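/- **Setting.** Let $N\ge 2$ (the case $\widehat{gl}(2)_c$ is $N=2$), let $\zeta,\tau,c\in\mathbb C$ with $\operatorname{Im}\zeta>0$, and put $q=e^{i\pi\zeta}$ (so $0<|q|<1$), $q^a=e^{i\pi\zeta a}$, $p=e^{2i\pi\tau}$, $p^{1/2}=e^{i\pi\tau}$, $\tau^*=\tau-c\zeta$, $p^*=e^{2i\pi\tau^*}=pq^{-2c}$, $p^{*1/2}=e^{i\pi\tau^*}$, $z=e^{i\pi\xi}$. Let $\Theta_a(x)=(x;a)_\infty(ax^{-1};a)_\infty(a;a)_\infty$, $$\mathcal U(z)=q^{\frac2N-2}\frac{\Theta_{q^{2N}}(q^2z^2)\,\Theta_{q^{2N}}(q^2z^{-2})}{\Theta_{q^{2N}}(z^2)\,\Theta_{q^{2N}}(z^{-2})},$$ $\mathcal F_a(z)=\prod_{k=0}^{a-1}\mathcal U((-p^{1/2})^kz)$ for $a\ge0$, $\mathcal F_a(z)=\prod_{k=1}^{|a|}\mathcal U((-p^{1/2})^{-k}z)^{-1}$ for $a<0$, let $\mathcal F^*_a$ be $\mathcal F_a$ with $p^{1/2}$ replaced by $p^{*1/2}$,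 and $$\mathcal Y_{mn}(z)=\frac{\mathcal F^*_n(z)\,\mathcal F^*_{-n}(z)}{\mathcal F_m(z)\,\mathcal F_{-m}(z)}\qquad(m,n\in\mathbb Z).$$ Let $\omega=e^{2i\pi/N}$, $g=\operatorname{diag}(\omega,\dots,\omega^N)$, $g^{1/2}=\operatorname{diag}(e^{i\pi j/N})_{1\le j\le N}$, $h_{ij}=\delta_{i+1,j}$ (indices mod $N$), $I_{(a,b)}=g^bh^a$, let $\vartheta_{a,b}(\xi)=\vartheta\!\left[\begin{smallmatrix}\frac12+a/N\\ \frac12+b/N\end{smallmatrix}\right](\xi,\tau)$, and let $$R(z,q,p)=(g^{1/2}\otimes g^{1/2})\Big(\frac{z^{2/N-2}}{\kappa(z^2)}\frac{\vartheta_{0,0}(\zeta)}{\vartheta_{0,0}(\xi+\zeta)}\sum_{a,b=0}^{N-1}\frac{\vartheta_{a,b}(\xi+\zeta/N)}{N\,\vartheta_{a,b}(\zeta/N)}\,I_{(a,b)}\otimes I_{(a,b)}^{-1}\Big)(g^{-1/2}\otimes g^{-1/2})$$ be Belavin's elliptic $R$-matrix (for $\operatorname{Im}\tau>0$; $z^{2/N-2}=e^{i\pi\xi(2/N-2)}$;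 the factors $\vartheta_{0,0}(\zeta)/\vartheta_{a,b}(\zeta/N)$ are extended by continuity where they read $0/0$), where $$\frac1{\kappa(z^2)}=\frac{(q^{2N}z^{-2},\,q^2z^2,\,pz^{-2},\,pq^{2N-2}z^2;\,p,q^{2N})_\infty}{(q^{2N}z^2,\,q^2z^{-2},\,pz^2,\,pq^{2N-2}z^{-2};\,p,q^{2N})_\infty}.$$ Let $\widehat R(z,q,p)=\tau_N(q^{1/2}z^{-1})R(z,q,p)$ with $\tau_N(z)=z^{2/N-2}\,\Theta_{q^{2N}}(qz^2)/\Theta_{q^{2N}}(qz^{-2})$, and $\widehat R^*(z)=\widehat R(z,q,p^*)$ (with $\tau$ replaced by $\tau^*$). Call $z\in\mathbb C^\times$ *generic* if $z^2$ is not a product of integer powers of $q^2,p,p^*$. The algebra $\mathcal A_{q,p}(\widehat{gl}(N)_c)$ is given by an invertible $N\times N$ matrix $L(z)$ with relations $$\widehat R_{12}(z/w)L_1(z)L_2(w)=L_2(w)L_1(z)\widehat R^*_{12}(z/w)\qquad(z/w\text{ generic}).$$ Here, as for $\widehat R$, $L(z)$ is a function of $\xi=\frac1{i\pi}\log z$,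 defined and invertible for $\xi$ in a set $D\subset\mathbb C$, and multiplication of the argument by $(-p^{*1/2})^n$ means $\xi\mapsto\xi+n(\tau^*+1)$. Put $$t_{mn}(z)=\operatorname{tr}\Big((g^{1/2}hg^{1/2})^{-m}\,L\big((-p^{*1/2})^nz\big)\,(g^{1/2}hg^{1/2})^{-n}\,L(z)^{-1}\Big).$$ **Proposition.** Let $m,n\in\mathbb Z$, let $(q,p,c)$ lie on the surface $\mathcal S_{mn}:\ (-p^{1/2})^m(-p^{*1/2})^n=q^{-N}$, and suppose that one of the following holds. * $|m|,|n|>1$, and for some nonzero integers $\lambda,\lambda'$ with $\lambda+\lambda'=1$: $\ c=\frac N{nm}(\lambda'm-\lambda n)$, $\ -p^{1/2}=q^{-N\lambda/m}$, $\ -p^{*1/2}=q^{-N\lambda'/n}$. * $|n|=1$, $|m|>1$, and for some $\lambda\in\frac1u\mathbb Z$, where $u=2$ or $u$ is a divisor of $m$ or of $m+n$: $$(\mathrm A_\lambda)\quad c=Nn(1-\lambda(m+n)),\quad -p^{1/2}=q^{-N\lambda},\quad -p^{*1/2}=q^{-Nn(1-\lambda m)}.$$ * $|m|=1$, $|n|>1$,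 and for some $\lambda'\in\frac1{u'}\mathbb Z$, where $u'=2$ or $u'$ is a divisor of $n$ or of $n+m$: $$(\mathrm B_{\lambda'})\quad c=Nm(\lambda'(n+m)-1),\quad -p^{1/2}=q^{-Nm(1-\lambda'n)},\quad -p^{*1/2}=q^{-N\lambda'}.$$ * $m=n=\pm1$, and $(\mathrm A_\lambda)$ holds for some $\lambda\in\frac12\mathbb Z$ or $(\mathrm B_{\lambda'})$ holds for some $\lambda'\in\frac12\mathbb Z$. * $m+n=0$, $n>0$ is odd, $\ c=\frac Nn$, $\ -p^{1/2}=q^{-\frac{n-1}{2n}N}$, $\ -p^{*1/2}=q^{-\frac{n+1}{2n}N}$. Then: 1. $\mathcal Y_{mn}(z)=1$ for all generic $z$. 2. Suppose moreover that $|p|<1$ and $|p^*|<1$ (so that $R$ and $R^*$ are defined) and, if $N>2$, that the equation of $\mathcal S_{mn}$ holds at the level of logarithms, $m(\tau+1)+n(\tau^*+1)\in -N\zeta+(2\mathbb Z\cap N\mathbb Z)$ (for $N=2$ this is the equation of $\mathcal S_{mn}$ itself). Then the $t_{mn}(z)$ generate an abelian subalgebra, in the following sense. * In the complex algebra generated by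 the entries of $L(z)$ and $L(z)^{-1}$, $\xi\in D$ ($D\subset\mathbb C$ any set), with the relations above, $t_{mn}(z)\,t_{mn}(w)=t_{mn}(w)\,t_{mn}(z)$ whenever $z/w$ is generic and both sides are defined. * If $D$ is open and $L$ is a function on $D$ with values in $N\times N$ matrices over a Hausdorff topological ring $A$ which is a $\mathbb C$-algebra, if $L$ is continuous with continuous inverse, and if it satisfies the relations above, then the subalgebra of $A$ generated by all $t_{mn}(z)$ with $\xi$ and $\xi+n(\tau^*+1)$ in $D$ is commutative. -/

import Mathlib

open scoped Kronecker Topology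

noncomputable section

namespace EllipticAlgebra

/-! ### Exponentials, infinite products, theta functions

All parameters are logarithmic: `z = e^{iπξ}`, `q = e^{iπζ}`, `p = e^{2iπτ}`.  In particular
`q^a = e^{iπζa}` for complex `a`, `p^{1/2} = e^{iπτ}`, and `p* = p q^{-2c}` corresponds to
`τ* = τ - cζ`, so that `p*^{1/2} = e^{iπτ*} = p^{1/2} q^{-c}`. -/

/-- `e^{iπx}`. -/
def ex (x : ℂ) : ℂ := Complex.exp (Real.pi * Complex.I * x)

/-- `q^a`, for `q = e^{iπζ}` and a complex exponent `a`. -/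
def qpow (ζ a : ℂ) : ℂ := ex (ζ * a)

/-- The logarithmic parameter `τ*` of `p* = p q^{-2c}`. -/
def tauStar (ζ τ c : ℂ) : ℂ := τ - c * ζ

/-- `(x; a)_∞ = ∏_{n ≥ 0} (1 - x aⁿ)`. -/
def poch (x a : ℂ) : ℂ := ∏' n : ℕ, (1 - x * a ^ n)

/-- `(x; a, b)_∞ = ∏_{n, n' ≥ 0} (1 - x aⁿ bⁿ')`. -/
def poch₂ (x a b : ℂ) : ℂ := ∏' n : ℕ × ℕ, (1 - x * a ^ n.1 * b ^ n.2)

/-- The Jacobi function `Θ_a(x) = (x; a)_∞ (a x⁻¹; a)_∞ (a; a)_∞`. -/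
def bigTheta (a x : ℂ) : ℂ := poch x a * poch (a * x⁻¹) a * poch a a

/-- The Jacobi theta function `ϑ[γ₁, γ₂](ξ, τ)` with characteristics. -/
def thetaChar (γ₁ γ₂ ξ τ : ℂ) : ℂ :=
  Complex.exp (Real.pi * Complex.I * γ₁ ^ 2 * τ + 2 * Real.pi * Complex.I * γ₁ * (ξ + γ₂)) *
    jacobiTheta₂ (ξ + γ₂ + γ₁ * τ) τ

/-- The defining series of the theta function with characteristics. -/
theorem thetaChar_eq_tsum (γ₁ γ₂ ξ τ : ℂ) :
    thetaChar γ₁ γ₂ ξ τ = ∑' m : ℤ, Complex.exp (Real.pi * Complex.I * (m + γ₁) ^ 2 * τ +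
      2 * Real.pi * Complex.I * (m + γ₁) * (ξ + γ₂)) := by
  unfold thetaChar jacobiTheta₂
  rw [← tsum_mul_left]
  congr 1
  funext m
  rw [jacobiTheta₂_term, ← Complex.exp_add]
  congr 1
  ring

/-! ### The elliptic R-matrix -/

/-- `g = diag(ω, ω², …, ω^N)`, `ω = e^{2iπ/N}`. -/
def gMat (N : ℕ) : Matrix (Fin N) (Fin N) ℂ :=
  Matrix.diagonal fun i => ex (2 * ((i : ℕ) + 1 : ℂ) / N)

/-- The square root `g^{1/2}` of `g`. -/
def gHalf (N : ℕ) : Matrix (Fin N) (Fin N) ℂ :=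
  Matrix.diagonal fun i => ex (((i : ℕ) + 1 : ℂ) / N)

/-- `h_{ij} = δ_{i+1,j}`, indices modulo `N`. -/
def hMat (N : ℕ) : Matrix (Fin N) (Fin N) ℂ :=
  Matrix.of fun i j => if ((i : ℕ) + 1) % N = (j : ℕ) then 1 else 0

/-- `g^{1/2} h g^{1/2}`. -/
def ghg (N : ℕ) : Matrix (Fin N) (Fin N) ℂ := gHalf N * hMat N * gHalf N

/-- `I_{(a,b)} = g^b h^a`. -/
def iMat (N a b : ℕ) : Matrix (Fin N) (Fin N) ℂ := gMat N ^ b * hMat N ^ a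

/-- The normalisation factor `1/κ(z²)`. -/
def kappaInv (N : ℕ) (ξ ζ τ : ℂ) : ℂ :=
  let y := ex (2 * ξ)
  let p := ex (2 * τ)
  let Q := ex (2 * N * ζ)
  let q2 := ex (2 * ζ)
  (poch₂ (Q * y⁻¹) p Q * poch₂ (q2 * y) p Q * poch₂ (p * y⁻¹) p Q *
      poch₂ (p * (Q * q2⁻¹) * y) p Q) /
    (poch₂ (Q * y) p Q * poch₂ (q2 * y⁻¹) p Q * poch₂ (p * y) p Q *
      poch₂ (p * (Q * q2⁻¹) * y⁻¹) p Q)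

/-- The coefficient
`ϑ[½,½](ζ) / ϑ[½,½](ξ+ζ) · ϑ[½+a/N,½+b/N](ξ+ζ/N) / (N ϑ[½+a/N,½+b/N](ζ/N))`
(theta functions of modulus `τ`).  The factor which depends on `ζ` and `τ` only is entire in `ζ`;
it is given its value by continuity where it takes the form `0/0`, that is, where
`ζ` is a point of `ℤ + τℤ` (`q² ∈ p^ℤ`). -/
def weight (N a b : ℕ) (ξ ζ τ : ℂ) : ℂ :=
  Filter.limUnder (𝓝[≠] ζ) (fun ζ' : ℂ =>
      thetaChar (1 / 2) (1 / 2) ζ' τ /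
        (N * thetaChar (1 / 2 + a / N) (1 / 2 + b / N) (ζ' / N) τ)) *
    (thetaChar (1 / 2 + a / N) (1 / 2 + b / N) (ξ + ζ / N) τ /
      thetaChar (1 / 2) (1 / 2) (ξ + ζ) τ)

/-- The matrix `𝒵(z, q, p)` of the `ℤ_N`-vertex model, as an endomorphism of `ℂ^N ⊗ ℂ^N`. -/
def zMat (N : ℕ) (ξ ζ τ : ℂ) : Matrix (Fin N × Fin N) (Fin N × Fin N) ℂ :=
  (ex (ξ * (2 / N - 2)) * kappaInv N ξ ζ τ) •
    ∑ a ∈ Finset.range N, ∑ b ∈ Finset.range N,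
      weight N a b ξ ζ τ • (iMat N a b ⊗ₖ (iMat N a b)⁻¹)

/-- The unitary elliptic R-matrix `R(z, q, p)`. -/
def rMat (N : ℕ) (ξ ζ τ : ℂ) : Matrix (Fin N × Fin N) (Fin N × Fin N) ℂ :=
  (gHalf N ⊗ₖ gHalf N) * zMat N ξ ζ τ * ((gHalf N)⁻¹ ⊗ₖ (gHalf N)⁻¹)

/-- `τ_N(z) = z^{2/N-2} Θ_{q^{2N}}(q z²) / Θ_{q^{2N}}(q z⁻²)`, at `z = e^{iπx}`. -/
def tauN (N : ℕ) (ζ x : ℂ) : ℂ :=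
  ex (x * (2 / N - 2)) * (bigTheta (ex (2 * N * ζ)) (ex ζ * ex (2 * x)) /
    bigTheta (ex (2 * N * ζ)) (ex ζ * ex (-(2 * x))))

/-- `R̂(z, q, p) = τ_N(q^{1/2} z⁻¹) R(z, q, p)`. -/
def rHat (N : ℕ) (ξ ζ τ : ℂ) : Matrix (Fin N × Fin N) (Fin N × Fin N) ℂ :=
  tauN N ζ (ζ / 2 - ξ) • rMat N ξ ζ τ

/-! ### The structure functions -/

/-- `𝒰(z) = q^{2/N-2} Θ(q² z²) Θ(q² z⁻²) / (Θ(z²) Θ(z⁻²))`, `Θ = Θ_{q^{2N}}`, at `z = e^{iπx}`. -/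
def uFun (N : ℕ) (ζ x : ℂ) : ℂ :=
  let T := bigTheta (ex (2 * N * ζ))
  qpow ζ (2 / N - 2) * (T (ex (2 * ζ) * ex (2 * x)) * T (ex (2 * ζ) * ex (-(2 * x))) /
    (T (ex (2 * x)) * T (ex (-(2 * x)))))

/-- `ℱ_a(z)` at `z = e^{iπx}`: the product of `𝒰((-p^{1/2})^k z)` over `0 ≤ k < a` if `a ≥ 0`, and of
`𝒰((-p^{1/2})^{-k} z)⁻¹` over `1 ≤ k ≤ |a|` if `a < 0`.  Here `-p^{1/2} = e^{iπ(τ+1)}`. -/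
def fFun (N : ℕ) (ζ τ : ℂ) : ℤ → ℂ → ℂ
  | Int.ofNat a, x => ∏ k ∈ Finset.range a, uFun N ζ (x + k * (τ + 1))
  | Int.negSucc a, x => ∏ k ∈ Finset.range (a + 1), (uFun N ζ (x - (k + 1) * (τ + 1)))⁻¹

/-- `𝒴_{mn} = ℱ*_n ℱ*_{-n} / (ℱ_m ℱ_{-m})`, where `ℱ*` is `ℱ` with `p` replaced by `p*`. -/
def yFun (N : ℕ) (ζ τ c : ℂ) (m n : ℤ) (x : ℂ) : ℂ :=
  fFun N ζ (tauStar ζ τ c) n x * fFun N ζ (tauStar ζ τ c) (-n) x /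
    (fFun N ζ τ m x * fFun N ζ τ (-m) x)

/-- `z = e^{iπx}` is such that `z²` is not a product of integer powers of `q²`, `p`, `p*`.  All zeros
and poles of the entries of `R̂`, `R̂*` and of the structure functions are excluded by this. -/
def Generic (ζ τ c x : ℂ) : Prop :=
  ∀ a b d k : ℤ, x ≠ a * ζ + b * τ + d * tauStar ζ τ c + k

/-! ### The elliptic quantum algebra -/

section Relations

variable {A : Type*} [Ring A] [Algebra ℂ A] {N : ℕ}

/-- `R₁₂ L₁ L'₂`, with `L₁ = L ⊗ 𝕀` and `L'₂ = 𝕀 ⊗ L'`. -/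
def rllLeft (R : Matrix (Fin N × Fin N) (Fin N × Fin N) ℂ) (L L' : Matrix (Fin N) (Fin N) A) :
    Matrix (Fin N × Fin N) (Fin N × Fin N) A :=
  R.map (algebraMap ℂ A) * (L ⊗ₖ (1 : Matrix (Fin N) (Fin N) A)) *
    ((1 : Matrix (Fin N) (Fin N) A) ⊗ₖ L')

/-- `L'₂ L₁ R₁₂`. -/
def rllRight (R : Matrix (Fin N × Fin N) (Fin N × Fin N) ℂ) (L L' : Matrix (Fin N) (Fin N) A) :
    Matrix (Fin N × Fin N) (Fin N × Fin N) A :=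
  ((1 : Matrix (Fin N) (Fin N) A) ⊗ₖ L') * (L ⊗ₖ (1 : Matrix (Fin N) (Fin N) A)) *
    R.map (algebraMap ℂ A)

end Relations

/-- The generators: the values at the points `ξ ∈ D` of the entries of `L(z)` and of `L(z)⁻¹`,
`z = e^{iπξ}`. -/
inductive Gen (N : ℕ) (D : Set ℂ) : Type
  | L (i j : Fin N) (ξ : D) : Gen N D
  | Linv (i j : Fin N) (ξ : D) : Gen N D

open Classical in
/-- The matrix `L(z)` of free generators (extended by `0` outside `D`). -/
def freeL (N : ℕ) (D : Set ℂ) (ξ : ℂ) : Matrix (Fin N) (Fin N) (FreeAlgebra ℂ (Gen N D)) :=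
  Matrix.of fun i j => if h : ξ ∈ D then FreeAlgebra.ι ℂ (Gen.L i j ⟨ξ, h⟩) else 0

open Classical in
/-- The matrix `L(z)⁻¹` of free generators (extended by `0` outside `D`). -/
def freeLinv (N : ℕ) (D : Set ℂ) (ξ : ℂ) : Matrix (Fin N) (Fin N) (FreeAlgebra ℂ (Gen N D)) :=
  Matrix.of fun i j => if h : ξ ∈ D then FreeAlgebra.ι ℂ (Gen.Linv i j ⟨ξ, h⟩) else 0

/-- The defining relations: `R̂₁₂(z/w) L₁(z) L₂(w) = L₂(w) L₁(z) R̂*₁₂(z/w)` for generic `z/w`, and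
the two relations expressing that `L(z)⁻¹` is inverse to `L(z)`. -/
inductive Rel (N : ℕ) (ζ τ c : ℂ) (D : Set ℂ) :
    FreeAlgebra ℂ (Gen N D) → FreeAlgebra ℂ (Gen N D) → Prop
  | rll (ξ η : ℂ) (hξ : ξ ∈ D) (hη : η ∈ D) (hg : Generic ζ τ c (ξ - η)) (i j : Fin N × Fin N) :
      Rel N ζ τ c D
        (rllLeft (rHat N (ξ - η) ζ τ) (freeL N D ξ) (freeL N D η) i j)
        (rllRight (rHat N (ξ - η) ζ (tauStar ζ τ c)) (freeL N D ξ) (freeL N D η) i j)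
  | mul_inv (ξ : ℂ) (hξ : ξ ∈ D) (i j : Fin N) :
      Rel N ζ τ c D ((freeL N D ξ * freeLinv N D ξ) i j)
        ((1 : Matrix (Fin N) (Fin N) (FreeAlgebra ℂ (Gen N D))) i j)
  | inv_mul (ξ : ℂ) (hξ : ξ ∈ D) (i j : Fin N) :
      Rel N ζ τ c D ((freeLinv N D ξ * freeL N D ξ) i j)
        ((1 : Matrix (Fin N) (Fin N) (FreeAlgebra ℂ (Gen N D))) i j)

/-- The elliptic quantum algebra `𝒜_{q,p}(gl(N)^)_c`, presented by the values of the invertible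
current matrix `L(z)` at `z = e^{iπξ}`, `ξ ∈ D`, subject to the relations `Rel`. -/
abbrev Alg (N : ℕ) (ζ τ c : ℂ) (D : Set ℂ) : Type := RingQuot (Rel N ζ τ c D)

/-- The current matrix `L(z)`, `z = e^{iπξ}`, of the elliptic quantum algebra. -/
def algL (N : ℕ) (ζ τ c : ℂ) (D : Set ℂ) (ξ : ℂ) : Matrix (Fin N) (Fin N) (Alg N ζ τ c D) :=
  (freeL N D ξ).map (RingQuot.mkAlgHom ℂ (Rel N ζ τ c D))

/-- The inverse current matrix `L(z)⁻¹`, `z = e^{iπξ}`, of the elliptic quantum algebra. -/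
def algLinv (N : ℕ) (ζ τ c : ℂ) (D : Set ℂ) (ξ : ℂ) : Matrix (Fin N) (Fin N) (Alg N ζ τ c D) :=
  (freeLinv N D ξ).map (RingQuot.mkAlgHom ℂ (Rel N ζ τ c D))

/-- A continuous realisation of the elliptic quantum algebra in a topological algebra `A`: the matrix
`L(z)`, `z = e^{iπξ}`, is a function of `ξ` in the open set `D` with values in `Mat_N(A)`, continuous
and with continuous two-sided inverse `Linv`, and it satisfies the exchange relations.  An example of
such a function is the sum of a series `L_{ij}(z) = ∑_{n ∈ ℤ} L_{ij}[n] zⁿ` on an open set where the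
series converges to a continuous, continuously invertible matrix. -/
structure IsRealization (N : ℕ) (ζ τ c : ℂ) (D : Set ℂ) {A : Type*} [Ring A] [Algebra ℂ A]
    [TopologicalSpace A] (L Linv : ℂ → Matrix (Fin N) (Fin N) A) : Prop where
  isOpen : IsOpen D
  continuousOn_L : ContinuousOn L D
  continuousOn_Linv : ContinuousOn Linv D
  mul_inv : ∀ ξ ∈ D, L ξ * Linv ξ = 1
  inv_mul : ∀ ξ ∈ D, Linv ξ * L ξ = 1
  rll : ∀ ξ ∈ D, ∀ η ∈ D, Generic ζ τ c (ξ - η) →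
    rllLeft (rHat N (ξ - η) ζ τ) (L ξ) (L η) =
      rllRight (rHat N (ξ - η) ζ (tauStar ζ τ c)) (L ξ) (L η)

/-! ### The generators `t_{mn}(z)` -/

/-- The logarithm of `(-p*^{1/2})^n`: multiplication of `z` by `(-p*^{1/2})^n` is translation of `ξ` by
`n (τ* + 1)`. -/
def shift (ζ τ c : ℂ) (n : ℤ) : ℂ := n * (tauStar ζ τ c + 1)

/-- `t_{mn}(z) = tr ((g^{1/2} h g^{1/2})^{-m} L((-p*^{1/2})^n z) (g^{1/2} h g^{1/2})^{-n} L(z)⁻¹)`,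
at `z = e^{iπξ}`. -/
def tGen (N : ℕ) (ζ τ c : ℂ) (m n : ℤ) {A : Type*} [Ring A] [Algebra ℂ A]
    (L Linv : ℂ → Matrix (Fin N) (Fin N) A) (ξ : ℂ) : A :=
  Matrix.trace (((ghg N) ^ (-m)).map (algebraMap ℂ A) * L (ξ + shift ζ τ c n) *
    ((ghg N) ^ (-n)).map (algebraMap ℂ A) * Linv ξ)

/-- The set of points at which both factors `L` of `t_{mn}` are evaluated inside `D`. -/
def tDomain (ζ τ c : ℂ) (n : ℤ) (D : Set ℂ) : Set ℂ := {ξ | ξ ∈ D ∧ ξ + shift ζ τ c n ∈ D}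

/-! ### The surfaces and the sufficient conditions -/

/-- `-p^{1/2}`; with `τ*` in place of `τ` this is `-p*^{1/2}`. -/
def negSqrtP (τ : ℂ) : ℂ := -ex τ

/-- The surface `𝒮_{mn}`: `(-p^{1/2})^m (-p*^{1/2})^n = q^{-N}`. -/
def OnSurface (N : ℕ) (ζ τ c : ℂ) (m n : ℤ) : Prop :=
  negSqrtP τ ^ m * negSqrtP (tauStar ζ τ c) ^ n = qpow ζ (-N)

/-- The equation of the surface `𝒮_{mn}`, `m (τ+1) + n (τ*+1) + N ζ ∈ 2ℤ`, on the covering on which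
`R̂` is single-valued.  For `N > 2` the matrix `R̂` is a function of `ξ`, not of `z = e^{iπξ}`: it
satisfies `R̂(ξ+1) = (g ⊗ 𝕀)⁻¹ R̂(ξ) (g ⊗ 𝕀)`, hence has period `N`, and the equation has
to hold modulo `2ℤ ∩ Nℤ`.  For `N = 2` this is the equation of the surface itself. -/
def OnSurfaceCover (N : ℕ) (ζ τ c : ℂ) (m n : ℤ) : Prop :=
  ∃ k : ℤ, (N : ℤ) ∣ 2 * k ∧
    m * (τ + 1) + n * (tauStar ζ τ c + 1) = -(N * ζ) + 2 * k

/-- The parametrised condition used when `|n| = 1`. -/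
def CondN (N : ℕ) (ζ τ c : ℂ) (m n : ℤ) (l : ℚ) : Prop :=
  c = N * n * (1 - l * (m + n)) ∧
  negSqrtP τ = qpow ζ (-(N * l)) ∧
  negSqrtP (tauStar ζ τ c) = qpow ζ (-(N * n * (1 - l * m)))

/-- The parametrised condition used when `|m| = 1`. -/
def CondM (N : ℕ) (ζ τ c : ℂ) (m n : ℤ) (l' : ℚ) : Prop :=
  c = N * m * (l' * (n + m) - 1) ∧
  negSqrtP τ = qpow ζ (-(N * m * (1 - l' * n))) ∧
  negSqrtP (tauStar ζ τ c) = qpow ζ (-(N * l'))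

/-- The sufficient conditions for `t_{mn}` to generate an abelian subalgebra. -/
inductive AbelianCondition (N : ℕ) (ζ τ c : ℂ) (m n : ℤ) : Prop
  /-- `|m|, |n| > 1`. -/
  | big (hm : 1 < |m|) (hn : 1 < |n|) (l l' : ℤ) (hl : l ≠ 0) (hl' : l' ≠ 0) (hsum : l + l' = 1)
      (hc : c = N / (n * m) * (l' * m - l * n))
      (hp : negSqrtP τ = qpow ζ (-(N * l / m)))
      (hps : negSqrtP (tauStar ζ τ c) = qpow ζ (-(N * l' / n)))
  /-- `|n| = 1`, `|m| > 1`, with `l ∈ ℤ/u`, where `u = 2` or `u` divides `m` or `m + n`. -/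
  | absN (hn : |n| = 1) (hm : 1 < |m|) (a u : ℤ) (hu : u = 2 ∨ u ∣ m ∨ u ∣ m + n)
      (h : CondN N ζ τ c m n (a / u))
  /-- `|m| = 1`, `|n| > 1`, with `l' ∈ ℤ/u'`, where `u' = 2` or `u'` divides `n` or `n + m`. -/
  | absM (hm : |m| = 1) (hn : 1 < |n|) (a u : ℤ) (hu : u = 2 ∨ u ∣ n ∨ u ∣ n + m)
      (h : CondM N ζ τ c m n (a / u))
  /-- `m = n = ±1`, with a half-integer parameter, in either form. -/
  | diag (hmn : m = n) (hm : |m| = 1) (a : ℤ)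
      (h : CondN N ζ τ c m n (a / 2) ∨ CondM N ζ τ c m n (a / 2))
  /-- `m + n = 0`, with `n` positive and odd. -/
  | antidiag (hmn : m + n = 0) (hn : 0 < n) (hodd : Odd n)
      (hc : c = N / n)
      (hp : negSqrtP τ = qpow ζ (-((n - 1) / (2 * n) * N)))
      (hps : negSqrtP (tauStar ζ τ c) = qpow ζ (-((n + 1) / (2 * n) * N)))

end EllipticAlgebra

end

noncomputable section

namespace EllipticAlgebra

/-! ### The exponential `ex` -/

/-! Write `M = ghg N`, `x = ξ - η`, and `U` for `uFun`. The elliptic R-matrix has four symmetries.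
Unitarity reads `R̂(x) R̂₂₁(-x) = U(x)`. Crossing is the analogous identity for partial transposes
at arguments with sum `-Nζ`. Translation of the argument by `τ + 1` is conjugation by `M₁` up to the
factor `U⁻¹`. Finally, `M ⊗ M` commutes with `R̂`.

Crossing glues two traces into one trace over `ℂ^N ⊗ ℂ^N`, with an R-matrix inserted between
`L(z)⁻¹` and the shifted `L(w)`. The exchange relation then brings both `L` to the left and both
inverses to the right. On the surface `𝒮_{mn}` the crossing partner of the inserted argument is `x +
m(τ+1)`, which quasi-periodicity in `p` reduces to `x`; this gives `tGen_mul_tGen`. Inserting `R̂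
R̂₂₁ = U` and exchanging both pairs reverses the order of `ξ` and `η`. The scalars left over combine
into `𝒴_{mn}(x)`, so `𝒴_{mn} = 1` gives commutation (`commute_tGen`).

That `𝒴_{mn} = 1` is elementary: `U` is even with periods `1` and `Nζ`, and each listed condition
makes the products `ℱ_a ℱ_{-a}` telescope, either to `1` or to a ratio of two values of `U`
(`yFun_eq_one`).

The symmetries of `R̂` rest on sums over the `N²` torsion points. As functions of `ζ`, twisted sums
of products of two regularised weights are theta functions of degree two, because translating `ζ` by
a period merely permutes the torsion points. Such functions are determined by their zeros and
symmetry, by division by the odd theta function and Liouville's theorem (`sum_regWeight_crossing`,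
`sum_regWeight_unitarity_off`, `sum_regWeight_unitarity_diag`). The scalar `1/κ` is a ratio of
elliptic gamma functions, whose difference equations supply the remaining factors.

In a topological realisation, commutation at generic differences extends to all differences by
continuity, since non-generic points form a countable set. -/

theorem ex_zero : ex 0 = 1 := by simp [ex]

theorem ex_add (x y : ℂ) : ex (x + y) = ex x * ex y := by
  rw [ex, ex, ex, ← Complex.exp_add]; ring_nf

theorem ex_ne_zero (x : ℂ) : ex x ≠ 0 := Complex.exp_ne_zero _

theorem ex_neg (x : ℂ) : ex (-x) = (ex x)⁻¹ := by
  rw [ex, ex, ← Complex.exp_neg]; ring_nf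

theorem ex_sub (x y : ℂ) : ex (x - y) = ex x / ex y := by
  rw [sub_eq_add_neg, ex_add, ex_neg, div_eq_mul_inv]

theorem ex_nat_mul (n : ℕ) (x : ℂ) : ex (n * x) = ex x ^ n := by
  rw [ex, ex, ← Complex.exp_nat_mul]; ring_nf

theorem ex_int_mul (n : ℤ) (x : ℂ) : ex (n * x) = ex x ^ n := by
  rw [ex, ex, ← Complex.exp_int_mul]; ring_nf

theorem ex_one : ex 1 = -1 := by simp [ex, Complex.exp_pi_mul_I]

theorem ex_two : ex 2 = 1 := by
  rw [← one_add_one_eq_two, ex_add, ex_one]; norm_num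

theorem ex_eq_one_iff (x : ℂ) : ex x = 1 ↔ ∃ k : ℤ, x = 2 * k := by
  rw [ex, Complex.exp_eq_one_iff]
  have h : (Real.pi : ℂ) * Complex.I ≠ 0 :=
    mul_ne_zero (Complex.ofReal_ne_zero.2 Real.pi_ne_zero) Complex.I_ne_zero
  refine exists_congr fun k => ⟨fun e => mul_left_cancel₀ h ?_, fun e => ?_⟩
  · rw [e]; ring
  · rw [e]; ring

theorem ex_eq_ex_iff (x y : ℂ) : ex x = ex y ↔ ∃ k : ℤ, x = y + 2 * k := by
  rw [← div_eq_one_iff_eq (ex_ne_zero y), ← ex_sub, ex_eq_one_iff]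
  exact exists_congr fun k => sub_eq_iff_eq_add'

theorem norm_ex (x : ℂ) : ‖ex x‖ = Real.exp (-(Real.pi * x.im)) := by
  rw [ex, Complex.norm_exp]; simp

theorem norm_ex_lt_one {x : ℂ} (h : 0 < x.im) : ‖ex x‖ < 1 := by
  rw [norm_ex, Real.exp_lt_one_iff]; have := mul_pos Real.pi_pos h; linarith

theorem differentiable_ex : Differentiable ℂ ex := by unfold ex; fun_prop

theorem continuous_ex : Continuous ex := differentiable_ex.continuous

/-! ### Infinite products -/

theorem summable_norm_mul_pow {a : ℂ} (ha : ‖a‖ < 1) (x : ℂ) :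
    Summable fun n : ℕ => ‖-(x * a ^ n)‖ := by
  simpa [norm_neg, norm_mul, norm_pow] using
    (summable_geometric_of_lt_one (norm_nonneg a) ha).mul_left ‖x‖

theorem multipliable_poch {a : ℂ} (ha : ‖a‖ < 1) (x : ℂ) :
    Multipliable fun n : ℕ => 1 - x * a ^ n := by
  simpa [sub_eq_add_neg] using multipliable_one_add_of_summable (summable_norm_mul_pow ha x)

theorem poch_eq_mul {a : ℂ} (ha : ‖a‖ < 1) (x : ℂ) : poch x a = (1 - x) * poch (x * a) a := by
  unfold poch
  have e : ∀ n : ℕ, 1 - x * a ^ (n + 1) = 1 - x * a * a ^ n := fun n => by ring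
  rw [tprod_eq_zero_mul']
  · simp only [e, pow_zero, mul_one]
  · simpa only [e] using multipliable_poch ha (x * a)

theorem poch_ne_zero {a : ℂ} (ha : ‖a‖ < 1) {x : ℂ} (h : ∀ n : ℕ, x * a ^ n ≠ 1) :
    poch x a ≠ 0 := by
  have := tprod_one_add_ne_zero_of_summable (f := fun n : ℕ => -(x * a ^ n))
    (fun n => by rw [← sub_eq_add_neg]; exact sub_ne_zero.2 (h n).symm)
    (summable_norm_mul_pow ha x)
  simpa [poch, sub_eq_add_neg] using this

theorem poch_one (a : ℂ) : poch 1 a = 0 :=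
  tprod_of_exists_eq_zero ⟨0, by simp⟩

theorem poch_self_ne_zero {a : ℂ} (ha : ‖a‖ < 1) : poch a a ≠ 0 := by
  refine poch_ne_zero ha fun n e => ?_
  have h : ‖a * a ^ n‖ = 1 := by rw [e, norm_one]
  rw [← pow_succ', norm_pow] at h
  exact (pow_lt_one₀ (norm_nonneg a) ha n.succ_ne_zero).ne h

theorem differentiable_poch {a : ℂ} (ha : ‖a‖ < 1) : Differentiable ℂ fun x => poch x a := by
  have key : ∀ r : ℝ, DifferentiableOn ℂ (fun x => poch x a) (Metric.ball 0 r) := by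
    intro r
    have hu : Summable fun n : ℕ => r * ‖a‖ ^ n :=
      (summable_geometric_of_lt_one (norm_nonneg a) ha).mul_left r
    have := (hu.hasProdLocallyUniformlyOn_nat_one_add (f := fun (n : ℕ) (x : ℂ) => -(x * a ^ n))
      (Metric.isOpen_ball (x := (0 : ℂ)) (ε := r)) (.of_forall fun n x hx => by
        rw [norm_neg, norm_mul, norm_pow]
        have : ‖x‖ < r := by simpa using hx
        gcongr) (fun n => by fun_prop)).differentiableOn
        (.of_forall fun _ => by
          simpa [Finset.prod_fn] using DifferentiableOn.finsetProd (fun _ _ => by fun_prop))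
        Metric.isOpen_ball
    simpa [poch, sub_eq_add_neg] using this
  intro x
  exact (key (‖x‖ + 1)).differentiableAt (Metric.isOpen_ball.mem_nhds (by simp))

/-! ### The function `Θ_a` -/

theorem bigTheta_inv {a : ℂ} (ha : ‖a‖ < 1) {x : ℂ} (hx : x ≠ 0) :
    bigTheta a x⁻¹ = -x⁻¹ * bigTheta a x := by
  unfold bigTheta
  rw [inv_inv, poch_eq_mul ha x, poch_eq_mul ha x⁻¹, mul_comm a x, mul_comm a x⁻¹]
  field_simp
  ring

theorem bigTheta_mul {a : ℂ} (ha : ‖a‖ < 1) (ha0 : a ≠ 0) {x : ℂ} (hx : x ≠ 0) :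
    bigTheta a (a * x) = -x⁻¹ * bigTheta a x := by
  rw [← bigTheta_inv ha hx]
  unfold bigTheta
  rw [mul_inv, mul_inv_cancel_left₀ ha0, inv_inv, mul_comm (poch (a * x) a)]

theorem bigTheta_ne_zero {a : ℂ} (ha : ‖a‖ < 1) {x : ℂ} (hx : x ≠ 0)
    (h : ∀ k : ℤ, x ≠ a ^ k) : bigTheta a x ≠ 0 := by
  refine mul_ne_zero (mul_ne_zero (poch_ne_zero ha fun n e => ?_) (poch_ne_zero ha fun n e => ?_))
    (poch_self_ne_zero ha)
  · apply h (-n); rw [zpow_neg, zpow_natCast]; exact eq_inv_of_mul_eq_one_left e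
  · apply h (n + 1)
    have : a ^ (n + 1) = x := by
      rw [← mul_one x, ← e]; field_simp; ring
    exact_mod_cast this.symm

/-! ### The odd theta function -/

/-- The product form of the odd theta function of modulus `τ`, up to a constant factor. -/
def oddTheta (τ ξ : ℂ) : ℂ := ex (-ξ) * bigTheta (ex (2 * τ)) (ex (2 * ξ))

section

variable {τ : ℂ}

theorem oddTheta_zero : oddTheta τ 0 = 0 := by
  simp [oddTheta, bigTheta, ex_zero, poch_one]

theorem oddTheta_add_one (ξ : ℂ) : oddTheta τ (ξ + 1) = -oddTheta τ ξ := by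
  unfold oddTheta
  rw [neg_add, ex_add, mul_add, ex_add, mul_one, ex_two, ex_neg 1, ex_one]
  ring_nf

variable (hτ : 0 < τ.im)
include hτ

theorem norm_ex_two_mul_lt_one : ‖ex (2 * τ)‖ < 1 := norm_ex_lt_one (by simpa using hτ)

theorem oddTheta_add_tau (ξ : ℂ) : oddTheta τ (ξ + τ) = -ex (-2 * ξ - τ) * oddTheta τ ξ := by
  unfold oddTheta
  rw [mul_add, ex_add (2 * ξ), mul_comm (ex (2 * ξ)),
    bigTheta_mul (norm_ex_two_mul_lt_one hτ) (ex_ne_zero _) (ex_ne_zero _), ← ex_neg]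
  have : ex (-(ξ + τ)) * ex (-(2 * ξ)) = ex (-2 * ξ - τ) * ex (-ξ) := by
    rw [← ex_add, ← ex_add]; ring_nf
  linear_combination -bigTheta (ex (2 * τ)) (ex (2 * ξ)) * this

theorem oddTheta_neg (ξ : ℂ) : oddTheta τ (-ξ) = -oddTheta τ ξ := by
  unfold oddTheta
  rw [mul_neg, ex_neg (2 * ξ), bigTheta_inv (norm_ex_two_mul_lt_one hτ) (ex_ne_zero _), ← ex_neg,
    neg_neg]
  have : ex ξ * ex (-(2 * ξ)) = ex (-ξ) := by rw [← ex_add]; ring_nf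
  linear_combination -bigTheta (ex (2 * τ)) (ex (2 * ξ)) * this

theorem differentiable_oddTheta : Differentiable ℂ (oddTheta τ) := by
  have hp := differentiable_poch (norm_ex_two_mul_lt_one hτ)
  have h1 : Differentiable ℂ fun ξ : ℂ => ex (-ξ) := differentiable_ex.comp differentiable_neg
  have h2 : Differentiable ℂ fun ξ : ℂ => poch (ex (2 * ξ)) (ex (2 * τ)) :=
    hp.comp (differentiable_ex.comp (by fun_prop : Differentiable ℂ fun ξ : ℂ => 2 * ξ))
  have h3 : Differentiable ℂ fun ξ : ℂ => poch (ex (2 * τ) * (ex (2 * ξ))⁻¹) (ex (2 * τ)) := by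
    simp only [← ex_neg, ← ex_add]
    exact hp.comp (differentiable_ex.comp
      (by fun_prop : Differentiable ℂ fun ξ : ℂ => 2 * τ + -(2 * ξ)))
  exact h1.mul ((h2.mul h3).mul_const _)

theorem oddTheta_add_int_add_int_mul (ξ : ℂ) (a b : ℤ) :
    oddTheta τ (ξ + a + b * τ) = ex (a + b - 2 * b * ξ - b ^ 2 * τ) * oddTheta τ ξ := by
  have h1 : ∀ (a : ℤ) (ξ : ℂ), oddTheta τ (ξ + a) = ex a * oddTheta τ ξ := by
    intro a ξ
    induction a with
    | zero => simp [ex_zero]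
    | succ n ih =>
      push_cast at ih ⊢
      rw [← add_assoc, oddTheta_add_one, ih, ex_add, ex_one]; ring
    | pred n ih =>
      have := oddTheta_add_one (τ := τ) (ξ + ((-n - 1 : ℤ) : ℂ))
      push_cast at ih this ⊢
      rw [show ξ + (-(n : ℂ) - 1) + 1 = ξ + -n by ring, ih] at this
      rw [ex_sub, ex_one]
      linear_combination this
  have h2 : ∀ (b : ℤ) (ξ : ℂ),
      oddTheta τ (ξ + b * τ) = ex (b - 2 * b * ξ - b ^ 2 * τ) * oddTheta τ ξ := by
    intro b ξ
    induction b with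
    | zero => simp [ex_zero]
    | succ n ih =>
      push_cast at ih ⊢
      rw [show ξ + ((n : ℂ) + 1) * τ = ξ + n * τ + τ by ring, oddTheta_add_tau hτ, ih,
        show (n : ℂ) + 1 - 2 * (n + 1) * ξ - (n + 1) ^ 2 * τ =
          (-2 * (ξ + n * τ) - τ) + (n - 2 * n * ξ - n ^ 2 * τ) + 1 by ring, ex_add, ex_add, ex_one]
      ring
    | pred n ih =>
      have := oddTheta_add_tau hτ (ξ + ((-n - 1 : ℤ) : ℂ) * τ)
      push_cast at ih this ⊢
      rw [show ξ + (-(n : ℂ) - 1) * τ + τ = ξ + -n * τ by ring, ih,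
        show -(n : ℂ) - 2 * -n * ξ - (-n) ^ 2 * τ = (-2 * (ξ + (-(n : ℂ) - 1) * τ) - τ) +
          (-n - 1 - 2 * (-n - 1) * ξ - (-n - 1) ^ 2 * τ) + 1 by ring, ex_add, ex_add, ex_one] at this
      have h := ex_ne_zero (-2 * (ξ + (-(n : ℂ) - 1) * τ) - τ)
      apply mul_left_cancel₀ h
      linear_combination this
  rw [h2, h1, ← mul_assoc, ← ex_add]
  -- Combining the two translations leaves the extra term `-2ab`, an even integer, on which `ex` is
  -- `1`.
  have : (b : ℂ) - 2 * b * (ξ + a) - b ^ 2 * τ + a =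
      a + b - 2 * b * ξ - b ^ 2 * τ + 2 * ((-(b * a) : ℤ) : ℂ) := by push_cast; ring
  rw [this, ex_add _ (2 * _), (ex_eq_one_iff _).2 ⟨_, rfl⟩, mul_one]

theorem oddTheta_eq_zero_iff (ξ : ℂ) : oddTheta τ ξ = 0 ↔ ∃ a b : ℤ, ξ = a + b * τ := by
  constructor
  · intro h
    by_contra hne
    refine mul_ne_zero (ex_ne_zero _) (bigTheta_ne_zero (norm_ex_two_mul_lt_one hτ)
      (ex_ne_zero _) fun k e => hne ?_) h
    rw [← ex_int_mul, ex_eq_ex_iff] at e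
    obtain ⟨j, e⟩ := e
    exact ⟨j, k, by linear_combination e / 2⟩
  · rintro ⟨a, b, rfl⟩
    have := oddTheta_add_int_add_int_mul hτ 0 a b
    rw [oddTheta_zero, mul_zero, zero_add] at this
    exact this

/-- At the origin the factor `1 - ex (2ξ)` splits off with a nonvanishing cofactor;
quasi-periodicity carries this to every lattice point. Simplicity of the zeros is what makes
division by `oddTheta` possible among entire functions. -/
theorem deriv_oddTheta_ne_zero {ξ : ℂ} (h : oddTheta τ ξ = 0) : deriv (oddTheta τ) ξ ≠ 0 := by
  have ha := norm_ex_two_mul_lt_one hτ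
  have h0 : deriv (oddTheta τ) 0 ≠ 0 := by
    set T : ℂ → ℂ := fun ξ => ex (-ξ) * (poch (ex (2 * ξ) * ex (2 * τ)) (ex (2 * τ)) *
      poch (ex (2 * τ) * (ex (2 * ξ))⁻¹) (ex (2 * τ)) * poch (ex (2 * τ)) (ex (2 * τ))) with hT
    have hTd : DifferentiableAt ℂ T 0 := by
      have hp := differentiable_poch ha
      have h1 : Differentiable ℂ fun ξ : ℂ => ex (-ξ) := differentiable_ex.comp differentiable_neg
      have h2 : Differentiable ℂ fun ξ : ℂ => poch (ex (2 * ξ) * ex (2 * τ)) (ex (2 * τ)) := by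
        simp only [← ex_add]
        exact hp.comp (differentiable_ex.comp
          (by fun_prop : Differentiable ℂ fun ξ : ℂ => 2 * ξ + 2 * τ))
      have h3 : Differentiable ℂ fun ξ : ℂ => poch (ex (2 * τ) * (ex (2 * ξ))⁻¹) (ex (2 * τ)) := by
        simp only [← ex_neg, ← ex_add]
        exact hp.comp (differentiable_ex.comp
          (by fun_prop : Differentiable ℂ fun ξ : ℂ => 2 * τ + -(2 * ξ)))
      exact (h1.mul ((h2.mul h3).mul_const _)) 0
    have hS : oddTheta τ = (fun ξ => 1 - ex (2 * ξ)) * T := by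
      funext ξ
      rw [Pi.mul_apply, oddTheta, bigTheta, poch_eq_mul ha (ex (2 * ξ)), hT]
      ring
    have he : HasDerivAt (fun ξ : ℂ => 1 - ex (2 * ξ)) (-(Real.pi * Complex.I * 2)) 0 := by
      have : HasDerivAt (fun ξ : ℂ => Complex.exp (Real.pi * Complex.I * (2 * ξ)))
          (Complex.exp (Real.pi * Complex.I * (2 * 0)) * (Real.pi * Complex.I * (2 * 1))) 0 :=
        (((hasDerivAt_id (0 : ℂ)).const_mul 2).const_mul _).cexp
      simpa [ex] using this.const_sub 1
    rw [hS, (he.mul hTd.hasDerivAt).deriv]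
    simp only [mul_zero, ex_zero, sub_self, zero_mul, add_zero]
    refine mul_ne_zero (neg_ne_zero.2 (by simp [Real.pi_ne_zero])) ?_
    simp only [hT, mul_zero, neg_zero, ex_zero, one_mul, inv_one, mul_one]
    have := poch_self_ne_zero ha
    exact mul_ne_zero (mul_ne_zero this this) this
  obtain ⟨a, b, rfl⟩ := (oddTheta_eq_zero_iff hτ ξ).1 h
  set l : ℂ := a + b * τ
  have e : ∀ x, oddTheta τ x * ex (a + b - 2 * b * x - b ^ 2 * τ) = oddTheta τ (x + l) := by
    intro x
    rw [mul_comm, ← oddTheta_add_int_add_int_mul hτ, add_assoc]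
  have h1 : HasDerivAt (fun x => oddTheta τ (x + l)) (deriv (oddTheta τ) l) 0 := by
    have := (differentiable_oddTheta hτ (0 + l)).hasDerivAt.comp_add_const 0 l
    simpa using this
  have h2 := (differentiable_oddTheta hτ 0).hasDerivAt.mul
    ((differentiable_ex.comp (by fun_prop : Differentiable ℂ
      fun x : ℂ => (a + b - 2 * b * x - b ^ 2 * τ : ℂ))) 0).hasDerivAt
  have h3 := h1.unique (h2.congr_of_eventuallyEq (.of_forall fun x => (e x).symm))
  rw [h3, oddTheta_zero, zero_mul, add_zero]
  exact mul_ne_zero h0 (ex_ne_zero _)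

end

/-! ### Division of entire functions, and Liouville's theorem for quasi-periodic functions -/

theorem eventually_ne_zero_of_simple_zeros {g : ℂ → ℂ} (hg : Differentiable ℂ g)
    (hg' : ∀ x, g x = 0 → deriv g x ≠ 0) (x : ℂ) : ∀ᶠ y in 𝓝[≠] x, g y ≠ 0 := by
  by_cases h : g x = 0
  · exact (hg x).hasDerivAt.eventually_ne (hg' x h)
  · exact ((hg x).continuousAt.eventually_ne h).filter_mono nhdsWithin_le_nhds

theorem eq_of_eq_off_zeros {g A B : ℂ → ℂ} (hg : Differentiable ℂ g)
    (hg' : ∀ x, g x = 0 → deriv g x ≠ 0) (hA : Continuous A) (hB : Continuous B)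
    (h : ∀ x, g x ≠ 0 → A x = B x) (x : ℂ) : A x = B x := by
  have h1 : Filter.Tendsto A (𝓝[≠] x) (𝓝 (A x)) := hA.continuousAt.mono_left nhdsWithin_le_nhds
  have h2 : Filter.Tendsto B (𝓝[≠] x) (𝓝 (B x)) := hB.continuousAt.mono_left nhdsWithin_le_nhds
  refine tendsto_nhds_unique h1 (h2.congr' ?_)
  filter_upwards [eventually_ne_zero_of_simple_zeros hg hg' x] with y hy using (h y hy).symm

/-- At a common zero the quotient equals that of the difference quotients `dslope f / dslope g`,
whose denominator is nonzero because the zero of `g` is simple. -/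
theorem exists_entire_quotient {f g : ℂ → ℂ} (hf : Differentiable ℂ f) (hg : Differentiable ℂ g)
    (hg' : ∀ x, g x = 0 → deriv g x ≠ 0) (hfg : ∀ x, g x = 0 → f x = 0) :
    ∃ h : ℂ → ℂ, Differentiable ℂ h ∧ ∀ x, f x = g x * h x := by
  classical
  refine ⟨fun x => if g x = 0 then deriv f x / deriv g x else f x / g x, fun x => ?_, fun x => ?_⟩
  · by_cases hx : g x = 0
    · have hd : ∀ {k : ℂ → ℂ}, Differentiable ℂ k → DifferentiableAt ℂ (dslope k x) x := by
        intro k hk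
        exact ((Complex.differentiableOn_dslope Filter.univ_mem).2
          hk.differentiableOn).differentiableAt Filter.univ_mem
      have h0 : dslope g x x ≠ 0 := by rw [dslope_same]; exact hg' x hx
      refine ((hd hf).div (hd hg) h0).congr_of_eventuallyEq ?_
      have h1 := eventually_ne_zero_of_simple_zeros hg hg' x
      rw [eventually_nhdsWithin_iff] at h1
      filter_upwards [h1] with y hy
      by_cases e : y = x
      · subst e; simp [hx, dslope_same]
      · have hgy := hy e
        simp only [hgy, if_false, Pi.div_apply, dslope_of_ne _ e, slope_def_field, hx, hfg x hx,
          sub_zero]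
        have : y - x ≠ 0 := sub_ne_zero.2 e
        field_simp
    · refine ((hf x).div (hg x) hx).congr_of_eventuallyEq ?_
      filter_upwards [(hg x).continuousAt.eventually_ne hx] with y hy
      simp [hy]
  · by_cases hx : g x = 0
    · simp [hx, hfg x hx]
    · simp only [hx, if_false]; field_simp

/-- Liouville's theorem: the modulus is bounded by its maximum on a fundamental parallelogram. Only
the modulus has to be periodic, which admits unimodular multipliers. -/
theorem exists_eq_const_of_norm_periodic {τ : ℂ} (hτ : 0 < τ.im) {h : ℂ → ℂ}
    (hd : Differentiable ℂ h) (h1 : ∀ x, ‖h (x + 1)‖ = ‖h x‖) (h2 : ∀ x, ‖h (x + τ)‖ = ‖h x‖) :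
    ∃ C, ∀ x, h x = C := by
  have hp : ∀ {t : ℂ}, (∀ x, ‖h (x + t)‖ = ‖h x‖) → ∀ (n : ℤ) (x : ℂ), ‖h (x + n * t)‖ = ‖h x‖ := by
    intro t ht n
    induction n with
    | zero => simp
    | succ n ih =>
      intro x
      rw [show x + ((n + 1 : ℤ) : ℂ) * t = x + (n : ℤ) * t + t by push_cast; ring, ht, ih]
    | pred n ih =>
      intro x
      rw [← ih x, ← ht (x + ((-n - 1 : ℤ) : ℂ) * t)]; push_cast; ring_nf
  have hK : IsCompact ((fun s : ℝ × ℝ => (s.1 : ℂ) + s.2 * τ) '' (Set.Icc 0 1 ×ˢ Set.Icc 0 1)) :=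
    (isCompact_Icc.prod isCompact_Icc).image (by fun_prop)
  have hsub : (Set.range fun x => ‖h x‖) ⊆ (fun x => ‖h x‖) ''
      ((fun s : ℝ × ℝ => (s.1 : ℂ) + s.2 * τ) '' (Set.Icc 0 1 ×ˢ Set.Icc 0 1)) := by
    rintro _ ⟨x, rfl⟩
    set b := x.im / τ.im
    set a := (x - b * τ).re
    have hx : x = a + b * τ := by
      apply Complex.ext
      · simp [a]
      · simp [b, hτ.ne']
    -- Subtracting the integer parts of both lattice coordinates moves the point into the
    -- parallelogram.
    refine ⟨x + ((-⌊a⌋ : ℤ) : ℂ) * 1 + ((-⌊b⌋ : ℤ) : ℂ) * τ, ⟨(Int.fract a, Int.fract b), ?_, ?_⟩, ?_⟩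
    · exact ⟨⟨Int.fract_nonneg _, (Int.fract_lt_one _).le⟩,
        ⟨Int.fract_nonneg _, (Int.fract_lt_one _).le⟩⟩
    · conv_rhs => rw [hx]
      simp only [Int.fract]; push_cast; ring
    · dsimp only
      rw [hp h2, hp h1]
  have hb := (hK.image hd.continuous.norm).isBounded.subset hsub
  rw [isBounded_iff_forall_norm_le] at hb
  obtain ⟨M, hM⟩ := hb
  exact hd.exists_const_forall_eq_of_bounded (isBounded_iff_forall_norm_le.2
    ⟨M, by rintro _ ⟨x, rfl⟩; simpa using hM _ ⟨x, rfl⟩⟩)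

/-- An entire function with multiplier `μ` for the period `1` and multiplier `ν e^{-2πidx}` for the
quasi-period `τ`. -/
structure QuasiPeriodic (τ d μ ν : ℂ) (K : ℂ → ℂ) : Prop where
  differentiable : Differentiable ℂ K
  add_one : ∀ x, K (x + 1) = μ * K x
  add_tau : ∀ x, K (x + τ) = ν * ex (-2 * d * x) * K x

namespace QuasiPeriodic

variable {τ d μ ν : ℂ} {K K' : ℂ → ℂ}

theorem oddTheta (hτ : 0 < τ.im) : QuasiPeriodic τ 1 (-1) (-ex (-τ)) (oddTheta τ) where
  differentiable := differentiable_oddTheta hτ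
  add_one x := by rw [oddTheta_add_one, neg_one_mul]
  add_tau x := by rw [oddTheta_add_tau hτ, sub_eq_add_neg, ex_add]; ring_nf

theorem congr_param {d₁ μ₁ ν₁ : ℂ} (h : QuasiPeriodic τ d μ ν K) (hd : d = d₁) (hμ : μ = μ₁)
    (hν : ν = ν₁) : QuasiPeriodic τ d₁ μ₁ ν₁ K := by subst hd hμ hν; exact h

theorem sub (h : QuasiPeriodic τ d μ ν K) (h' : QuasiPeriodic τ d μ ν K') :
    QuasiPeriodic τ d μ ν fun x => K x - K' x where
  differentiable := h.differentiable.sub h'.differentiable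
  add_one x := by rw [h.add_one, h'.add_one]; ring
  add_tau x := by rw [h.add_tau, h'.add_tau]; ring

theorem const_mul (h : QuasiPeriodic τ d μ ν K) (c : ℂ) :
    QuasiPeriodic τ d μ ν fun x => c * K x where
  differentiable := h.differentiable.const_mul c
  add_one x := by rw [h.add_one]; ring
  add_tau x := by rw [h.add_tau]; ring

theorem sum {ι : Type*} (s : Finset ι) {K : ι → ℂ → ℂ}
    (h : ∀ i ∈ s, QuasiPeriodic τ d μ ν (K i)) :
    QuasiPeriodic τ d μ ν fun x => ∑ i ∈ s, K i x where
  differentiable := Differentiable.fun_sum fun i hi => (h i hi).differentiable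
  add_one x := by rw [Finset.mul_sum]; exact Finset.sum_congr rfl fun i hi => (h i hi).add_one x
  add_tau x := by rw [Finset.mul_sum]; exact Finset.sum_congr rfl fun i hi => (h i hi).add_tau x

theorem mul {d' μ' ν' : ℂ} (h : QuasiPeriodic τ d μ ν K) (h' : QuasiPeriodic τ d' μ' ν' K') :
    QuasiPeriodic τ (d + d') (μ * μ') (ν * ν') fun x => K x * K' x where
  differentiable := h.differentiable.mul h'.differentiable
  add_one x := by rw [h.add_one, h'.add_one]; ring
  add_tau x := by
    rw [h.add_tau, h'.add_tau, show -2 * (d + d') * x = -2 * d * x + -2 * d' * x by ring, ex_add]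
    ring

theorem translate (h : QuasiPeriodic τ d μ ν K) (s : ℂ) :
    QuasiPeriodic τ d μ (ν * ex (-2 * d * s)) fun x => K (x + s) where
  differentiable := h.differentiable.comp (by fun_prop)
  add_one x := by rw [← h.add_one]; ring_nf
  add_tau x := by
    rw [show x + τ + s = x + s + τ by ring, h.add_tau, mul_add, ex_add]; ring

theorem comp_neg (h : QuasiPeriodic τ d μ ν K) (hμ : μ ≠ 0) (hν : ν ≠ 0) :
    QuasiPeriodic τ d μ⁻¹ (ν⁻¹ * ex (-2 * d * τ)) fun x => K (-x) where
  differentiable := h.differentiable.comp differentiable_neg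
  add_one x := by
    have := h.add_one (-(x + 1))
    rw [show -(x + 1) + 1 = -x by ring] at this
    rw [this]; field_simp
  add_tau x := by
    have := h.add_tau (-(x + τ))
    rw [show -(x + τ) + τ = -x by ring] at this
    have e : ex (-2 * d * τ) * ex (-2 * d * x) * ex (-2 * d * -(x + τ)) = 1 := by
      rw [← ex_add, ← ex_add, ← ex_zero]; ring_nf
    linear_combination -ν⁻¹ * ex (-2 * d * τ) * ex (-2 * d * x) * this -
      K (-(x + τ)) * (ν * ν⁻¹) * e - K (-(x + τ)) * mul_inv_cancel₀ hν

theorem eq_zero_of_zero (h : QuasiPeriodic τ d μ ν K) (hμ : μ ≠ 0) (hν : ν ≠ 0) (h0 : K 0 = 0)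
    (a b : ℤ) : K (a + b * τ) = 0 := by
  have h1 : ∀ x, K (x + 1) = 0 ↔ K x = 0 := fun x => by rw [h.add_one]; simp [hμ]
  have h2 : ∀ x, K (x + τ) = 0 ↔ K x = 0 := fun x => by
    rw [h.add_tau]; simp [hν, ex_ne_zero]
  have hp : ∀ {t : ℂ}, (∀ x, K (x + t) = 0 ↔ K x = 0) →
      ∀ (n : ℤ) (x : ℂ), K (x + n * t) = 0 ↔ K x = 0 := by
    intro t ht n
    induction n with
    | zero => simp
    | succ n ih =>
      intro x
      rw [show x + ((n + 1 : ℤ) : ℂ) * t = x + (n : ℤ) * t + t by push_cast; ring, ht, ih]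
    | pred n ih =>
      intro x
      rw [← ih x, ← ht (x + ((-n - 1 : ℤ) : ℂ) * t)]; push_cast; ring_nf
  have := (hp h2 b (0 + a * 1)).2 ((hp h1 a 0).2 h0)
  simpa using this

theorem eq_of_oddTheta_mul_eq (hτ : 0 < τ.im) (hK : Continuous K) (hK' : Continuous K')
    (h : ∀ x, EllipticAlgebra.oddTheta τ x * K x = EllipticAlgebra.oddTheta τ x * K' x) (x : ℂ) :
    K x = K' x :=
  eq_of_eq_off_zeros (differentiable_oddTheta hτ) (fun _ => deriv_oddTheta_ne_zero hτ) hK hK'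
    (fun y hy => mul_left_cancel₀ hy (h y)) x

/-- A zero at the origin propagates to the whole lattice, which is exactly the zero set of
`oddTheta`. Dividing it out lowers the degree by one; repeated use brings a theta function down to
degree zero. -/
theorem exists_eq_oddTheta_mul (hτ : 0 < τ.im) (h : QuasiPeriodic τ d μ ν K) (hμ : μ ≠ 0)
    (hν : ν ≠ 0) (h0 : K 0 = 0) :
    ∃ K' : ℂ → ℂ, QuasiPeriodic τ (d - 1) (-μ) (-ν * ex τ) K' ∧
      ∀ x, K x = EllipticAlgebra.oddTheta τ x * K' x := by
  obtain ⟨K', hd, e⟩ := exists_entire_quotient h.differentiable (differentiable_oddTheta hτ)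
    (fun _ => deriv_oddTheta_ne_zero hτ) fun x hx => by
      obtain ⟨a, b, rfl⟩ := (oddTheta_eq_zero_iff hτ x).1 hx
      exact h.eq_zero_of_zero hμ hν h0 a b
  refine ⟨K', ⟨hd, ?_, ?_⟩, e⟩
  · refine eq_of_oddTheta_mul_eq hτ (hd.continuous.comp (by fun_prop))
      (hd.continuous.const_mul _) fun x => ?_
    have := h.add_one x
    rw [e, e, oddTheta_add_one] at this
    linear_combination -this
  · refine eq_of_oddTheta_mul_eq hτ (hd.continuous.comp (by fun_prop))
      ((continuous_const.mul (continuous_ex.comp (by fun_prop))).mul hd.continuous) fun x => ?_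
    have := h.add_tau x
    rw [e, e, oddTheta_add_tau hτ] at this
    have e1 : ex (-2 * x - τ) * ex (2 * x + τ) = 1 := by rw [← ex_add, ← ex_zero]; ring_nf
    have e2 : ex (-2 * d * x) * ex (2 * x + τ) = ex τ * ex (-2 * (d - 1) * x) := by
      rw [← ex_add, ← ex_add]; ring_nf
    linear_combination -ex (2 * x + τ) * this -
      EllipticAlgebra.oddTheta τ x * K' (x + τ) * e1 - ν * EllipticAlgebra.oddTheta τ x * K' x * e2

theorem exists_eq_const (hτ : 0 < τ.im) (h : QuasiPeriodic τ 0 μ ν K) (hμ : ‖μ‖ = 1)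
    (hν : ‖ν‖ = 1) : ∃ C, ∀ x, K x = C :=
  exists_eq_const_of_norm_periodic hτ h.differentiable
    (fun x => by rw [h.add_one, norm_mul, hμ, one_mul])
    (fun x => by rw [h.add_tau]; simp [hν, ex_zero])

/-- In degree zero the function is constant, and a nonzero constant admits only trivial multipliers.
-/
theorem eq_zero (hτ : 0 < τ.im) (h : QuasiPeriodic τ 0 μ ν K) (hμ : ‖μ‖ = 1)
    (hν : ‖ν‖ = 1) (h1 : μ ≠ 1 ∨ ν ≠ 1) (x : ℂ) : K x = 0 := by
  obtain ⟨C, hC⟩ := h.exists_eq_const hτ hμ hν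
  have e1 := h.add_one 0
  have e2 := h.add_tau 0
  simp only [hC, mul_zero, ex_zero, mul_one] at e1 e2
  rw [hC]
  by_contra hne
  rcases h1 with h1 | h1
  · exact h1 (mul_right_cancel₀ hne (e1.symm.trans (one_mul C).symm))
  · exact h1 (mul_right_cancel₀ hne (e2.symm.trans (one_mul C).symm))

/-- A theta function of degree two is symmetric about its centre. -/
theorem apply_neg_sub (hτ : 0 < τ.im) {D : ℂ}
    (h : QuasiPeriodic τ 2 1 (ex (-2 * τ - 2 * D)) K) (x : ℂ) : K (-D - x) = K x := by
  have h1 : QuasiPeriodic τ 2 1 (ex (-2 * τ)) fun x => K (x + -(D / 2)) :=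
    (h.translate (-(D / 2))).congr_param rfl rfl (by rw [← ex_add]; ring_nf)
  have h2 : QuasiPeriodic τ 2 1 (ex (-2 * τ)) fun x => K (-x + -(D / 2)) :=
    (h1.comp_neg one_ne_zero (ex_ne_zero _)).congr_param rfl inv_one
      (by rw [← ex_neg, ← ex_add]; ring_nf)
  -- The antisymmetric part about the centre vanishes at `0` and, by periodicity, at `1/2`. Dividing
  -- by both zeros leaves degree zero with multiplier `-1` for `τ`, hence zero.
  have h3 := h1.sub h2
  obtain ⟨K₁, q1, e1⟩ := h3.exists_eq_oddTheta_mul hτ one_ne_zero (ex_ne_zero _) (by simp)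
  have hhalf : K₁ (1 / 2) = 0 := by
    have e := e1 (1 / 2)
    have : K (1 / 2 + -(D / 2)) - K (-(1 / 2) + -(D / 2)) = 0 := by
      have := h1.add_one (-(1 / 2))
      rw [show (-(1 / 2) + 1 : ℂ) = 1 / 2 by norm_num, one_mul] at this
      rw [this, sub_self]
    rw [this] at e
    refine (mul_eq_zero.1 e.symm).resolve_left fun h0 => ?_
    obtain ⟨a, b, hab⟩ := (oddTheta_eq_zero_iff hτ _).1 h0
    have hb := congrArg Complex.im hab
    simp at hb
    rcases hb with rfl | hb
    · simp at hab
      have h' : ((1 : ℤ) : ℂ) = ((2 * a : ℤ) : ℂ) := by push_cast; rw [← hab]; norm_num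
      have := Int.cast_injective h'
      omega
    · exact hτ.ne' hb
  have q2 := q1.translate (1 / 2)
  obtain ⟨K₂, q3, e3⟩ := q2.exists_eq_oddTheta_mul hτ (by simp)
    (mul_ne_zero (mul_ne_zero (neg_ne_zero.2 (ex_ne_zero _)) (ex_ne_zero _)) (ex_ne_zero _))
    (by simpa using hhalf)
  have q4 : QuasiPeriodic τ 0 1 (-1) K₂ := q3.congr_param (by norm_num) (by norm_num) (by
    rw [show -2 * (2 - 1) * (1 / 2 : ℂ) = -1 by norm_num, ex_neg 1, ex_one,
      show -2 * τ = -τ + -τ by ring, ex_add, ex_neg]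
    field_simp [ex_ne_zero τ])
  have z := q4.eq_zero hτ (by simp) (by simp) (Or.inr (by norm_num))
  have key : ∀ y, K (y + -(D / 2)) = K (-y + -(D / 2)) := fun y => by
    have := e1 y
    have h4 := e3 (y - 1 / 2)
    rw [z, mul_zero, sub_add_cancel] at h4
    rw [h4, mul_zero] at this
    exact sub_eq_zero.1 this
  have := key (-x - D / 2)
  rw [show -x - D / 2 + -(D / 2) = -D - x by ring, show -(-x - D / 2) + -(D / 2) = x by ring] at this
  exact this

/-- An even theta function of degree two which vanishes at `0`. -/
theorem eq_const_mul_sq (hτ : 0 < τ.im) (h : QuasiPeriodic τ 2 1 (ex (-2 * τ)) K)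
    (heven : ∀ x, K (-x) = K x) (h0 : K 0 = 0) :
    ∃ C, ∀ x, K x = C * EllipticAlgebra.oddTheta τ x ^ 2 := by
  obtain ⟨K₁, q1, e1⟩ := h.exists_eq_oddTheta_mul hτ one_ne_zero (ex_ne_zero _) h0
  -- An even function divided by an odd one is odd, so the quotient vanishes at `0` again and a
  -- second division reaches degree zero.
  have hodd : ∀ x, K₁ (-x) = -K₁ x := by
    refine eq_of_oddTheta_mul_eq hτ (q1.differentiable.continuous.comp continuous_neg)
      q1.differentiable.continuous.neg fun x => ?_
    have := heven x
    rw [e1, e1, oddTheta_neg hτ] at this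
    linear_combination -this
  have h10 : K₁ 0 = 0 := by
    have := hodd 0
    rw [neg_zero] at this
    linear_combination this / 2
  obtain ⟨K₂, q2, e2⟩ := q1.exists_eq_oddTheta_mul hτ (by simp)
    (mul_ne_zero (neg_ne_zero.2 (ex_ne_zero _)) (ex_ne_zero _)) h10
  obtain ⟨C, hC⟩ := (q2.congr_param (by norm_num : (2 - 1 - 1 : ℂ) = 0) (neg_neg 1)
    (by
      rw [show -2 * τ = -τ + -τ by ring, ex_add, ex_neg]
      field_simp [ex_ne_zero τ] : - (-ex (-2 * τ) * ex τ) * ex τ = 1)).exists_eq_const hτ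
      (by simp) (by simp)
  exact ⟨C, fun x => by rw [e1, e2, hC]; ring⟩

end QuasiPeriodic

/-! ### Theta functions with characteristics -/

theorem thetaChar_add (γ₁ γ₂ s t ξ τ : ℂ) :
    thetaChar (γ₁ + s) (γ₂ + t) ξ τ =
      ex (s ^ 2 * τ + 2 * s * (ξ + γ₂ + t)) * thetaChar γ₁ γ₂ (ξ + s * τ + t) τ := by
  unfold thetaChar ex
  rw [← mul_assoc, ← Complex.exp_add]
  congr 2 <;> ring

/-- The zeroth Fourier coefficient over `[0, 1]` is `1`, by term-by-term integration of the series.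
-/
theorem exists_jacobiTheta₂_ne_zero {τ : ℂ} (hτ : 0 < τ.im) : ∃ z, jacobiTheta₂ z τ ≠ 0 := by
  by_contra! h
  have hs : Summable fun n : ℤ => ‖jacobiTheta₂_term n 0 τ‖ :=
    ((summable_jacobiTheta₂_term_iff 0 τ).2 hτ).norm
  have hnorm : ∀ (n : ℤ) (x : ℝ), ‖jacobiTheta₂_term n x τ‖ = ‖jacobiTheta₂_term n 0 τ‖ := by
    intro n x
    simp [norm_jacobiTheta₂_term]
  have hcont : ∀ n : ℤ, Continuous fun x : ℝ => jacobiTheta₂_term n x τ := by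
    intro n; unfold jacobiTheta₂_term; fun_prop
  have key := intervalIntegral.hasSum_integral_of_dominated_convergence (μ := MeasureTheory.volume)
    (a := 0) (b := 1) (F := fun (n : ℤ) (x : ℝ) => jacobiTheta₂_term n x τ)
    (f := fun x : ℝ => jacobiTheta₂ x τ) (fun n _ => ‖jacobiTheta₂_term n 0 τ‖)
    (fun n => (hcont n).aestronglyMeasurable)
    (fun n => .of_forall fun x _ => (hnorm n x).le)
    (.of_forall fun _ _ => hs) (by simp)
    (.of_forall fun x _ => hasSum_jacobiTheta₂_term _ hτ)
  have hint : ∀ n : ℤ, n ≠ 0 → ∫ x in (0 : ℝ)..1, jacobiTheta₂_term n x τ = 0 := by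
    intro n hn
    have e : ∀ x : ℝ, jacobiTheta₂_term n x τ =
        Complex.exp ((2 * Real.pi * Complex.I * n) * x) *
          Complex.exp (Real.pi * Complex.I * n ^ 2 * τ) := by
      intro x; rw [jacobiTheta₂_term, Complex.exp_add]
    simp only [e]
    rw [intervalIntegral.integral_mul_const, integral_exp_mul_complex]
    · have : Complex.exp (2 * Real.pi * Complex.I * n) = 1 := by
        rw [Complex.exp_eq_one_iff]; exact ⟨n, by ring⟩
      simp [this]
    · simp [Real.pi_ne_zero, hn]
  have h0 : ∫ x in (0 : ℝ)..1, jacobiTheta₂_term 0 x τ = 1 := by simp [jacobiTheta₂_term]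
  have := key.unique (hasSum_single (0 : ℤ) fun n hn => hint n hn)
  simp [h, h0] at this

theorem quasiPeriodic_thetaChar_half {τ : ℂ} (hτ : 0 < τ.im) :
    QuasiPeriodic τ 1 (-1) (-ex (-τ)) fun ξ => thetaChar (1 / 2) (1 / 2) ξ τ := by
  have e : ∀ ξ, thetaChar (1 / 2) (1 / 2) ξ τ =
      ex (τ / 4 + ξ + 1 / 2) * jacobiTheta₂ (ξ + 1 / 2 + 1 / 2 * τ) τ := by
    intro ξ; unfold thetaChar ex; congr 2; ring
  have hex : ∀ x, Complex.exp (-Real.pi * Complex.I * x) = ex (-x) := by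
    intro x; unfold ex; congr 1; ring
  refine ⟨?_, fun x => ?_, fun x => ?_⟩
  · simp only [e]
    refine (differentiable_ex.comp (by fun_prop)).mul fun x => ?_
    exact (differentiableAt_jacobiTheta₂_fst _ hτ).comp x
      (by fun_prop : DifferentiableAt ℂ (fun ξ : ℂ => ξ + 1 / 2 + 1 / 2 * τ) x)
  · rw [e, e, show x + 1 + 1 / 2 + 1 / 2 * τ = x + 1 / 2 + 1 / 2 * τ + 1 by ring,
      jacobiTheta₂_add_left, show τ / 4 + (x + 1) + 1 / 2 = τ / 4 + x + 1 / 2 + 1 by ring,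
      ex_add _ 1, ex_one]
    ring
  · rw [e, e, show x + τ + 1 / 2 + 1 / 2 * τ = x + 1 / 2 + 1 / 2 * τ + τ by ring,
      jacobiTheta₂_add_left', hex, ← mul_assoc, ← mul_assoc]
    congr 1
    have : -(1 : ℂ) = ex (-1) := by rw [ex_neg, ex_one]; norm_num
    rw [neg_eq_neg_one_mul (ex (-τ)), this, ← ex_add, ← ex_add, ← ex_add, ← ex_add]
    congr 1; ring

/-- The theta function with characteristics `(1/2, 1/2)` vanishes at `0` and has the multipliers of
`oddTheta`, so their quotient is a constant `C`. Its value is never needed, since it cancels in the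
weights. -/
theorem exists_thetaChar_eq {τ : ℂ} (hτ : 0 < τ.im) : ∃ C : ℂ, C ≠ 0 ∧ ∀ s t ξ : ℂ,
    thetaChar (1 / 2 + s) (1 / 2 + t) ξ τ =
      C * ex (s ^ 2 * τ + 2 * s * (ξ + 1 / 2 + t)) * oddTheta τ (ξ + s * τ + t) := by
  have q := quasiPeriodic_thetaChar_half hτ
  have h0 : thetaChar (1 / 2) (1 / 2) 0 τ = 0 := by
    -- At the half-period the functional equation together with evenness reads `ϑ = -ϑ`.
    have h := jacobiTheta₂_add_left' (-(1 / 2 + 1 / 2 * τ)) τ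
    rw [jacobiTheta₂_neg_left, ← jacobiTheta₂_add_left] at h
    rw [show -(1 / 2 + 1 / 2 * τ) + τ + 1 = 1 / 2 + 1 / 2 * τ by ring,
      show -(Real.pi : ℂ) * Complex.I * (τ + 2 * -(1 / 2 + 1 / 2 * τ)) = Real.pi * Complex.I by
        ring, Complex.exp_pi_mul_I] at h
    have : jacobiTheta₂ (1 / 2 + 1 / 2 * τ) τ = 0 := by linear_combination h / 2
    rw [thetaChar, zero_add, this, mul_zero]
  obtain ⟨K, qK, e⟩ := q.exists_eq_oddTheta_mul hτ (by simp) (neg_ne_zero.2 (ex_ne_zero _)) h0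
  obtain ⟨C, hC⟩ := (qK.congr_param (sub_self 1) (neg_neg 1) (by
    rw [neg_neg, ex_neg, inv_mul_cancel₀ (ex_ne_zero _)])).exists_eq_const hτ (by simp) (by simp)
  refine ⟨C, ?_, fun s t ξ => ?_⟩
  · rintro rfl
    obtain ⟨z, hz⟩ := exists_jacobiTheta₂_ne_zero hτ
    have := e (z - 1 / 2 - 1 / 2 * τ)
    rw [hC, mul_zero, thetaChar] at this
    refine hz ?_
    have h := (mul_eq_zero.1 this).resolve_left (Complex.exp_ne_zero _)
    rwa [show z - 1 / 2 - 1 / 2 * τ + 1 / 2 + 1 / 2 * τ = z by ring] at h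
  · rw [thetaChar_add, e, hC]; ring

/-- Identities between functions of `ζ` that are entire need only be checked off the lattice. -/
theorem eq_of_eq_off_lattice {τ : ℂ} (hτ : 0 < τ.im) {A B : ℂ → ℂ} (hA : Continuous A) (hB : Continuous B)
    (h : ∀ x, oddTheta τ x ≠ 0 → A x = B x) (x : ℂ) : A x = B x :=
  eq_of_eq_off_zeros (differentiable_oddTheta hτ) (fun _ => deriv_oddTheta_ne_zero hτ) hA hB h x

/-! ### The weights -/

/-- The point `(ζ + aτ + b) / N`. -/
def torsPoint (N : ℕ) (τ : ℂ) (a b : ℤ) (ζ : ℂ) : ℂ := (ζ + a * τ + b) / N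

section

variable {N : ℕ} (hN : N ≠ 0) {τ : ℂ} (hτ : 0 < τ.im)
include hN

theorem torsPoint_add_left (a b : ℤ) (ζ : ℂ) :
    torsPoint N τ (a + N) b ζ = torsPoint N τ a b ζ + τ := by
  have : (N : ℂ) ≠ 0 := Nat.cast_ne_zero.2 hN
  unfold torsPoint; push_cast; field_simp; ring

theorem torsPoint_add_right (a b : ℤ) (ζ : ℂ) :
    torsPoint N τ a (b + N) ζ = torsPoint N τ a b ζ + 1 := by
  have : (N : ℂ) ≠ 0 := Nat.cast_ne_zero.2 hN
  unfold torsPoint; push_cast; field_simp; ring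

include hτ

theorem oddTheta_eq_zero_of_torsPoint (a b : ℤ) (ζ : ℂ)
    (h : oddTheta τ (torsPoint N τ a b ζ) = 0) : oddTheta τ ζ = 0 := by
  have : (N : ℂ) ≠ 0 := Nat.cast_ne_zero.2 hN
  obtain ⟨k, l, e⟩ := (oddTheta_eq_zero_iff hτ _).1 h
  refine (oddTheta_eq_zero_iff hτ _).2 ⟨N * k - b, N * l - a, ?_⟩
  rw [torsPoint, div_eq_iff this] at e
  push_cast
  linear_combination e

/-- The zeros of the denominator are simple, and each of them is a lattice point `ζ`, hence a zero
of the numerator. -/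
theorem exists_thetaQuot (a b : ℤ) : ∃ g : ℂ → ℂ, Differentiable ℂ g ∧
    ∀ ζ, oddTheta τ ζ = oddTheta τ (torsPoint N τ a b ζ) * g ζ := by
  have hN' : (N : ℂ) ≠ 0 := Nat.cast_ne_zero.2 hN
  have hd : ∀ ζ, HasDerivAt (torsPoint N τ a b) (1 / N) ζ := fun ζ =>
    (((hasDerivAt_id ζ).add_const (a * τ)).add_const (b : ℂ)).div_const _
  refine exists_entire_quotient (differentiable_oddTheta hτ)
    ((differentiable_oddTheta hτ).comp fun ζ => (hd ζ).differentiableAt) (fun ζ h => ?_)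
    (fun ζ h => oddTheta_eq_zero_of_torsPoint hN hτ a b ζ h)
  change deriv (oddTheta τ ∘ torsPoint N τ a b) ζ ≠ 0
  rw [((differentiable_oddTheta hτ _).hasDerivAt.comp ζ (hd ζ)).deriv]
  exact mul_ne_zero (deriv_oddTheta_ne_zero hτ h) (one_div_ne_zero hN')

end

/-- The entire function `ϑ(ζ) / ϑ((ζ + aτ + b) / N)`. -/
def thetaQuot (N : ℕ) (τ : ℂ) (a b : ℤ) : ℂ → ℂ :=
  Classical.epsilon fun g : ℂ → ℂ => Differentiable ℂ g ∧
    ∀ ζ, oddTheta τ ζ = oddTheta τ (torsPoint N τ a b ζ) * g ζ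

/-- The regularised weight. -/
def regWeight (N : ℕ) (τ : ℂ) (a b : ℤ) (ξ ζ : ℂ) : ℂ :=
  thetaQuot N τ a b ζ * ex (2 * a / N * ξ) * oddTheta τ (ξ + torsPoint N τ a b ζ)

section

variable {N : ℕ} (hN : N ≠ 0) {τ : ℂ} (hτ : 0 < τ.im)
include hN hτ

theorem differentiable_thetaQuot (a b : ℤ) : Differentiable ℂ (thetaQuot N τ a b) :=
  (Classical.epsilon_spec (exists_thetaQuot hN hτ a b)).1

theorem oddTheta_eq_mul_thetaQuot (a b : ℤ) (ζ : ℂ) :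
    oddTheta τ ζ = oddTheta τ (torsPoint N τ a b ζ) * thetaQuot N τ a b ζ :=
  (Classical.epsilon_spec (exists_thetaQuot hN hτ a b)).2 ζ

/-- This identifies the value by continuity in `weight` with the entire function `thetaQuot`. Of the
exponential prefactors of the two characteristics only the part in `ξ` survives. -/
theorem weight_eq (a b : ℕ) (ξ ζ : ℂ) :
    weight N a b ξ ζ τ = regWeight N τ a b ξ ζ / (N * oddTheta τ (ξ + ζ)) := by
  have hN' : (N : ℂ) ≠ 0 := Nat.cast_ne_zero.2 hN
  obtain ⟨C, hC, e⟩ := exists_thetaChar_eq hτ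
  have e0 : ∀ ξ, thetaChar (1 / 2) (1 / 2) ξ τ = C * oddTheta τ ξ := by
    intro ξ; simpa [ex_zero] using e 0 0 ξ
  have hpt : ∀ ζ : ℂ, ζ / N + a / N * τ + b / N = torsPoint N τ a b ζ := by
    intro ζ; unfold torsPoint; push_cast; ring
  have hd : ∀ ζ, HasDerivAt (torsPoint N τ a b) (1 / N) ζ := fun ζ =>
    (((hasDerivAt_id ζ).add_const _).add_const _).div_const _
  have hne : ∀ᶠ ζ' in 𝓝[≠] ζ, oddTheta τ ζ' ≠ 0 := eventually_ne_zero_of_simple_zeros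
    (differentiable_oddTheta hτ) (fun _ => deriv_oddTheta_ne_zero hτ) ζ
  have hlim : Filter.Tendsto (fun ζ' : ℂ => thetaChar (1 / 2) (1 / 2) ζ' τ /
        (N * thetaChar (1 / 2 + a / N) (1 / 2 + b / N) (ζ' / N) τ)) (𝓝[≠] ζ)
      (𝓝 (thetaQuot N τ a b ζ /
        (N * ex ((a / N) ^ 2 * τ + 2 * (a / N) * (ζ / N + 1 / 2 + b / N))))) := by
    have hc : ContinuousAt (fun ζ : ℂ => thetaQuot N τ a b ζ /
        (N * ex ((a / N) ^ 2 * τ + 2 * (a / N) * (ζ / N + 1 / 2 + b / N)))) ζ := by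
      refine (differentiable_thetaQuot hN hτ a b).continuous.continuousAt.div ?_
        (mul_ne_zero hN' (ex_ne_zero _))
      exact (continuous_const.mul (continuous_ex.comp (by fun_prop))).continuousAt
    refine (hc.tendsto.mono_left nhdsWithin_le_nhds).congr' ?_
    filter_upwards [hne] with ζ' h'
    rw [e0, e, hpt, oddTheta_eq_mul_thetaQuot hN hτ a b ζ']
    have h1 : oddTheta τ (torsPoint N τ a b ζ') ≠ 0 := fun h =>
      h' (oddTheta_eq_zero_of_torsPoint hN hτ a b ζ' h)
    have := ex_ne_zero ((a / N) ^ 2 * τ + 2 * (a / N) * (ζ' / N + 1 / 2 + b / N))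
    field_simp
  rw [weight, hlim.limUnder_eq, e0, e, regWeight,
    show ξ + ζ / N + a / N * τ + b / N = ξ + (ζ / N + a / N * τ + b / N) by ring, hpt,
    show (a / N : ℂ) ^ 2 * τ + 2 * (a / N) * (ξ + ζ / N + 1 / 2 + b / N) =
      ((a / N) ^ 2 * τ + 2 * (a / N) * (ζ / N + 1 / 2 + b / N)) + 2 * (a : ℤ) / N * ξ by
        push_cast; ring, ex_add ((a / N) ^ 2 * τ + 2 * (a / N) * (ζ / N + 1 / 2 + b / N))]
  have := ex_ne_zero ((a / N) ^ 2 * τ + 2 * (a / N) * (ζ / N + 1 / 2 + b / N))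
  generalize ex ((a / N) ^ 2 * τ + 2 * (a / N) * (ζ / N + 1 / 2 + b / N)) = E at this ⊢
  generalize ex (2 * ((a : ℤ) : ℂ) / N * ξ) = E'
  by_cases h : oddTheta τ (ξ + ζ) = 0
  · simp [h]
  · field_simp

theorem differentiable_regWeight (a b : ℤ) (ξ : ℂ) :
    Differentiable ℂ (regWeight N τ a b ξ) := by
  unfold regWeight
  refine ((differentiable_thetaQuot hN hτ a b).mul_const _).mul
    ((differentiable_oddTheta hτ).comp ?_)
  unfold torsPoint; fun_prop

theorem regWeight_eq (a b : ℤ) (ξ : ℂ) {ζ : ℂ} (h : oddTheta τ (torsPoint N τ a b ζ) ≠ 0) :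
    regWeight N τ a b ξ ζ = oddTheta τ ζ * (ex (2 * a / N * ξ) *
      (oddTheta τ (ξ + torsPoint N τ a b ζ) / oddTheta τ (torsPoint N τ a b ζ))) := by
  rw [oddTheta_eq_mul_thetaQuot hN hτ a b ζ, regWeight]
  field_simp

theorem oddTheta_torsPoint_ne_zero (a b : ℤ) {ζ : ℂ} (h : oddTheta τ ζ ≠ 0) :
    oddTheta τ (torsPoint N τ a b ζ) ≠ 0 :=
  fun h' => h (oddTheta_eq_zero_of_torsPoint hN hτ a b ζ h')

/-- The automorphy factors of numerator and denominator differ by a factor that the change of `ex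
(2aξ/N)` absorbs. Weights thus depend only on indices modulo `N`, which licenses reindexing the
sums. -/
theorem regWeight_add_left (a b : ℤ) (ξ ζ : ℂ) :
    regWeight N τ (a + N) b ξ ζ = regWeight N τ a b ξ ζ := by
  have hN' : (N : ℂ) ≠ 0 := Nat.cast_ne_zero.2 hN
  refine eq_of_eq_off_lattice hτ (differentiable_regWeight hN hτ _ _ ξ).continuous
    (differentiable_regWeight hN hτ _ _ ξ).continuous (fun ζ h => ?_) ζ
  have h1 := oddTheta_torsPoint_ne_zero hN hτ a b h
  rw [regWeight_eq hN hτ _ _ _ (oddTheta_torsPoint_ne_zero hN hτ (a + N) b h),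
    regWeight_eq hN hτ _ _ _ h1, torsPoint_add_left hN, ← add_assoc, oddTheta_add_tau hτ,
    oddTheta_add_tau hτ]
  have e : ex (2 * ((a + N : ℤ) : ℂ) / N * ξ) * ex (-2 * (ξ + torsPoint N τ a b ζ) - τ) =
      ex (2 * a / N * ξ) * ex (-2 * torsPoint N τ a b ζ - τ) := by
    rw [← ex_add, ← ex_add]; congr 1; push_cast; field_simp; ring
  have e' : ex (2 * ((a + N : ℤ) : ℂ) / N * ξ) * (ex (-2 * (ξ + torsPoint N τ a b ζ) - τ) /
      ex (-2 * torsPoint N τ a b ζ - τ)) = ex (2 * a / N * ξ) := by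
    rw [mul_div_assoc', div_eq_iff (ex_ne_zero _), e]
  rw [neg_mul (ex _), neg_mul (ex _), neg_div_neg_eq, mul_div_mul_comm, ← mul_assoc (ex _), e']

theorem regWeight_add_right (a b : ℤ) (ξ ζ : ℂ) :
    regWeight N τ a (b + N) ξ ζ = regWeight N τ a b ξ ζ := by
  refine eq_of_eq_off_lattice hτ (differentiable_regWeight hN hτ _ _ ξ).continuous
    (differentiable_regWeight hN hτ _ _ ξ).continuous (fun ζ h => ?_) ζ
  rw [regWeight_eq hN hτ _ _ _ (oddTheta_torsPoint_ne_zero hN hτ a (b + N) h),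
    regWeight_eq hN hτ _ _ _ (oddTheta_torsPoint_ne_zero hN hτ a b h), torsPoint_add_right hN,
    ← add_assoc, oddTheta_add_one, oddTheta_add_one, neg_div_neg_eq]

/-- A period added to `ζ` is a unit step of the torsion index. This is why sums over all indices are
quasi-periodic in `ζ`. -/
theorem regWeight_zeta_add_one (a b : ℤ) (ξ ζ : ℂ) :
    regWeight N τ a b ξ (ζ + 1) = -regWeight N τ a (b + 1) ξ ζ := by
  refine eq_of_eq_off_lattice hτ
    ((differentiable_regWeight hN hτ _ _ ξ).continuous.comp (continuous_add_const 1))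
    (differentiable_regWeight hN hτ _ _ ξ).continuous.neg (fun ζ h => ?_) ζ
  have e : torsPoint N τ a b (ζ + 1) = torsPoint N τ a (b + 1) ζ := by
    unfold torsPoint; push_cast; ring
  have h1 := oddTheta_torsPoint_ne_zero hN hτ a (b + 1) h
  change regWeight N τ a b ξ (ζ + 1) = -regWeight N τ a (b + 1) ξ ζ
  rw [regWeight_eq hN hτ _ _ _ h1, regWeight_eq hN hτ _ _ _ (by rwa [e]), e, oddTheta_add_one]
  ring

theorem regWeight_zeta_add_tau (a b : ℤ) (ξ ζ : ℂ) :
    regWeight N τ a b ξ (ζ + τ) =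
      -ex (-2 * ζ - τ - 2 * ξ / N) * regWeight N τ (a + 1) b ξ ζ := by
  refine eq_of_eq_off_lattice hτ
    ((differentiable_regWeight hN hτ _ _ ξ).continuous.comp (continuous_add_const τ))
    ((continuous_ex.comp
      (by fun_prop : Continuous fun ζ : ℂ => -2 * ζ - τ - 2 * ξ / N)).neg.mul
      (differentiable_regWeight hN hτ _ _ ξ).continuous) (fun ζ h => ?_) ζ
  have e : torsPoint N τ a b (ζ + τ) = torsPoint N τ (a + 1) b ζ := by
    unfold torsPoint; push_cast; ring
  have h1 := oddTheta_torsPoint_ne_zero hN hτ (a + 1) b h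
  change regWeight N τ a b ξ (ζ + τ) =
    -ex (-2 * ζ - τ - 2 * ξ / N) * regWeight N τ (a + 1) b ξ ζ
  rw [regWeight_eq hN hτ _ _ _ h1, regWeight_eq hN hτ _ _ _ (by rwa [e]), e, oddTheta_add_tau hτ]
  have e2 : ex (-2 * ζ - τ - 2 * ξ / N) * ex (2 * ((a + 1 : ℤ) : ℂ) / N * ξ) =
      ex (-2 * ζ - τ) * ex (2 * a / N * ξ) := by
    rw [← ex_add, ← ex_add]; push_cast; ring_nf
  linear_combination oddTheta τ ζ * (oddTheta τ (ξ + torsPoint N τ (a + 1) b ζ) /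
    oddTheta τ (torsPoint N τ (a + 1) b ζ)) * e2

theorem oddTheta_torsPoint_zero_ne_zero {a b : ℤ} (h : ¬((N : ℤ) ∣ a ∧ (N : ℤ) ∣ b)) :
    oddTheta τ (torsPoint N τ a b 0) ≠ 0 := by
  have hN' : (N : ℂ) ≠ 0 := Nat.cast_ne_zero.2 hN
  intro h0
  obtain ⟨k, l, e⟩ := (oddTheta_eq_zero_iff hτ _).1 h0
  rw [torsPoint, div_eq_iff hN', zero_add] at e
  have him := congrArg Complex.im e
  have hre := congrArg Complex.re e
  simp at him hre
  have h1 : (a : ℝ) = l * N := by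
    have : ((a : ℝ) - l * N) * τ.im = 0 := by linear_combination him
    exact sub_eq_zero.1 ((mul_eq_zero.1 this).resolve_right hτ.ne')
  rw [h1] at hre
  have h2 : (b : ℝ) = k * N := by linear_combination hre
  exact h ⟨⟨l, by exact_mod_cast h1.trans (mul_comm _ _)⟩,
    ⟨k, by exact_mod_cast h2.trans (mul_comm _ _)⟩⟩

/-- At `ζ = 0` the numerator `oddTheta τ ζ` vanishes while the denominator does not. Hence sums over
torsion points collapse to one term there. -/
theorem regWeight_zeta_zero {a b : ℤ} (h : ¬((N : ℤ) ∣ a ∧ (N : ℤ) ∣ b)) (ξ : ℂ) :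
    regWeight N τ a b ξ 0 = 0 := by
  rw [regWeight_eq hN hτ _ _ _ (oddTheta_torsPoint_zero_ne_zero hN hτ h), oddTheta_zero, zero_mul]

theorem deriv_regWeight_zeta_zero {a b : ℤ} (h : ¬((N : ℤ) ∣ a ∧ (N : ℤ) ∣ b)) (ξ : ℂ) :
    deriv (regWeight N τ a b ξ) 0 = deriv (oddTheta τ) 0 * (ex (2 * a / N * ξ) *
      (oddTheta τ (ξ + torsPoint N τ a b 0) / oddTheta τ (torsPoint N τ a b 0))) := by
  have h0 := oddTheta_torsPoint_zero_ne_zero hN hτ h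
  have hd : Differentiable ℂ (torsPoint N τ a b) := by unfold torsPoint; fun_prop
  have hc : ∀ᶠ ζ in 𝓝 (0 : ℂ), oddTheta τ (torsPoint N τ a b ζ) ≠ 0 :=
    (((differentiable_oddTheta hτ).comp hd).continuous.continuousAt).eventually_ne h0
  have hφ : DifferentiableAt ℂ (fun ζ => ex (2 * a / N * ξ) *
      (oddTheta τ (ξ + torsPoint N τ a b ζ) / oddTheta τ (torsPoint N τ a b ζ))) 0 :=
    ((((differentiable_oddTheta hτ).comp (hd.const_add ξ)) 0).div
      (((differentiable_oddTheta hτ).comp hd) 0) h0).const_mul _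
  have := ((differentiable_oddTheta hτ 0).hasDerivAt.mul hφ.hasDerivAt).congr_of_eventuallyEq
    (hc.mono fun ζ hζ => regWeight_eq hN hτ a b ξ hζ)
  rw [this.deriv, oddTheta_zero, zero_mul, add_zero]

/-- Differentiating `ϑ(ζ) = ϑ(ζ/N) g(ζ)` at `0` gives `g(0) = N`. -/
theorem regWeight_zero_zero (ξ : ℂ) : regWeight N τ 0 0 ξ 0 = N * oddTheta τ ξ := by
  have hN' : (N : ℂ) ≠ 0 := Nat.cast_ne_zero.2 hN
  have hp0 : torsPoint N τ 0 0 0 = 0 := by simp [torsPoint]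
  have hd : HasDerivAt (torsPoint N τ 0 0) (1 / N) 0 :=
    (((hasDerivAt_id (0 : ℂ)).add_const _).add_const _).div_const _
  have h1 := ((differentiable_oddTheta hτ (torsPoint N τ 0 0 0)).hasDerivAt.comp 0 hd).mul
    (differentiable_thetaQuot hN hτ 0 0 0).hasDerivAt
  have h2 := (differentiable_oddTheta hτ 0).hasDerivAt.unique
    (h1.congr_of_eventuallyEq (.of_forall fun ζ => oddTheta_eq_mul_thetaQuot hN hτ 0 0 ζ))
  simp only [Function.comp, hp0, oddTheta_zero, zero_mul, add_zero] at h2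
  have h3 : thetaQuot N τ 0 0 0 = N := by
    have := deriv_oddTheta_ne_zero hτ (oddTheta_zero (τ := τ))
    field_simp at h2
    exact h2.symm
  rw [regWeight, h3, hp0]
  simp [ex_zero]

end

/-! ### Sums over the torsion points -/

/-- Sums of `N`-periodic functions over residues are translation invariant; integer indices avoid
arithmetic in `Fin N`. -/
theorem sum_fin_add_int {M : Type*} [AddCommGroup M] {N : ℕ} (f : ℤ → M)
    (hf : ∀ a, f (a + N) = f a) (k : ℤ) :
    ∑ a : Fin N, f (((a : ℕ) : ℤ) + k) = ∑ a : Fin N, f ((a : ℕ) : ℤ) := by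
  have h1 : ∀ k : ℤ, ∑ a : Fin N, f (((a : ℕ) : ℤ) + (k + 1)) =
      ∑ a : Fin N, f (((a : ℕ) : ℤ) + k) := by
    intro k
    have e1 := Finset.sum_range_succ (fun a : ℕ => f ((a : ℤ) + k)) N
    have e2 := Finset.sum_range_succ' (fun a : ℕ => f ((a : ℤ) + k)) N
    rw [e1] at e2
    have h0 : f ((N : ℤ) + k) = f (((0 : ℕ) : ℤ) + k) := by
      rw [add_comm, hf, Nat.cast_zero, zero_add]
    rw [h0] at e2
    rw [Finset.sum_range, Finset.sum_range] at e2
    rw [add_right_cancel e2]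
    refine Finset.sum_congr rfl fun a _ => ?_
    push_cast; ring_nf
  induction k with
  | zero => simp
  | succ n ih => rw [h1, ih]
  | pred n ih => rw [← h1, ← ih]; simp

theorem sum_fin_fin_add_int {M : Type*} [AddCommGroup M] {N : ℕ} (f : ℤ → ℤ → M)
    (hf : ∀ a b, f (a + N) b = f a b) (hf' : ∀ a b, f a (b + N) = f a b) (k l : ℤ) :
    ∑ a : Fin N, ∑ b : Fin N, f (((a : ℕ) : ℤ) + k) (((b : ℕ) : ℤ) + l) =
      ∑ a : Fin N, ∑ b : Fin N, f ((a : ℕ) : ℤ) ((b : ℕ) : ℤ) := by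
  rw [sum_fin_add_int (fun a => ∑ b : Fin N, f a (((b : ℕ) : ℤ) + l)) (by simp [hf]) k]
  exact Finset.sum_congr rfl fun a _ => sum_fin_add_int _ (hf' _) l

theorem sum_fin_fin_eq_zero_term {M : Type*} [AddCommGroup M] {N : ℕ} (hN : N ≠ 0) (f : ℤ → ℤ → M)
    (h : ∀ a b : ℤ, ¬((N : ℤ) ∣ a ∧ (N : ℤ) ∣ b) → f a b = 0) :
    ∑ a : Fin N, ∑ b : Fin N, f ((a : ℕ) : ℤ) ((b : ℕ) : ℤ) = f 0 0 := by
  have hdvd : ∀ a : Fin N, (N : ℤ) ∣ ((a : ℕ) : ℤ) → (a : ℕ) = 0 := fun a ha =>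
    Nat.eq_zero_of_dvd_of_lt (Int.natCast_dvd_natCast.1 ha) a.2
  have : NeZero N := ⟨hN⟩
  rw [Finset.sum_eq_single (0 : Fin N), Finset.sum_eq_single (0 : Fin N)]
  · simp
  · intro b _ hb
    exact h _ _ fun hd => hb (Fin.ext (by simpa using hdvd b hd.2))
  · simp
  · intro a _ ha
    refine Finset.sum_eq_zero fun b _ => h _ _ fun hd => ha (Fin.ext (by simpa using hdvd a hd.1))
  · simp

section

variable {N : ℕ} (hN : N ≠ 0) {τ : ℂ} (hτ : 0 < τ.im)
include hN hτ

/-- Twisted sums of products of two weights are theta functions of degree two in `ζ`. -/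
theorem quasiPeriodic_sum_regWeight (k l : ℤ) (c d : ℤ) (ξ ξ' : ℂ) :
    QuasiPeriodic τ 2 (ex (-(2 * d / N))) (ex (-2 * τ - 2 * ((ξ + ξ') / N) - 2 * c / N)) fun ζ =>
      ∑ a : Fin N, ∑ b : Fin N, ex (2 * (c * (a : ℕ) + d * (b : ℕ)) / N) *
        (regWeight N τ ((a : ℕ) + k) ((b : ℕ) + l) ξ ζ *
          regWeight N τ (a : ℕ) (b : ℕ) ξ' ζ) := by
  have hN' : (N : ℂ) ≠ 0 := Nat.cast_ne_zero.2 hN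
  let f : ℂ → ℤ → ℤ → ℂ := fun ζ a b => ex (2 * (c * a + d * b) / N) *
    (regWeight N τ (a + k) (b + l) ξ ζ * regWeight N τ a b ξ' ζ)
  have hf1 : ∀ ζ a b, f ζ (a + N) b = f ζ a b := by
    intro ζ a b
    simp only [f]
    rw [show a + (N : ℤ) + k = a + k + N by ring, regWeight_add_left hN hτ,
      regWeight_add_left hN hτ]
    congr 1
    rw [ex_eq_ex_iff]
    exact ⟨c, by push_cast; field_simp; ring⟩
  have hf2 : ∀ ζ a b, f ζ a (b + N) = f ζ a b := by
    intro ζ a b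
    simp only [f]
    rw [show b + (N : ℤ) + l = b + l + N by ring, regWeight_add_right hN hτ,
      regWeight_add_right hN hτ]
    congr 1
    rw [ex_eq_ex_iff]
    exact ⟨d, by push_cast; field_simp; ring⟩
  have key : QuasiPeriodic τ 2 (ex (-(2 * d / N)))
      (ex (-2 * τ - 2 * ((ξ + ξ') / N) - 2 * c / N)) fun ζ =>
      ∑ a : Fin N, ∑ b : Fin N, f ζ ((a : ℕ) : ℤ) ((b : ℕ) : ℤ) := by
    refine ⟨?_, fun ζ => ?_, fun ζ => ?_⟩
    · exact Differentiable.fun_sum fun a _ => Differentiable.fun_sum fun b _ =>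
        ((differentiable_regWeight hN hτ _ _ ξ).mul
          (differentiable_regWeight hN hτ _ _ ξ')).const_mul _
    -- The translation `ζ ↦ ζ + 1` is undone by shifting `b` by one; the two signs cancel and the
    -- phase supplies the multiplier. For `ζ ↦ ζ + τ` the same is done with `a`.
    · rw [← sum_fin_fin_add_int (f ζ) (hf1 ζ) (hf2 ζ) 0 1, Finset.mul_sum]
      refine Finset.sum_congr rfl fun a _ => ?_
      rw [Finset.mul_sum]
      refine Finset.sum_congr rfl fun b _ => ?_
      simp only [f, add_zero]
      rw [regWeight_zeta_add_one hN hτ, regWeight_zeta_add_one hN hτ,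
        show ((b : ℕ) : ℤ) + 1 + l = (b : ℕ) + l + 1 by ring, ← mul_assoc (ex (-_)), ← ex_add]
      rw [neg_mul_neg]
      congr 2
      push_cast; ring
    · rw [← sum_fin_fin_add_int (f ζ) (hf1 ζ) (hf2 ζ) 1 0, Finset.mul_sum]
      refine Finset.sum_congr rfl fun a _ => ?_
      rw [Finset.mul_sum]
      refine Finset.sum_congr rfl fun b _ => ?_
      simp only [f, add_zero]
      rw [regWeight_zeta_add_tau hN hτ, regWeight_zeta_add_tau hN hτ,
        show ((a : ℕ) : ℤ) + 1 + k = (a : ℕ) + k + 1 by ring]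
      have e : ex (2 * (c * (((a : ℕ) : ℤ) : ℂ) + d * (((b : ℕ) : ℤ) : ℂ)) / N) *
          (ex (-2 * ζ - τ - 2 * ξ / N) * ex (-2 * ζ - τ - 2 * ξ' / N)) =
          ex (-2 * τ - 2 * ((ξ + ξ') / N) - 2 * c / N) * ex (-2 * 2 * ζ) *
          ex (2 * (c * (((a : ℕ) + 1 : ℤ) : ℂ) + d * (((b : ℕ) : ℤ) : ℂ)) / N) := by
        rw [← ex_add, ← ex_add, ← ex_add, ← ex_add]
        congr 1; push_cast; ring
      linear_combination regWeight N τ ((a : ℕ) + k + 1) ((b : ℕ) + l) ξ ζ *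
          regWeight N τ ((a : ℕ) + 1) (b : ℕ) ξ' ζ * e
  simpa only [f, Int.cast_natCast] using key

/-- The sum identity behind the crossing symmetry of the elliptic R-matrix. -/
theorem sum_regWeight_crossing (k l : ℤ) (ξ ξ' ζ : ℂ) (h : ξ + ξ' = -(N * ζ)) :
    ∑ a : Fin N, ∑ b : Fin N, regWeight N τ ((a : ℕ) + k) ((b : ℕ) + l) ξ ζ *
          regWeight N τ (a : ℕ) (b : ℕ) ξ' ζ =
      if (N : ℤ) ∣ k ∧ (N : ℤ) ∣ l then N ^ 2 * oddTheta τ ξ * oddTheta τ ξ' else 0 := by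
  have hN' : (N : ℂ) ≠ 0 := Nat.cast_ne_zero.2 hN
  have q := (quasiPeriodic_sum_regWeight hN hτ k l 0 0 ξ ξ').congr_param (μ₁ := 1)
    (ν₁ := ex (-2 * τ - 2 * ((ξ + ξ') / N))) rfl (by simp [ex_zero]) (by simp)
  -- The symmetry about the centre exchanges `0` with `-(ξ + ξ')/N`, which is `ζ` exactly under the
  -- hypothesis. The sum may therefore be evaluated at `0`.
  have := q.apply_neg_sub hτ 0
  have hD : -((ξ + ξ') / N) - 0 = ζ := by rw [h]; field_simp; ring
  rw [hD] at this
  simp only [Int.cast_zero, zero_mul, add_zero, mul_zero, zero_div, ex_zero, one_mul] at this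
  rw [this]
  have := sum_fin_fin_eq_zero_term hN (fun a b => regWeight N τ (a + k) (b + l) ξ 0 *
          regWeight N τ a b ξ' 0) fun a b hab => by
            rw [regWeight_zeta_zero hN hτ hab, mul_zero]
  rw [this, regWeight_zero_zero hN hτ, zero_add, zero_add]
  split_ifs with hkl
  · obtain ⟨⟨k, rfl⟩, ⟨l, rfl⟩⟩ := hkl
    have h1 : ∀ (k b : ℤ), regWeight N τ (N * k) b ξ 0 = regWeight N τ 0 b ξ 0 := by
      intro k b
      induction k with
      | zero => simp
      | succ n ih => rw [mul_add, mul_one, regWeight_add_left hN hτ, ih]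
      | pred n ih =>
        rw [← ih, ← regWeight_add_left hN hτ]; congr 1; ring
    have h2 : ∀ (k a : ℤ), regWeight N τ a (N * k) ξ 0 = regWeight N τ a 0 ξ 0 := by
      intro k b
      induction k with
      | zero => simp
      | succ n ih => rw [mul_add, mul_one, regWeight_add_right hN hτ, ih]
      | pred n ih =>
        rw [← ih, ← regWeight_add_right hN hτ]; congr 1; ring
    rw [h1, h2, regWeight_zero_zero hN hτ]; ring
  · rw [regWeight_zeta_zero hN hτ hkl, zero_mul]

/-- The off-diagonal sum identity behind the unitarity of the elliptic R-matrix. -/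
theorem sum_regWeight_unitarity_off (k l : ℤ) (hkl : ¬((N : ℤ) ∣ k ∧ (N : ℤ) ∣ l)) (ξ ζ : ℂ) :
    ∑ a : Fin N, ∑ b : Fin N, ex (2 * (l * (a : ℕ) - k * (b : ℕ)) / N) *
      (regWeight N τ ((a : ℕ) + k) ((b : ℕ) + l) ξ ζ *
          regWeight N τ (a : ℕ) (b : ℕ) (-ξ) ζ) = 0 := by
  have hN' : (N : ℂ) ≠ 0 := Nat.cast_ne_zero.2 hN
  have q := (quasiPeriodic_sum_regWeight hN hτ k l l (-k) ξ (-ξ)).congr_param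
    (μ₁ := ex (2 * k / N)) (ν₁ := ex (-2 * τ - 2 * l / N)) rfl
    (by congr 1; push_cast; ring) (by congr 1; ring)
  simp only [Int.cast_neg, neg_mul, ← sub_eq_add_neg] at q
  set H : ℂ → ℂ := fun ζ => ∑ a : Fin N, ∑ b : Fin N, ex (2 * (l * (a : ℕ) - k * (b : ℕ)) / N) *
      (regWeight N τ ((a : ℕ) + k) ((b : ℕ) + l) ξ ζ *
          regWeight N τ (a : ℕ) (b : ℕ) (-ξ) ζ) with hH
  have hneg : ¬((N : ℤ) ∣ -k ∧ (N : ℤ) ∣ -l) := by simpa using hkl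
  have hprod : ∀ a b : ℤ, regWeight N τ (a + k) (b + l) ξ 0 * regWeight N τ a b (-ξ) 0 = 0 := by
    intro a b
    by_cases h : (N : ℤ) ∣ a ∧ (N : ℤ) ∣ b
    · rw [regWeight_zeta_zero hN hτ (fun h' => hkl ⟨(dvd_add_right h.1).1 h'.1,
        (dvd_add_right h.2).1 h'.2⟩), zero_mul]
    · rw [regWeight_zeta_zero hN hτ h, mul_zero]
  have hH0 : H 0 = 0 := by
    refine Finset.sum_eq_zero fun a _ => Finset.sum_eq_zero fun b _ => ?_
    rw [hprod, mul_zero]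
  -- Together with `H 0 = 0` this is a double zero. In the derivative only two terms survive, those
  -- where the undifferentiated weight has index zero, and they cancel because `oddTheta` is odd.
  have hderiv : HasDerivAt H 0 0 := by
    let e : ℤ → ℤ → ℂ := fun a b => ex (2 * (l * a - k * b) / N)
    let f₁ : ℤ → ℤ → ℂ := fun a b => e a b *
      (deriv (regWeight N τ (a + k) (b + l) ξ) 0 * regWeight N τ a b (-ξ) 0)
    -- The indices are shifted by `(k, l)` so that the surviving term sits at `(0, 0)`.
    let f₂ : ℤ → ℤ → ℂ := fun a b => e (a - k) (b - l) *
      (regWeight N τ a b ξ 0 * deriv (regWeight N τ (a - k) (b - l) (-ξ)) 0)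
    have hsum : HasDerivAt H (∑ a : Fin N, ∑ b : Fin N, (f₁ (a : ℕ) (b : ℕ) +
        f₂ ((a : ℕ) + k) ((b : ℕ) + l))) 0 := by
      refine HasDerivAt.fun_sum fun a _ => HasDerivAt.fun_sum fun b _ => ?_
      have h1 := (differentiable_regWeight hN hτ ((a : ℕ) + k) ((b : ℕ) + l) ξ 0).hasDerivAt
      have h2 := (differentiable_regWeight hN hτ (a : ℕ) (b : ℕ) (-ξ) 0).hasDerivAt
      have := (h1.mul h2).const_mul (ex (2 * (l * (a : ℕ) - k * (b : ℕ)) / N))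
      refine this.congr_deriv ?_
      simp only [f₁, f₂, e, add_sub_cancel_right, Int.cast_natCast]
      ring
    convert hsum using 1
    simp only [Finset.sum_add_distrib]
    have hreg1 : ∀ a b, regWeight N τ (a + N) b = regWeight N τ a b := fun a b =>
      funext fun _ => funext fun _ => regWeight_add_left hN hτ _ _ _ _
    have hreg2 : ∀ a b, regWeight N τ a (b + N) = regWeight N τ a b := fun a b =>
      funext fun _ => funext fun _ => regWeight_add_right hN hτ _ _ _ _
    rw [sum_fin_fin_add_int f₂, sum_fin_fin_eq_zero_term hN f₁, sum_fin_fin_eq_zero_term hN f₂]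
    · have hk : ex (-2 * k / N * -ξ) = ex (2 * k / N * ξ) := by congr 1; ring
      have hp : torsPoint N τ (-k) (-l) 0 = -torsPoint N τ k l 0 := by
        unfold torsPoint; push_cast; ring
      simp only [f₁, f₂, e, zero_add, zero_sub]
      rw [regWeight_zero_zero hN hτ, regWeight_zero_zero hN hτ, deriv_regWeight_zeta_zero hN hτ hkl,
        deriv_regWeight_zeta_zero hN hτ hneg, hp, ← neg_add, oddTheta_neg hτ, oddTheta_neg hτ,
        oddTheta_neg hτ, neg_div_neg_eq]
      have e1 : ex (2 * (l * ((0 : ℤ) : ℂ) - k * ((0 : ℤ) : ℂ)) / N) = 1 := by simp [ex_zero]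
      have e2 : ex (2 * (l * ((-k : ℤ) : ℂ) - k * ((-l : ℤ) : ℂ)) / N) = 1 := by
        rw [← ex_zero]; congr 1; push_cast; ring
      have e3 : ex (2 * ((-k : ℤ) : ℂ) / N * -ξ) = ex (2 * k / N * ξ) := by
        congr 1; push_cast; ring
      rw [e1, e2, e3]; ring
    · intro a b h
      simp only [f₂]
      rw [regWeight_zeta_zero hN hτ h]; ring
    · intro a b h
      simp only [f₁]
      rw [regWeight_zeta_zero hN hτ h]; ring
    · intro a b
      simp only [f₂, e]
      rw [hreg1, show a + (N : ℤ) - k = a - k + N by ring, hreg1]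
      congr 1
      rw [ex_eq_ex_iff]
      exact ⟨l, by push_cast; field_simp; ring⟩
    · intro a b
      simp only [f₂, e]
      rw [hreg2, show b + (N : ℤ) - l = b - l + N by ring, hreg2]
      congr 1
      rw [ex_eq_ex_iff]
      exact ⟨-k, by push_cast; field_simp; ring⟩
  obtain ⟨H₁, q1, e1⟩ := q.exists_eq_oddTheta_mul hτ (ex_ne_zero _) (ex_ne_zero _) hH0
  have h10 : H₁ 0 = 0 := by
    have h := (differentiable_oddTheta hτ 0).hasDerivAt.mul (q1.differentiable 0).hasDerivAt
    have h' := hderiv.unique (h.congr_of_eventuallyEq (.of_forall e1))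
    rw [oddTheta_zero, zero_mul, add_zero] at h'
    exact (mul_eq_zero.1 h'.symm).resolve_left (deriv_oddTheta_ne_zero hτ oddTheta_zero)
  obtain ⟨H₂, q2, e2⟩ := q1.exists_eq_oddTheta_mul hτ (neg_ne_zero.2 (ex_ne_zero _))
    (mul_ne_zero (neg_ne_zero.2 (ex_ne_zero _)) (ex_ne_zero _)) h10
  have q3 := q2.congr_param (d₁ := 0) (μ₁ := ex (2 * k / N)) (ν₁ := ex (-(2 * l / N)))
    (by norm_num) (neg_neg _) (by
      rw [neg_mul, neg_mul, neg_mul, neg_neg, ← ex_add, ← ex_add]; congr 1; ring)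
  have hnorm : ∀ x : ℂ, x.im = 0 → ‖ex x‖ = 1 := fun x hx => by rw [norm_ex, hx]; simp
  -- After removal of the double zero the multipliers are `ω^k` and `ω^{-l}`, not both `1` since
  -- `(k, l)` is nonzero modulo `N`.
  have z := q3.eq_zero hτ (hnorm _ (by
      rw [show (2 * (k : ℂ) / N) = ((2 * k / N : ℝ) : ℂ) by push_cast; ring]; exact Complex.ofReal_im _))
    (hnorm _ (by
      rw [show (-(2 * (l : ℂ) / N)) = ((-(2 * l / N) : ℝ) : ℂ) by push_cast; ring]
      exact Complex.ofReal_im _)) (by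
      by_contra! hc
      obtain ⟨⟨i, hi⟩, ⟨j, hj⟩⟩ := (ex_eq_one_iff _).1 hc.1, (ex_eq_one_iff _).1 hc.2
      refine hkl ⟨⟨i, ?_⟩, ⟨-j, ?_⟩⟩
      · have : (k : ℂ) = N * i := by field_simp at hi; linear_combination hi
        exact_mod_cast this
      · have : (l : ℂ) = N * (-j) := by field_simp at hj; linear_combination -hj
        exact_mod_cast this)
  change H ζ = 0
  rw [e1, e2, z]; ring

omit hN in
/-- The functions `ϑ(u+ξ)ϑ(u-ξ)/ϑ(u)²` of `ξ` are theta functions of degree two. -/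
theorem quasiPeriodic_mul_div_sq (u : ℂ) : QuasiPeriodic τ 2 1 (ex (-2 * τ)) fun ξ =>
    oddTheta τ (u + ξ) * oddTheta τ (u - ξ) / oddTheta τ u ^ 2 := by
  have h1 := (QuasiPeriodic.oddTheta hτ).translate u
  have h2 := (QuasiPeriodic.oddTheta hτ).translate (-u)
  have h3 := (h1.mul h2).const_mul (-1 / oddTheta τ u ^ 2)
  have h4 : (fun ξ => oddTheta τ (u + ξ) * oddTheta τ (u - ξ) / oddTheta τ u ^ 2) =
      fun x => -1 / oddTheta τ u ^ 2 * (oddTheta τ (x + u) * oddTheta τ (x + -u)) := by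
    funext ξ
    rw [show u - ξ = -(ξ + -u) by ring, oddTheta_neg hτ, add_comm u]; ring
  rw [h4]
  refine h3.congr_param (by norm_num) (by norm_num) ?_
  rw [show -ex (-τ) * ex (-2 * 1 * u) * (-ex (-τ) * ex (-2 * 1 * -u)) =
    ex (-τ) * ex (-2 * 1 * u) * ex (-τ) * ex (-2 * 1 * -u) by ring, ← ex_add, ← ex_add, ← ex_add]
  congr 1; ring

omit hN hτ in
/-- An even entire function is its value at `0` up to second order. -/
theorem exists_eq_add_sq_mul_of_even {f : ℂ → ℂ} (hf : Differentiable ℂ f)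
    (heven : ∀ x, f (-x) = f x) :
    ∃ g : ℂ → ℂ, Differentiable ℂ g ∧ ∀ x, f x = f 0 + x ^ 2 * g x := by
  have hid : ∀ x : ℂ, id x = 0 → deriv id x ≠ 0 := fun x _ => by simp
  obtain ⟨k, hk, ek⟩ := exists_entire_quotient (hf.sub_const (f 0)) differentiable_id hid
    fun x hx => by rw [id] at hx; rw [hx, sub_self]
  have hodd : ∀ x, k (-x) = -k x := eq_of_eq_off_zeros differentiable_id hid
    (hk.continuous.comp continuous_neg) hk.continuous.neg fun x hx => by
      have h1 := ek x
      have h2 := ek (-x)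
      rw [heven, h1] at h2
      simp only [id] at h2 hx
      apply mul_left_cancel₀ hx
      linear_combination h2
  have hk0 : k 0 = 0 := by
    have := hodd 0
    rw [neg_zero] at this
    linear_combination this / 2
  obtain ⟨g, hg, eg⟩ := exists_entire_quotient hk differentiable_id hid
    fun x hx => by rw [id] at hx; rw [hx, hk0]
  refine ⟨g, hg, fun x => ?_⟩
  have h1 := ek x
  rw [eg x] at h1
  simp only [id] at h1
  linear_combination h1

omit hN hτ in
-- The second-order coefficient of a product of such factors is the sum of their coefficients; this
-- turns a product formula into a sum formula.
theorem exists_prod_one_add_sq_mul {ι : Type*} (s : Finset ι) (g : ι → ℂ → ℂ)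
    (hg : ∀ i ∈ s, Continuous (g i)) : ∃ p : ℂ → ℂ, Continuous p ∧
      (∀ x, ∏ i ∈ s, (1 + x ^ 2 * g i x) = 1 + x ^ 2 * p x) ∧ p 0 = ∑ i ∈ s, g i 0 := by
  classical
  induction s using Finset.induction_on with
  | empty => exact ⟨fun _ => 0, continuous_const, by simp, by simp⟩
  | insert i s hi ih =>
    obtain ⟨p, hp, e, e0⟩ := ih fun j hj => hg j (Finset.mem_insert_of_mem hj)
    have hgi := hg i (Finset.mem_insert_self _ _)
    refine ⟨fun x => g i x + p x + x ^ 2 * (g i x * p x), by fun_prop, fun x => ?_, ?_⟩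
    · rw [Finset.prod_insert hi, e]; ring
    · dsimp only; rw [Finset.sum_insert hi, e0]; ring

omit hN hτ in
theorem prod_fin_add_one {N : ℕ} (hN : N ≠ 0) (f : ℤ → ℂ) (κ : ℂ) (hf : f N = κ * f 0) :
    ∏ b : Fin N, f (((b : ℕ) : ℤ) + 1) = κ * ∏ b : Fin N, f ((b : ℕ) : ℤ) := by
  obtain ⟨n, rfl⟩ := Nat.exists_eq_succ_of_ne_zero hN
  rw [Fin.prod_univ_castSucc, Fin.prod_univ_succ]
  simp only [Fin.val_castSucc, Fin.val_last, Fin.val_succ, Fin.val_zero, Nat.cast_succ,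
    Nat.cast_zero] at hf ⊢
  rw [hf]; ring

/-- The multiplication formula for the odd theta function. -/
theorem exists_prod_torsPoint_eq : ∃ C : ℂ, ∀ ζ, ∏ a : Fin N, ∏ b : Fin N,
    oddTheta τ (torsPoint N τ (a : ℕ) (b : ℕ) ζ) =
      C * ex (-(N - 1) * ζ) * oddTheta τ ζ := by
  have hN' : (N : ℂ) ≠ 0 := Nat.cast_ne_zero.2 hN
  have hone : ∀ (a b : ℤ) (ζ : ℂ), torsPoint N τ a b (ζ + 1) = torsPoint N τ a (b + 1) ζ := by
    intro a b ζ; unfold torsPoint; push_cast; ring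
  have htau : ∀ (a b : ℤ) (ζ : ℂ), torsPoint N τ a b (ζ + τ) = torsPoint N τ (a + 1) b ζ := by
    intro a b ζ; unfold torsPoint; push_cast; ring
  have q : QuasiPeriodic τ 1 ((-1) ^ N) (∏ b : Fin N, -ex (-2 * ((b : ℕ) / N) - τ)) fun ζ =>
      ∏ a : Fin N, ∏ b : Fin N, oddTheta τ (torsPoint N τ (a : ℕ) (b : ℕ) ζ) := by
    refine ⟨?_, fun ζ => ?_, fun ζ => ?_⟩
    · refine Differentiable.fun_finsetProd fun a _ => Differentiable.fun_finsetProd fun b _ =>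
        (differentiable_oddTheta hτ).comp ?_
      unfold torsPoint; fun_prop
    · have h1 : ∀ a : Fin N, ∏ b : Fin N, oddTheta τ (torsPoint N τ (a : ℕ) (b : ℕ) (ζ + 1)) =
          -1 * ∏ b : Fin N, oddTheta τ (torsPoint N τ (a : ℕ) (b : ℕ) ζ) := by
        intro a
        simp only [hone]
        refine prod_fin_add_one hN (fun b => oddTheta τ (torsPoint N τ (a : ℕ) b ζ)) (-1) ?_
        have := torsPoint_add_right (τ := τ) hN (a : ℕ) 0 ζ
        rw [zero_add] at this
        rw [this, oddTheta_add_one, neg_one_mul]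
      rw [Finset.prod_congr rfl fun a _ => h1 a, Finset.prod_mul_distrib]
      simp
    · simp only [htau]
      refine (prod_fin_add_one hN (fun a => ∏ b : Fin N,
        oddTheta τ (torsPoint N τ a (b : ℕ) ζ)) _ ?_)
      have h1 : ∀ b : Fin N, oddTheta τ (torsPoint N τ N (b : ℕ) ζ) =
          -ex (-2 * ((b : ℕ) / N) - τ) * ex (-2 * ζ / N) *
            oddTheta τ (torsPoint N τ 0 (b : ℕ) ζ) := by
        intro b
        have := torsPoint_add_left (τ := τ) hN 0 (b : ℕ) ζ
        rw [zero_add] at this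
        rw [this, oddTheta_add_tau hτ, neg_mul (ex (-2 * ((b : ℕ) / N) - τ)), ← ex_add]
        congr 3
        simp only [torsPoint]; push_cast; ring
      rw [Finset.prod_congr rfl fun b _ => h1 b, Finset.prod_mul_distrib, Finset.prod_mul_distrib]
      congr 2
      rw [Finset.prod_const, Finset.card_univ, Fintype.card_fin, ← ex_nat_mul]
      congr 1; field_simp
  have hprod0 : (∏ b : Fin N, -ex (-2 * ((b : ℕ) / N) - τ)) ≠ 0 :=
    Finset.prod_ne_zero_iff.2 fun b _ => neg_ne_zero.2 (ex_ne_zero _)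
  have : NeZero N := ⟨hN⟩
  obtain ⟨Q, qQ, eQ⟩ := q.exists_eq_oddTheta_mul hτ (by simp) hprod0
    (Finset.prod_eq_zero (Finset.mem_univ (0 : Fin N))
      (Finset.prod_eq_zero (Finset.mem_univ (0 : Fin N)) (by simp [torsPoint, oddTheta_zero])))
  -- The quotient by `oddTheta` has a non-unimodular multiplier for `τ`; this exponential
  -- compensates for it, as Liouville's theorem requires.
  have qe : QuasiPeriodic τ 0 (ex (N - 1)) (ex ((N - 1) * τ)) fun ζ => ex ((N - 1) * ζ) :=
    ⟨differentiable_ex.comp (by fun_prop), fun ζ => by rw [← ex_add]; ring_nf,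
      fun ζ => by simp only [mul_zero, zero_mul, ex_zero, mul_one]; rw [← ex_add]; ring_nf⟩
  have hnorm : ∀ b : Fin N, ‖-ex (-2 * ((b : ℕ) / N) - τ)‖ = ‖ex (-τ)‖ := by
    intro b
    rw [norm_neg, norm_ex, norm_ex,
      show (-2 * (((b : ℕ) : ℂ) / N) - τ) = ((-2 * (b : ℕ) / N : ℝ) : ℂ) + -τ by push_cast; ring,
      Complex.add_im, Complex.ofReal_im, zero_add]
  obtain ⟨C, hC⟩ := ((qQ.mul qe).congr_param (d₁ := 0) (by norm_num) rfl rfl).exists_eq_const hτ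
    (by
      rw [norm_mul, norm_neg, norm_pow, norm_neg, norm_one, one_pow, one_mul, norm_ex]
      simp)
    (by
      rw [norm_mul, norm_mul, norm_neg, norm_prod, Finset.prod_congr rfl fun b _ => hnorm b,
        Finset.prod_const, Finset.card_univ, Fintype.card_fin, ← norm_pow, ← ex_nat_mul,
        ← norm_mul, ← norm_mul, ← ex_add, ← ex_add, show (N : ℂ) * -τ + τ + (N - 1) * τ = 0 by ring,
        ex_zero, norm_one])
  refine ⟨C, fun ζ => ?_⟩
  rw [eQ, ← hC ζ]
  have : ex ((N - 1) * ζ) * ex (-(N - 1) * ζ) = 1 := by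
    rw [← ex_add, ← ex_zero]; congr 1; ring
  linear_combination -oddTheta τ ζ * Q ζ * this

/-- The diagonal sum identity behind the unitarity of the elliptic R-matrix. -/
theorem sum_regWeight_unitarity_diag (ξ ζ : ℂ) :
    ∑ a : Fin N, ∑ b : Fin N, (regWeight N τ (a : ℕ) (b : ℕ) ξ ζ *
          regWeight N τ (a : ℕ) (b : ℕ) (-ξ) ζ) =
      N ^ 2 * (oddTheta τ (ζ + ξ) * oddTheta τ (ζ - ξ)) := by
  have hN' : (N : ℂ) ≠ 0 := Nat.cast_ne_zero.2 hN
  refine eq_of_eq_off_lattice hτ (A := fun ζ => ∑ a : Fin N, ∑ b : Fin N,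
    (regWeight N τ (a : ℕ) (b : ℕ) ξ ζ * regWeight N τ (a : ℕ) (b : ℕ) (-ξ) ζ))
    (B := fun ζ => N ^ 2 * (oddTheta τ (ζ + ξ) * oddTheta τ (ζ - ξ))) ?_ ?_ (fun ζ hζ => ?_) ζ
  · exact continuous_finsetSum _ fun a _ => continuous_finsetSum _ fun b _ =>
      (differentiable_regWeight hN hτ _ _ ξ).continuous.mul
        (differentiable_regWeight hN hτ _ _ (-ξ)).continuous
  · have := (differentiable_oddTheta hτ).continuous
    fun_prop
  let E : ℂ → ℂ → ℂ := fun u ξ => oddTheta τ (u + ξ) * oddTheta τ (u - ξ) / oddTheta τ u ^ 2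
  let U : Fin N × Fin N → ℂ := fun i => torsPoint N τ (i.1 : ℕ) (i.2 : ℕ) ζ
  have hU : ∀ i, oddTheta τ (U i) ≠ 0 := fun i => oddTheta_torsPoint_ne_zero hN hτ _ _ hζ
  have hEeven : ∀ u x, E u (-x) = E u x := fun u x => by
    simp only [E, sub_neg_eq_add, ← sub_eq_add_neg]; ring
  have hE0 : ∀ {u}, oddTheta τ u ≠ 0 → E u 0 = 1 := fun {u} hu => by
    simp only [E, add_zero, sub_zero]; field_simp
  have hg : ∀ u, ∃ g : ℂ → ℂ, Continuous g ∧ (oddTheta τ u ≠ 0 → ∀ x, E u x = 1 + x ^ 2 * g x) := by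
    intro u
    obtain ⟨g, hg, e⟩ := exists_eq_add_sq_mul_of_even
      (quasiPeriodic_mul_div_sq hτ u).differentiable (hEeven u)
    exact ⟨g, hg.continuous, fun hu x => by rw [← hE0 hu]; exact e x⟩
  choose g hgc hge using hg
  -- By the multiplication formula the product of `E` over the torsion points is `E` itself at the
  -- dilated argument `N x`; the exponential factors cancel between `x` and `-x`.
  have hprod : ∀ x, ∏ i, E (U i) x = E ζ (N * x) := by
    intro x
    obtain ⟨C, hC⟩ := exists_prod_torsPoint_eq hN hτ
    have hC0 : C ≠ 0 := by
      rintro rfl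
      have := hC ζ
      rw [zero_mul, zero_mul] at this
      refine Finset.prod_ne_zero_iff.2 (fun a _ => Finset.prod_ne_zero_iff.2 fun b _ => ?_) this
      exact hU (a, b)
    have h1 : ∀ x, ∏ i : Fin N × Fin N, oddTheta τ (U i + x) =
        C * ex (-(N - 1) * (ζ + N * x)) * oddTheta τ (ζ + N * x) := by
      intro x
      rw [← hC, Fintype.prod_prod_type]
      refine Finset.prod_congr rfl fun a _ => Finset.prod_congr rfl fun b _ => ?_
      congr 1
      simp only [U, torsPoint]; field_simp; ring
    simp only [E, Finset.prod_div_distrib, Finset.prod_mul_distrib, Finset.prod_pow, sub_eq_add_neg]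
    have h2 := h1 0
    simp only [mul_zero, add_zero] at h2
    rw [h1, h1, h2]
    have e : ex (-(N - 1) * (ζ + N * x)) * ex (-(N - 1) * (ζ + N * -x)) =
        ex (-(N - 1) * ζ) ^ 2 := by
      rw [sq, ← ex_add, ← ex_add]; congr 1; ring
    have := ex_ne_zero (-(N - 1) * ζ)
    rw [div_eq_div_iff (by positivity) (by positivity), mul_neg]
    rw [mul_neg] at e
    linear_combination C ^ 2 * oddTheta τ (ζ + N * x) * oddTheta τ (ζ + -(N * x)) *
      oddTheta τ ζ ^ 2 * e
  obtain ⟨p, hp, ep, hp0⟩ := exists_prod_one_add_sq_mul Finset.univ (fun i => g (U i))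
    fun i _ => hgc _
  -- Comparison of second-order coefficients in the product formula; the dilation by `N` contributes
  -- `N²`.
  have hsum0 : ∑ i, g (U i) 0 = N ^ 2 * g ζ 0 := by
    rw [← hp0]
    have hNc : Continuous fun x : ℂ => N ^ 2 * g ζ (N * x) := by
      have := hgc ζ; fun_prop
    have := eq_of_eq_off_zeros differentiable_id (fun x _ => by simp) hp hNc (fun x hx => by
      have h1 := hprod x
      rw [hge ζ hζ, Finset.prod_congr rfl fun i _ => hge (U i) (hU i) x, ep] at h1
      apply mul_left_cancel₀ (pow_ne_zero 2 (by simpa using hx : x ≠ 0))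
      linear_combination h1) 0
    rw [this, mul_zero]
  have qK : QuasiPeriodic τ 2 1 (ex (-2 * τ)) fun x => ∑ i, E (U i) x - N ^ 2 * E ζ x :=
    (QuasiPeriodic.sum Finset.univ fun i _ => quasiPeriodic_mul_div_sq hτ (U i)).sub
      ((quasiPeriodic_mul_div_sq hτ ζ).const_mul _)
  have hKeq : ∀ x, ∑ i, E (U i) x - N ^ 2 * E ζ x =
      x ^ 2 * (∑ i, g (U i) x - N ^ 2 * g ζ x) := by
    intro x
    rw [Finset.sum_congr rfl fun i _ => hge (U i) (hU i) x, hge ζ hζ, Finset.sum_add_distrib,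
      ← Finset.mul_sum]
    simp
    ring
  -- The difference of the two sides is an even theta function of degree two vanishing at `0`, hence
  -- `c ϑ²`. Its second-order coefficient is zero by `hsum0`, whereas that of `ϑ²` is not, so `c =
  -- 0`.
  obtain ⟨c, hc⟩ := qK.eq_const_mul_sq hτ (fun x => by simp only [hEeven]) (by rw [hKeq]; simp)
  have hc0 : c = 0 := by
    have hid : ∀ x : ℂ, id x = 0 → deriv id x ≠ 0 := fun x _ => by simp
    obtain ⟨s, hs, es⟩ := exists_entire_quotient (differentiable_oddTheta hτ) differentiable_id hid
      fun x hx => by rw [id] at hx; rw [hx, oddTheta_zero]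
    have hs0 : s 0 ≠ 0 := by
      have h := (hasDerivAt_id (0 : ℂ)).mul (hs 0).hasDerivAt
      have h' := (differentiable_oddTheta hτ 0).hasDerivAt.unique
        (h.congr_of_eventuallyEq (.of_forall es))
      have := deriv_oddTheta_ne_zero hτ (oddTheta_zero (τ := τ))
      rw [h'] at this
      simpa using this
    have hcont : Continuous fun x => ∑ i, g (U i) x - N ^ 2 * g ζ x :=
      (continuous_finsetSum _ fun i _ => hgc _).sub (continuous_const.mul (hgc ζ))
    have := eq_of_eq_off_zeros (B := fun x => c * s x ^ 2) differentiable_id hid hcont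
      (continuous_const.mul (hs.continuous.pow 2)) (fun x hx => by
        have h1 := hc x
        rw [hKeq, es] at h1
        simp only [id] at h1 hx
        apply mul_left_cancel₀ (pow_ne_zero 2 hx)
        linear_combination h1) 0
    rw [hsum0, sub_self] at this
    simpa [hs0] using this.symm
  have hfin := hc ξ
  rw [hc0, zero_mul, sub_eq_zero, Fintype.sum_prod_type] at hfin
  calc _ = oddTheta τ ζ ^ 2 * ∑ a : Fin N, ∑ b : Fin N, E (U (a, b)) ξ := by
        rw [Finset.mul_sum]
        refine Finset.sum_congr rfl fun a _ => ?_
        rw [Finset.mul_sum]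
        refine Finset.sum_congr rfl fun b _ => ?_
        have h1 := hU (a, b)
        rw [regWeight_eq hN hτ _ _ _ h1, regWeight_eq hN hτ _ _ _ h1]
        have e : ex (2 * (((a : ℕ) : ℤ) : ℂ) / N * ξ) * ex (2 * (((a : ℕ) : ℤ) : ℂ) / N * -ξ) = 1 := by
          rw [← ex_add, ← ex_zero]; congr 1; ring
        simp only [E, U]
        rw [show -ξ + torsPoint N τ (a : ℕ) (b : ℕ) ζ = torsPoint N τ (a : ℕ) (b : ℕ) ζ - ξ by ring,
          add_comm ξ]
        linear_combination oddTheta τ ζ ^ 2 * (oddTheta τ (torsPoint N τ (a : ℕ) (b : ℕ) ζ + ξ) *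
          oddTheta τ (torsPoint N τ (a : ℕ) (b : ℕ) ζ - ξ) /
            oddTheta τ (torsPoint N τ (a : ℕ) (b : ℕ) ζ) ^ 2) * e
    _ = _ := by
        rw [hfin]; simp only [E]; field_simp

end

/-! ### Heisenberg commutation relations -/

section Heisenberg

variable {Γ : Type*} [Group Γ] {g h z : Γ} (hz : ∀ x, Commute z x) (hgz : h * g = z * (g * h))
include hz hgz

/-- Conjugation by `h` multiplies `g` by the central element `z`, and conjugation by a power of `g`
multiplies `h` by a power of `z`. All phases in products of the `I_{(a,b)}` come from this. -/
theorem heisenberg_zpow (a b : ℤ) : h ^ a * g ^ b = z ^ (a * b) * (g ^ b * h ^ a) := by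
  have h1 : h * g * h⁻¹ = z * g := by rw [hgz]; group
  have h2 : h * g ^ b * h⁻¹ = z ^ b * g ^ b := by rw [← conj_zpow, h1, (hz g).mul_zpow]
  have h3 : (g ^ b)⁻¹ * h * (g ^ b)⁻¹⁻¹ = z ^ b * h := by
    have e : h * g ^ b = z ^ b * g ^ b * h := by rw [← h2]; group
    rw [inv_inv, mul_assoc, e, ((hz (g ^ b)).zpow_left b).eq]; group
  have h4 : (g ^ b)⁻¹ * h ^ a * (g ^ b)⁻¹⁻¹ = z ^ (a * b) * h ^ a := by
    rw [← conj_zpow, h3, ((hz h).zpow_left b).mul_zpow, ← zpow_mul, mul_comm b a]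
  have h5 : h ^ a * g ^ b = g ^ b * ((g ^ b)⁻¹ * h ^ a * (g ^ b)⁻¹⁻¹) := by group
  rw [h5, h4, ← mul_assoc, ← ((hz (g ^ b)).zpow_left (a * b)).eq, mul_assoc]

theorem heisenberg_mul (k l a b : ℤ) : g ^ l * h ^ k * (g ^ b * h ^ a) =
    z ^ (k * b) * (g ^ (b + l) * h ^ (a + k)) := by
  have e := heisenberg_zpow hz hgz k b
  calc g ^ l * h ^ k * (g ^ b * h ^ a) = g ^ l * (h ^ k * g ^ b) * h ^ a := by group
    _ = (g ^ l * z ^ (k * b)) * g ^ b * h ^ k * h ^ a := by rw [e]; group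
    _ = _ := by
      rw [← ((hz (g ^ l)).zpow_left (k * b)).eq, add_comm b l, add_comm a k, zpow_add, zpow_add]
      group

theorem heisenberg_mul_inv (k l a b : ℤ) :
    g ^ (b + l) * h ^ (a + k) * (g ^ b * h ^ a)⁻¹ = z ^ (-(k * b)) * (g ^ l * h ^ k) := by
  rw [mul_inv_eq_iff_eq_mul, mul_assoc, heisenberg_mul hz hgz, ← mul_assoc, ← zpow_add]
  simp

theorem heisenberg_inv_mul (k l a b : ℤ) :
    (g ^ (b + l) * h ^ (a + k))⁻¹ * (g ^ b * h ^ a) = z ^ (a * l) * (g ^ l * h ^ k)⁻¹ := by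
  have e := heisenberg_mul hz hgz a b k l
  rw [add_comm l b, add_comm k a] at e
  rw [inv_mul_eq_iff_eq_mul, ← mul_assoc, ← ((hz _).zpow_left (a * l)).eq, ← e,
    mul_inv_cancel_right]

theorem heisenberg_mul_g (a b : ℤ) : g ^ b * h ^ a * g = z ^ a * (g * (g ^ b * h ^ a)) := by
  have e := heisenberg_zpow hz hgz a 1
  rw [zpow_one, mul_one] at e
  rw [mul_assoc, e, ← mul_assoc, ← ((hz _).zpow_left a).eq]
  group

theorem heisenberg_mul_hg (a b : ℤ) :
    g ^ b * h ^ a * (h * g) = z ^ (a - b) * (h * g * (g ^ b * h ^ a)) := by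
  have e := heisenberg_mul hz hgz a b 1 1
  have e' := heisenberg_mul hz hgz 1 1 a b
  have e1 := heisenberg_mul hz hgz 1 0 0 1
  simp only [zpow_one, zpow_zero, one_mul, mul_one, add_zero, zero_add] at e1
  simp only [zpow_one, mul_one, one_mul] at e e'
  rw [e1, ← mul_assoc _ z, ← (hz _).eq, mul_assoc, e, mul_assoc z, e', add_comm 1 b, add_comm 1 a]
  generalize g ^ (b + 1) * h ^ (a + 1) = x
  group

end Heisenberg

/-! ### The matrices `g`, `h`, `g^{1/2}` -/

section Matrices

variable {N : ℕ}

theorem hMat_pow (hN : N ≠ 0) (a : ℕ) : hMat N ^ a =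
    Matrix.of fun i j : Fin N => if ((i : ℕ) + a) % N = (j : ℕ) then 1 else 0 := by
  induction a with
  | zero =>
    ext i j
    simp [Matrix.one_apply, Nat.mod_eq_of_lt i.2, Fin.ext_iff]
  | succ a ih =>
    ext i j
    have hlt : ((i : ℕ) + a) % N < N := Nat.mod_lt _ (Nat.pos_of_ne_zero hN)
    rw [pow_succ, ih, Matrix.mul_apply, Finset.sum_eq_single ⟨((i : ℕ) + a) % N, hlt⟩]
    · simp [hMat, ← add_assoc]
    · intro k _ hk
      have : ((i : ℕ) + a) % N ≠ (k : ℕ) := fun e => hk (Fin.ext e.symm)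
      simp [this]
    · simp

theorem hMat_pow_self (hN : N ≠ 0) : hMat N ^ N = 1 := by
  rw [hMat_pow hN]
  ext i j
  simp [Matrix.one_apply, Nat.mod_eq_of_lt i.2, Fin.ext_iff]

theorem gMat_pow_self (hN : N ≠ 0) : gMat N ^ N = 1 := by
  have hN' : (N : ℂ) ≠ 0 := Nat.cast_ne_zero.2 hN
  rw [gMat, Matrix.diagonal_pow, ← Matrix.diagonal_one]
  congr 1
  funext i
  rw [Pi.pow_apply, ← ex_nat_mul, ex_eq_one_iff]
  exact ⟨(i : ℕ) + 1, by push_cast; field_simp⟩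

theorem gHalf_mul_gHalf : gHalf N * gHalf N = gMat N := by
  rw [gHalf, gMat, Matrix.diagonal_mul_diagonal]
  congr 1
  funext i
  rw [← ex_add]; ring_nf

theorem hMat_mul_gMat (hN : N ≠ 0) : hMat N * gMat N = ex (2 / N) • (gMat N * hMat N) := by
  have hN' : (N : ℂ) ≠ 0 := Nat.cast_ne_zero.2 hN
  ext i j
  rw [gMat, Matrix.mul_diagonal, Matrix.smul_apply, Matrix.diagonal_mul]
  simp only [hMat, Matrix.of_apply, smul_eq_mul]
  split_ifs with h
  · rw [one_mul, mul_one, ← ex_add, ← h, ex_eq_ex_iff]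
    -- Reducing `i + 1` modulo `N` changes the exponent by an even integer, so the wrap-around entry
    -- obeys the same relation.
    have h1 := Nat.div_add_mod ((i : ℕ) + 1) N
    have h2 : ((((i : ℕ) + 1) % N : ℕ) : ℂ) = (i : ℕ) + 1 - N * ((((i : ℕ) + 1) / N : ℕ) : ℂ) := by
      rw [eq_sub_iff_add_eq, add_comm]; exact_mod_cast h1
    refine ⟨-((((i : ℕ) + 1) / N : ℕ) : ℤ), ?_⟩
    rw [h2]
    generalize ((i : ℕ) + 1) / N = d
    push_cast; field_simp; ring
  · simp

/-- The matrix `h` as a unit. -/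
def hUnit (hN : N ≠ 0) : (Matrix (Fin N) (Fin N) ℂ)ˣ := Units.ofPowEqOne _ N (hMat_pow_self hN) hN

/-- The matrix `g^{1/2}` as a unit. -/
def gHalfUnit (N : ℕ) : (Matrix (Fin N) (Fin N) ℂ)ˣ where
  val := gHalf N
  inv := Matrix.diagonal fun i => ex (-(((i : ℕ) + 1 : ℂ) / N))
  val_inv := by
    rw [gHalf, Matrix.diagonal_mul_diagonal, ← Matrix.diagonal_one]
    congr 1; funext i; rw [← ex_add, add_neg_cancel, ex_zero]
  inv_val := by
    rw [gHalf, Matrix.diagonal_mul_diagonal, ← Matrix.diagonal_one]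
    congr 1; funext i; rw [← ex_add, neg_add_cancel, ex_zero]

/-- The matrix `g` as a unit. -/
def gUnit (N : ℕ) : (Matrix (Fin N) (Fin N) ℂ)ˣ := gHalfUnit N * gHalfUnit N

/-- The matrix `g^{1/2} h g^{1/2}` as a unit. -/
def ghgUnit (hN : N ≠ 0) : (Matrix (Fin N) (Fin N) ℂ)ˣ := gHalfUnit N * hUnit hN * gHalfUnit N

/-- The root of unity `e^{2iπ/N}` as a scalar unit. -/
def omegaUnit (N : ℕ) : (Matrix (Fin N) (Fin N) ℂ)ˣ :=
  Units.map (algebraMap ℂ (Matrix (Fin N) (Fin N) ℂ)).toMonoidHom (Units.mk0 _ (ex_ne_zero (2 / N)))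

theorem coe_hUnit (hN : N ≠ 0) : (hUnit hN : Matrix (Fin N) (Fin N) ℂ) = hMat N := rfl

theorem coe_gHalfUnit : (gHalfUnit N : Matrix (Fin N) (Fin N) ℂ) = gHalf N := rfl

theorem coe_gUnit : (gUnit N : Matrix (Fin N) (Fin N) ℂ) = gMat N := gHalf_mul_gHalf

theorem coe_ghgUnit (hN : N ≠ 0) : (ghgUnit hN : Matrix (Fin N) (Fin N) ℂ) = ghg N := rfl

theorem coe_omegaUnit_zpow (k : ℤ) :
    ((omegaUnit N ^ k : (Matrix (Fin N) (Fin N) ℂ)ˣ) : Matrix (Fin N) (Fin N) ℂ) =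
      algebraMap ℂ _ (ex (2 * k / N)) := by
  rw [omegaUnit, ← map_zpow, Units.coe_map]
  simp only [RingHom.toMonoidHom_eq_coe, MonoidHom.coe_coe, Units.val_zpow_eq_zpow_val,
    Units.val_mk0, ← ex_int_mul]
  congr 2; ring

theorem omegaUnit_commute (x : (Matrix (Fin N) (Fin N) ℂ)ˣ) : Commute (omegaUnit N) x := by
  apply Units.ext
  exact Algebra.commutes _ _

theorem hUnit_mul_gUnit (hN : N ≠ 0) :
    hUnit hN * gUnit N = omegaUnit N * (gUnit N * hUnit hN) := by
  apply Units.ext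
  rw [Units.val_mul, Units.val_mul, Units.val_mul, coe_gUnit, coe_hUnit, hMat_mul_gMat hN,
    Algebra.smul_def]
  rfl

/-- The matrix `I_{(a,b)}` as a unit, for integers `a`, `b`. -/
def iUnit (hN : N ≠ 0) (a b : ℤ) : (Matrix (Fin N) (Fin N) ℂ)ˣ := gUnit N ^ b * hUnit hN ^ a

theorem coe_iUnit (hN : N ≠ 0) (a b : ℕ) :
    (iUnit hN a b : Matrix (Fin N) (Fin N) ℂ) = iMat N a b := by
  rw [iUnit, zpow_natCast, zpow_natCast, Units.val_mul, Units.val_pow_eq_pow_val,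
    Units.val_pow_eq_pow_val, coe_gUnit, coe_hUnit, iMat]

theorem iUnit_add_left (hN : N ≠ 0) (a b : ℤ) : iUnit hN (a + N) b = iUnit hN a b := by
  have : hUnit hN ^ (N : ℤ) = 1 := by
    rw [zpow_natCast]; exact Units.ext (hMat_pow_self hN)
  rw [iUnit, zpow_add, this, mul_one, iUnit]

theorem iUnit_add_right (hN : N ≠ 0) (a b : ℤ) : iUnit hN a (b + N) = iUnit hN a b := by
  have : gUnit N ^ (N : ℤ) = 1 := by
    rw [zpow_natCast]; refine Units.ext ?_
    rw [Units.val_pow_eq_pow_val, coe_gUnit, gMat_pow_self hN, Units.val_one]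
  rw [iUnit, zpow_add, this, mul_one, iUnit]

section Scalars

variable (hN : N ≠ 0)

theorem algebraMap_mul_eq_smul (c : ℂ) (X : Matrix (Fin N) (Fin N) ℂ) :
    algebraMap ℂ _ c * X = c • X := (Algebra.smul_def c X).symm

theorem iUnit_mul_inv (k l a b : ℤ) :
    (iUnit hN (a + k) (b + l)).val * ((iUnit hN a b)⁻¹).val =
      ex (-(2 * (k * b) / N)) • (iUnit hN k l).val := by
  rw [← Units.val_mul, show iUnit hN (a + k) (b + l) * (iUnit hN a b)⁻¹ = _ from
    heisenberg_mul_inv omegaUnit_commute (hUnit_mul_gUnit hN) k l a b, Units.val_mul,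
    coe_omegaUnit_zpow, algebraMap_mul_eq_smul, iUnit]
  congr 2; push_cast; ring

theorem iUnit_inv_mul (k l a b : ℤ) :
    ((iUnit hN (a + k) (b + l))⁻¹).val * (iUnit hN a b).val =
      ex (2 * (a * l) / N) • ((iUnit hN k l)⁻¹).val := by
  rw [← Units.val_mul, show (iUnit hN (a + k) (b + l))⁻¹ * iUnit hN a b = _ from
    heisenberg_inv_mul omegaUnit_commute (hUnit_mul_gUnit hN) k l a b, Units.val_mul,
    coe_omegaUnit_zpow, algebraMap_mul_eq_smul, iUnit]
  congr 2; push_cast; ring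

theorem iUnit_mul_inv' (k l a b : ℤ) :
    (iUnit hN a b).val * ((iUnit hN (a + k) (b + l))⁻¹).val =
      ex (2 * (k * b) / N) • ((iUnit hN k l)⁻¹).val := by
  have e : iUnit hN (a + k) (b + l) * (iUnit hN a b)⁻¹ = omegaUnit N ^ (-(k * b)) * iUnit hN k l :=
    heisenberg_mul_inv omegaUnit_commute (hUnit_mul_gUnit hN) k l a b
  have e' : iUnit hN a b * (iUnit hN (a + k) (b + l))⁻¹ =
      omegaUnit N ^ (k * b) * (iUnit hN k l)⁻¹ := by
    have := congrArg (·⁻¹) e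
    simp only [mul_inv_rev, inv_inv, zpow_neg] at this
    rw [this, ((omegaUnit_commute (iUnit hN k l)⁻¹).zpow_left _).eq]
  rw [← Units.val_mul, e', Units.val_mul, coe_omegaUnit_zpow, algebraMap_mul_eq_smul]
  congr 2; push_cast; ring

theorem iUnit_mul_g (a b : ℤ) : (iUnit hN a b).val * gMat N =
    ex (2 * a / N) • (gMat N * (iUnit hN a b).val) := by
  rw [← coe_gUnit, ← Units.val_mul, show iUnit hN a b * gUnit N = _ from
    heisenberg_mul_g omegaUnit_commute (hUnit_mul_gUnit hN) a b, Units.val_mul,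
    coe_omegaUnit_zpow, algebraMap_mul_eq_smul, iUnit, Units.val_mul]

theorem iUnit_mul_hg (a b : ℤ) : (iUnit hN a b).val * (hMat N * gMat N) =
    ex (2 * (a - b) / N) • (hMat N * gMat N * (iUnit hN a b).val) := by
  rw [← coe_gUnit, ← coe_hUnit hN, ← Units.val_mul, ← Units.val_mul,
    show iUnit hN a b * (hUnit hN * gUnit N) = _ from
    heisenberg_mul_hg omegaUnit_commute (hUnit_mul_gUnit hN) a b, Units.val_mul,
    coe_omegaUnit_zpow, algebraMap_mul_eq_smul, iUnit, Units.val_mul]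
  push_cast; rfl

theorem iUnit_inv_mul_hg (a b : ℤ) : ((iUnit hN a b)⁻¹).val * (hMat N * gMat N) =
    ex (-(2 * (a - b) / N)) • (hMat N * gMat N * ((iUnit hN a b)⁻¹).val) := by
  have e := iUnit_mul_hg hN a b
  have e2 := congrArg (fun X => ex (-(2 * (a - b) / N)) •
    (((iUnit hN a b)⁻¹).val * X * ((iUnit hN a b)⁻¹).val)) e
  simp only [Matrix.mul_smul, Matrix.smul_mul, smul_smul, ← ex_add, neg_add_cancel, ex_zero,
    one_smul, Units.inv_mul_cancel_left, mul_assoc, Units.mul_inv, mul_one] at e2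
  rw [← mul_assoc] at e2
  simpa only [mul_assoc] using e2.symm

/-- `I_α I_{-α}` as an endomorphism of `ℂ^N ⊗ ℂ^N`. -/
def iTensor (a b : ℤ) : Matrix (Fin N × Fin N) (Fin N × Fin N) ℂ :=
  (iUnit hN a b).val ⊗ₖ ((iUnit hN a b)⁻¹).val

end Scalars

/-- Exchange of the two tensor factors. -/
def swapMat {R : Type*} (X : Matrix (Fin N × Fin N) (Fin N × Fin N) R) :
    Matrix (Fin N × Fin N) (Fin N × Fin N) R := X.submatrix Prod.swap Prod.swap

/-- Transposition in the second tensor factor. -/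
def partialTranspose {R : Type*} (X : Matrix (Fin N × Fin N) (Fin N × Fin N) R) :
    Matrix (Fin N × Fin N) (Fin N × Fin N) R :=
  Matrix.of fun i j => X (i.1, j.2) (j.1, i.2)

theorem swapMat_kronecker (A B : Matrix (Fin N) (Fin N) ℂ) : swapMat (A ⊗ₖ B) = B ⊗ₖ A := by
  ext i j; simp [swapMat, mul_comm]

theorem partialTranspose_kronecker (A B : Matrix (Fin N) (Fin N) ℂ) :
    partialTranspose (A ⊗ₖ B) = A ⊗ₖ B.transpose := by
  ext i j; simp [partialTranspose]

theorem swapMat_mul {R : Type*} [NonUnitalNonAssocSemiring R]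
    (X Y : Matrix (Fin N × Fin N) (Fin N × Fin N) R) :
    swapMat (X * Y) = swapMat X * swapMat Y := by
  unfold swapMat
  rw [← Matrix.submatrix_mul_equiv X Y Prod.swap (Equiv.prodComm _ _) Prod.swap]
  rfl

theorem swapMat_sum {ι : Type*} (s : Finset ι)
    (X : ι → Matrix (Fin N × Fin N) (Fin N × Fin N) ℂ) :
    swapMat (∑ i ∈ s, X i) = ∑ i ∈ s, swapMat (X i) := by
  ext; simp [swapMat, Matrix.sum_apply]

theorem swapMat_smul (c : ℂ) (X : Matrix (Fin N × Fin N) (Fin N × Fin N) ℂ) :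
    swapMat (c • X) = c • swapMat X := rfl

theorem partialTranspose_sum {ι : Type*} (s : Finset ι)
    (X : ι → Matrix (Fin N × Fin N) (Fin N × Fin N) ℂ) :
    partialTranspose (∑ i ∈ s, X i) = ∑ i ∈ s, partialTranspose (X i) := by
  ext; simp [partialTranspose, Matrix.sum_apply]

theorem partialTranspose_smul (c : ℂ) (X : Matrix (Fin N × Fin N) (Fin N × Fin N) ℂ) :
    partialTranspose (c • X) = c • partialTranspose X := rfl

/-! ### The regularised R-matrix -/

/-- The sum over the weights, without scalar factors and without the gauge transformation. -/
def regMat (hN : N ≠ 0) (τ ζ ξ : ℂ) : Matrix (Fin N × Fin N) (Fin N × Fin N) ℂ :=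
  ∑ a : Fin N, ∑ b : Fin N, regWeight N τ (a : ℕ) (b : ℕ) ξ ζ • iTensor hN (a : ℕ) (b : ℕ)

/-- A convolution over `(ℤ/N)²`: for each index of the second factor the first sum is recentred
there. The coefficients of `P k l` become the twisted sums of weights evaluated above. -/
theorem sum_mul_sum_eq_of_shift (f f' : ℤ → ℤ → ℂ)
    (T T' : ℤ → ℤ → Matrix (Fin N × Fin N) (Fin N × Fin N) ℂ)
    (P : ℤ → ℤ → Matrix (Fin N × Fin N) (Fin N × Fin N) ℂ) (c : ℤ → ℤ → ℤ → ℤ → ℂ)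
    (hf₁ : ∀ a b, f (a + N) b • T (a + N) b = f a b • T a b)
    (hf₂ : ∀ a b, f a (b + N) • T a (b + N) = f a b • T a b)
    (hT : ∀ k l a b, T (a + k) (b + l) * T' a b = c k l a b • P k l) :
    (∑ a : Fin N, ∑ b : Fin N, f (a : ℕ) (b : ℕ) • T (a : ℕ) (b : ℕ)) *
        (∑ a : Fin N, ∑ b : Fin N, f' (a : ℕ) (b : ℕ) • T' (a : ℕ) (b : ℕ)) =
      ∑ k : Fin N, ∑ l : Fin N, (∑ a : Fin N, ∑ b : Fin N, c (k : ℕ) (l : ℕ) (a : ℕ) (b : ℕ) *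
        (f ((a : ℕ) + (k : ℕ)) ((b : ℕ) + (l : ℕ)) * f' (a : ℕ) (b : ℕ))) •
          P (k : ℕ) (l : ℕ) := by
  have h1 : ∀ a b : Fin N, (∑ a : Fin N, ∑ b : Fin N, f (a : ℕ) (b : ℕ) • T (a : ℕ) (b : ℕ)) *
      (f' (a : ℕ) (b : ℕ) • T' (a : ℕ) (b : ℕ)) =
      ∑ k : Fin N, ∑ l : Fin N, (c (k : ℕ) (l : ℕ) (a : ℕ) (b : ℕ) *
        (f ((a : ℕ) + (k : ℕ)) ((b : ℕ) + (l : ℕ)) * f' (a : ℕ) (b : ℕ))) • P (k : ℕ) (l : ℕ) := by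
    intro a b
    rw [← sum_fin_fin_add_int (fun a b => f a b • T a b) hf₁ hf₂ (a : ℕ) (b : ℕ), Finset.sum_mul]
    refine Finset.sum_congr rfl fun k _ => ?_
    rw [Finset.sum_mul]
    refine Finset.sum_congr rfl fun l _ => ?_
    rw [smul_mul_smul_comm, add_comm ((k : ℕ) : ℤ), add_comm ((l : ℕ) : ℤ), hT, smul_smul]
    congr 1; ring
  generalize (∑ a : Fin N, ∑ b : Fin N, f (a : ℕ) (b : ℕ) • T (a : ℕ) (b : ℕ)) = B at h1 ⊢
  simp only [Finset.mul_sum, h1, Finset.sum_smul]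
  rw [Finset.sum_congr rfl fun a _ => Finset.sum_comm, Finset.sum_comm]
  refine Finset.sum_congr rfl fun k _ => ?_
  rw [Finset.sum_congr rfl fun a _ => Finset.sum_comm, Finset.sum_comm]

end Matrices

section

variable {N : ℕ} (hN : N ≠ 0) {τ : ℂ} (hτ : 0 < τ.im)

theorem iTensor_add_left (a b : ℤ) : iTensor hN (a + N) b = iTensor hN a b := by
  rw [iTensor, iUnit_add_left, iTensor]

theorem iTensor_add_right (a b : ℤ) : iTensor hN a (b + N) = iTensor hN a b := by
  rw [iTensor, iUnit_add_right, iTensor]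

theorem swapMat_iTensor (a b : ℤ) :
    swapMat (iTensor hN a b) = ((iUnit hN a b)⁻¹).val ⊗ₖ (iUnit hN a b).val :=
  swapMat_kronecker _ _

theorem iTensor_zero : iTensor hN 0 0 = 1 := by
  simp [iTensor, iUnit]

include hτ

/-- The coefficient of each basis tensor `I_{(k,l)} ⊗ I_{(k,l)}⁻¹` is the sum twisted by `ω^{la -
kb}`. It vanishes off `(0, 0)`, and the diagonal identity evaluates the rest. -/
theorem regMat_mul_swapMat (ξ ζ : ℂ) : regMat hN τ ζ ξ * swapMat (regMat hN τ ζ (-ξ)) =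
    (N ^ 2 * (oddTheta τ (ζ + ξ) * oddTheta τ (ζ - ξ))) • 1 := by
  have hs : swapMat (regMat hN τ ζ (-ξ)) = ∑ a : Fin N, ∑ b : Fin N,
      regWeight N τ (a : ℕ) (b : ℕ) (-ξ) ζ • swapMat (iTensor hN (a : ℕ) (b : ℕ)) := by
    simp only [regMat, swapMat_sum, swapMat_smul]
  rw [hs, regMat, sum_mul_sum_eq_of_shift (fun a b => regWeight N τ a b ξ ζ)
    (fun a b => regWeight N τ a b (-ξ) ζ) (iTensor hN) (fun a b => swapMat (iTensor hN a b))
    (iTensor hN) (fun k l a b => ex (2 * (l * a - k * b) / N))]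
  · have h1 : ∀ k l : Fin N, (∑ a : Fin N, ∑ b : Fin N,
        ex (2 * ((((l : ℕ) : ℤ) : ℂ) * (((a : ℕ) : ℤ) : ℂ) -
          (((k : ℕ) : ℤ) : ℂ) * (((b : ℕ) : ℤ) : ℂ)) / N) *
          (regWeight N τ ((a : ℕ) + (k : ℕ)) ((b : ℕ) + (l : ℕ)) ξ ζ *
            regWeight N τ (a : ℕ) (b : ℕ) (-ξ) ζ)) • iTensor hN (k : ℕ) (l : ℕ) =
        (fun k l : ℤ => if (N : ℤ) ∣ k ∧ (N : ℤ) ∣ l then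
          (N ^ 2 * (oddTheta τ (ζ + ξ) * oddTheta τ (ζ - ξ))) • iTensor hN k l else 0)
            (k : ℕ) (l : ℕ) := by
      intro k l
      dsimp only
      split_ifs with h
      · have hk : (k : ℕ) = 0 := Nat.eq_zero_of_dvd_of_lt (Int.natCast_dvd_natCast.1 h.1) k.2
        have hl : (l : ℕ) = 0 := Nat.eq_zero_of_dvd_of_lt (Int.natCast_dvd_natCast.1 h.2) l.2
        rw [hk, hl, ← sum_regWeight_unitarity_diag hN hτ]
        simp [ex_zero]
      · have := sum_regWeight_unitarity_off hN hτ (k : ℕ) (l : ℕ) h ξ ζ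
        simp only [Int.cast_natCast] at this ⊢
        rw [this, zero_smul]
    simp only [h1]
    rw [sum_fin_fin_eq_zero_term hN (fun k l : ℤ => if (N : ℤ) ∣ k ∧ (N : ℤ) ∣ l then
          (N ^ 2 * (oddTheta τ (ζ + ξ) * oddTheta τ (ζ - ξ))) • iTensor hN k l else 0)]
    · simp [iTensor_zero]
    · intro a b h; simp only [if_neg h]
  · intro a b; simp only [regWeight_add_left hN hτ, iTensor_add_left]
  · intro a b; simp only [regWeight_add_right hN hτ, iTensor_add_right]
  · intro k l a b
    rw [swapMat_iTensor, iTensor, ← Matrix.mul_kronecker_mul, iUnit_mul_inv, iUnit_inv_mul,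
      Matrix.smul_kronecker, Matrix.kronecker_smul, smul_smul, ← ex_add, iTensor]
    congr 2; ring

/-- Transposition reverses the product in the second factor, so the two phases cancel and the sums
are untwisted; the crossing identity applies. -/
theorem partialTranspose_regMat_mul (ξ ξ' ζ : ℂ) (h : ξ + ξ' = -(N * ζ)) :
    partialTranspose (regMat hN τ ζ ξ) * partialTranspose (swapMat (regMat hN τ ζ ξ')) =
    (N ^ 2 * oddTheta τ ξ * oddTheta τ ξ') • 1 := by
  have hs : partialTranspose (swapMat (regMat hN τ ζ ξ')) = ∑ a : Fin N, ∑ b : Fin N,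
      regWeight N τ (a : ℕ) (b : ℕ) ξ' ζ •
        partialTranspose (swapMat (iTensor hN (a : ℕ) (b : ℕ))) := by
    simp only [regMat, swapMat_sum, swapMat_smul, partialTranspose_sum, partialTranspose_smul]
  have hs' : partialTranspose (regMat hN τ ζ ξ) = ∑ a : Fin N, ∑ b : Fin N,
      regWeight N τ (a : ℕ) (b : ℕ) ξ ζ • partialTranspose (iTensor hN (a : ℕ) (b : ℕ)) := by
    simp only [regMat, partialTranspose_sum, partialTranspose_smul]
  rw [hs, hs', sum_mul_sum_eq_of_shift (fun a b => regWeight N τ a b ξ ζ)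
    (fun a b => regWeight N τ a b ξ' ζ) (fun a b => partialTranspose (iTensor hN a b))
    (fun a b => partialTranspose (swapMat (iTensor hN a b)))
    (fun a b => partialTranspose (iTensor hN a b)) (fun _ _ _ _ => 1)]
  · simp only [one_mul, sum_regWeight_crossing hN hτ _ _ ξ ξ' ζ h]
    rw [sum_fin_fin_eq_zero_term hN (fun k l : ℤ => (if (N : ℤ) ∣ k ∧ (N : ℤ) ∣ l then
          (N : ℂ) ^ 2 * oddTheta τ ξ * oddTheta τ ξ' else 0) • partialTranspose (iTensor hN k l))]
    · have : partialTranspose (1 : Matrix (Fin N × Fin N) (Fin N × Fin N) ℂ) = 1 := by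
        rw [← Matrix.one_kronecker_one, partialTranspose_kronecker, Matrix.transpose_one]
      simp [iTensor_zero, this]
    · intro a b h; simp only [if_neg h, zero_smul]
  · intro a b; simp only [regWeight_add_left hN hτ, iTensor_add_left]
  · intro a b; simp only [regWeight_add_right hN hτ, iTensor_add_right]
  · intro k l a b
    rw [swapMat_iTensor, iTensor, partialTranspose_kronecker, partialTranspose_kronecker,
      ← Matrix.mul_kronecker_mul, ← Matrix.transpose_mul, iUnit_mul_inv, iUnit_mul_inv',
      Matrix.transpose_smul, Matrix.smul_kronecker, Matrix.kronecker_smul, smul_smul, ← ex_add,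
      neg_add_cancel, ex_zero, iTensor, partialTranspose_kronecker]

omit hτ in
-- The phase `ω^a` from moving `g` past `I_{(a,b)}` equals the change of `ex (2aξ/N)`.
theorem gMat_mul_regMat_add_one (ξ ζ : ℂ) :
    (gMat N ⊗ₖ (1 : Matrix (Fin N) (Fin N) ℂ)) * regMat hN τ ζ (ξ + 1) =
      -(regMat hN τ ζ ξ * (gMat N ⊗ₖ (1 : Matrix (Fin N) (Fin N) ℂ))) := by
  simp only [regMat, Finset.mul_sum, Finset.sum_mul, ← Finset.sum_neg_distrib]
  refine Finset.sum_congr rfl fun a _ => Finset.sum_congr rfl fun b _ => ?_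
  rw [Matrix.smul_mul, Matrix.mul_smul, iTensor, ← Matrix.mul_kronecker_mul,
    ← Matrix.mul_kronecker_mul, iUnit_mul_g, Matrix.smul_kronecker, mul_one, one_mul, smul_smul,
    ← neg_smul]
  congr 1
  rw [regWeight, regWeight, add_right_comm, oddTheta_add_one, mul_add, ex_add, mul_one]
  ring

/-- Moving `hg` past `I_{(a,b)}` costs `ω^{a-b}`. The `a`-part matches `ex (2aξ/N)`, the `b`-part
matches the automorphy factor of `oddTheta` at the torsion point, and the terms in `aτ` cancel. -/
theorem hMat_mul_regMat_add_tau (ξ ζ : ℂ) :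
    ((hMat N * gMat N) ⊗ₖ (1 : Matrix (Fin N) (Fin N) ℂ)) * regMat hN τ ζ (ξ + 1 + τ) =
      ex (-2 * ξ - τ - 2 * ζ / N) •
        (regMat hN τ ζ ξ * ((hMat N * gMat N) ⊗ₖ (1 : Matrix (Fin N) (Fin N) ℂ))) := by
  simp only [regMat, Finset.mul_sum, Finset.sum_mul, Finset.smul_sum]
  refine Finset.sum_congr rfl fun a _ => Finset.sum_congr rfl fun b _ => ?_
  rw [Matrix.smul_mul, Matrix.mul_smul, iTensor, ← Matrix.mul_kronecker_mul,
    ← Matrix.mul_kronecker_mul, iUnit_mul_hg, Matrix.smul_kronecker, mul_one, one_mul, smul_smul,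
    smul_smul]
  congr 1
  rw [regWeight, regWeight, show ξ + 1 + τ + torsPoint N τ (a : ℕ) (b : ℕ) ζ =
    ξ + torsPoint N τ (a : ℕ) (b : ℕ) ζ + 1 + τ by ring, oddTheta_add_tau hτ, oddTheta_add_one]
  have hN' : (N : ℂ) ≠ 0 := Nat.cast_ne_zero.2 hN
  have e : ex (2 * (((a : ℕ) : ℤ) : ℂ) / N * (ξ + 1 + τ)) *
      ex (-2 * (ξ + torsPoint N τ (a : ℕ) (b : ℕ) ζ + 1) - τ) =
      ex (-2 * ξ - τ - 2 * ζ / N) * ex (2 * (((a : ℕ) : ℤ) : ℂ) / N * ξ) *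
        ex (2 * ((((a : ℕ) : ℤ) : ℂ) - (((b : ℕ) : ℤ) : ℂ)) / N) := by
    rw [← ex_add, ← ex_add, ← ex_add, ex_eq_ex_iff]
    refine ⟨-1, ?_⟩
    simp only [torsPoint]; push_cast; field_simp; ring
  linear_combination thetaQuot N τ (a : ℕ) (b : ℕ) ζ *
    oddTheta τ (ξ + torsPoint N τ (a : ℕ) (b : ℕ) ζ) * e

omit hτ in
theorem hMat_kronecker_mul_regMat (ξ ζ : ℂ) :
    ((hMat N * gMat N) ⊗ₖ (hMat N * gMat N)) * regMat hN τ ζ ξ =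
      regMat hN τ ζ ξ * ((hMat N * gMat N) ⊗ₖ (hMat N * gMat N)) := by
  simp only [regMat, Finset.mul_sum, Finset.sum_mul]
  refine Finset.sum_congr rfl fun a _ => Finset.sum_congr rfl fun b _ => ?_
  rw [Matrix.smul_mul, Matrix.mul_smul, iTensor, ← Matrix.mul_kronecker_mul,
    ← Matrix.mul_kronecker_mul, iUnit_mul_hg, iUnit_inv_mul_hg, Matrix.smul_kronecker,
    Matrix.kronecker_smul, smul_smul, smul_smul, mul_assoc (regWeight N τ _ _ ξ ζ), ← ex_add, add_neg_cancel, ex_zero,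
    mul_one]

/-! ### The R-matrix in terms of the regularised one -/

/-- The scalar factor of `R̂` with respect to `regMat`. -/
def rScalar (N : ℕ) (τ ζ ξ : ℂ) : ℂ :=
  tauN N ζ (ζ / 2 - ξ) * (ex (ξ * (2 / N - 2)) * kappaInv N ξ ζ τ) / (N * oddTheta τ (ξ + ζ))

/-- All scalars are gathered in one factor, so that matrix identities are checked on `regMat` and
scalar identities on `rScalar` separately. -/
theorem rHat_eq (ξ ζ : ℂ) : rHat N ξ ζ τ = rScalar N τ ζ ξ •
    ((gHalf N ⊗ₖ gHalf N) * regMat hN τ ζ ξ *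
      (((gHalfUnit N)⁻¹).val ⊗ₖ ((gHalfUnit N)⁻¹).val)) := by
  have hz : zMat N ξ ζ τ = ((ex (ξ * (2 / N - 2)) * kappaInv N ξ ζ τ) / (N * oddTheta τ (ξ + ζ))) •
      regMat hN τ ζ ξ := by
    rw [zMat, div_eq_mul_inv (ex _ * _), mul_smul (ex _ * _) (N * oddTheta τ (ξ + ζ))⁻¹]
    refine congrArg _ ?_
    rw [Finset.sum_range, regMat, Finset.smul_sum]
    refine Finset.sum_congr rfl fun a _ => ?_
    rw [Finset.sum_range, Finset.smul_sum]
    refine Finset.sum_congr rfl fun b _ => ?_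
    rw [weight_eq hN hτ, smul_smul, div_eq_inv_mul, iTensor, Matrix.coe_units_inv, coe_iUnit]
  rw [rHat, rMat, hz, Matrix.mul_smul, Matrix.smul_mul, smul_smul, Matrix.coe_units_inv,
    coe_gHalfUnit]
  congr 1
  rw [rScalar]; ring

omit hτ in
theorem gHalf_kronecker_mul_inv :
    (((gHalfUnit N)⁻¹).val ⊗ₖ ((gHalfUnit N)⁻¹).val) * (gHalf N ⊗ₖ gHalf N) = 1 := by
  rw [← Matrix.mul_kronecker_mul, ← coe_gHalfUnit, Units.inv_mul, Matrix.one_kronecker_one]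

omit hτ in
theorem gHalf_kronecker_inv_mul :
    (gHalf N ⊗ₖ gHalf N) * (((gHalfUnit N)⁻¹).val ⊗ₖ ((gHalfUnit N)⁻¹).val) = 1 := by
  rw [← Matrix.mul_kronecker_mul, ← coe_gHalfUnit, Units.mul_inv, Matrix.one_kronecker_one]

/-! ### Partial transposes and the symmetries of `R̂` up to scalars -/

include hN

omit hτ hN in
theorem kronecker_one_mul_apply {R : Type*} [Semiring R] (A : Matrix (Fin N) (Fin N) R)
    (X : Matrix (Fin N × Fin N) (Fin N × Fin N) R) (i j : Fin N × Fin N) :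
    ((A ⊗ₖ (1 : Matrix (Fin N) (Fin N) R)) * X) i j = ∑ k, A i.1 k * X (k, i.2) j := by
  simp [Matrix.mul_apply, Fintype.sum_prod_type, Matrix.one_apply]

omit hτ hN in
theorem one_kronecker_mul_apply {R : Type*} [Semiring R] (A : Matrix (Fin N) (Fin N) R)
    (X : Matrix (Fin N × Fin N) (Fin N × Fin N) R) (i j : Fin N × Fin N) :
    (((1 : Matrix (Fin N) (Fin N) R) ⊗ₖ A) * X) i j = ∑ k, A i.2 k * X (i.1, k) j := by
  rw [Matrix.mul_apply, Fintype.sum_prod_type_right]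
  simp [Matrix.one_apply]

omit hτ hN in
theorem mul_kronecker_one_apply {R : Type*} [Semiring R] (A : Matrix (Fin N) (Fin N) R)
    (X : Matrix (Fin N × Fin N) (Fin N × Fin N) R) (i j : Fin N × Fin N) :
    (X * (A ⊗ₖ (1 : Matrix (Fin N) (Fin N) R))) i j = ∑ k, X i (k, j.2) * A k j.1 := by
  simp [Matrix.mul_apply, Fintype.sum_prod_type, Matrix.one_apply]

omit hτ hN in
theorem mul_one_kronecker_apply {R : Type*} [Semiring R] (A : Matrix (Fin N) (Fin N) R)
    (X : Matrix (Fin N × Fin N) (Fin N × Fin N) R) (i j : Fin N × Fin N) :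
    (X * ((1 : Matrix (Fin N) (Fin N) R) ⊗ₖ A)) i j = ∑ k, X i (j.1, k) * A k j.2 := by
  rw [Matrix.mul_apply, Fintype.sum_prod_type_right]
  simp [Matrix.one_apply]

omit hτ hN in
theorem kronecker_eq_mul (A B : Matrix (Fin N) (Fin N) ℂ) :
    A ⊗ₖ B = (A ⊗ₖ (1 : Matrix (Fin N) (Fin N) ℂ)) * ((1 : Matrix (Fin N) (Fin N) ℂ) ⊗ₖ B) := by
  rw [← Matrix.mul_kronecker_mul, mul_one, one_mul]

omit hτ hN in
theorem kronecker_eq_mul' (A B : Matrix (Fin N) (Fin N) ℂ) :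
    A ⊗ₖ B = ((1 : Matrix (Fin N) (Fin N) ℂ) ⊗ₖ B) * (A ⊗ₖ (1 : Matrix (Fin N) (Fin N) ℂ)) := by
  rw [← Matrix.mul_kronecker_mul, mul_one, one_mul]

omit hτ hN in
-- Factors acting on the transposed leg change sides; those on the first leg stay.
theorem partialTranspose_kronecker_mul_mul (A B C D : Matrix (Fin N) (Fin N) ℂ)
    (X : Matrix (Fin N × Fin N) (Fin N × Fin N) ℂ) :
    partialTranspose ((A ⊗ₖ B) * X * (C ⊗ₖ D)) =
      (A ⊗ₖ D.transpose) * partialTranspose X * (C ⊗ₖ B.transpose) := by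
  have h1 : ∀ (A : Matrix (Fin N) (Fin N) ℂ) X, partialTranspose ((A ⊗ₖ 1) * X) =
      (A ⊗ₖ 1) * partialTranspose X := by
    intro A X; ext i j
    simp [kronecker_one_mul_apply, partialTranspose]
  have h2 : ∀ (A : Matrix (Fin N) (Fin N) ℂ) X, partialTranspose (X * (A ⊗ₖ 1)) =
      partialTranspose X * (A ⊗ₖ 1) := by
    intro A X; ext i j
    simp [mul_kronecker_one_apply, partialTranspose]
  have h3 : ∀ (A : Matrix (Fin N) (Fin N) ℂ) X, partialTranspose (X * (1 ⊗ₖ A)) =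
      (1 ⊗ₖ A.transpose) * partialTranspose X := by
    intro A X; ext i j
    simp [mul_one_kronecker_apply, one_kronecker_mul_apply, partialTranspose, mul_comm]
  have h4 : ∀ (A : Matrix (Fin N) (Fin N) ℂ) X, partialTranspose ((1 ⊗ₖ A) * X) =
      partialTranspose X * (1 ⊗ₖ A.transpose) := by
    intro A X; ext i j
    simp [mul_one_kronecker_apply, one_kronecker_mul_apply, partialTranspose, mul_comm]
  rw [kronecker_eq_mul A B, kronecker_eq_mul C D, kronecker_eq_mul A D.transpose,
    kronecker_eq_mul' C B.transpose, mul_assoc (A ⊗ₖ 1), mul_assoc (A ⊗ₖ 1), h1, ← mul_assoc, h3,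
    h2, h4]
  simp only [mul_assoc]

theorem rHat_mul_swapMat (ξ ζ : ℂ) : rHat N ξ ζ τ * swapMat (rHat N (-ξ) ζ τ) =
    (rScalar N τ ζ ξ * rScalar N τ ζ (-ξ) *
      (N ^ 2 * (oddTheta τ (ζ + ξ) * oddTheta τ (ζ - ξ)))) • 1 := by
  rw [rHat_eq hN hτ, rHat_eq hN hτ, swapMat_smul, swapMat_mul, swapMat_mul, swapMat_kronecker,
    swapMat_kronecker, smul_mul_smul_comm,
    mul_smul (rScalar N τ ζ ξ * rScalar N τ ζ (-ξ)) (N ^ 2 * _)]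
  congr 1
  have h1 := gHalf_kronecker_mul_inv (N := N)
  have h2 := gHalf_kronecker_inv_mul (N := N)
  have h3 := regMat_mul_swapMat hN hτ ξ ζ
  generalize ((gHalfUnit N)⁻¹).val ⊗ₖ ((gHalfUnit N)⁻¹).val = B at *
  generalize gHalf N ⊗ₖ gHalf N = A at *
  calc A * regMat hN τ ζ ξ * B * (A * swapMat (regMat hN τ ζ (-ξ)) * B)
      = A * regMat hN τ ζ ξ * (B * A) * (swapMat (regMat hN τ ζ (-ξ)) * B) := by
        simp only [mul_assoc]
    _ = A * (regMat hN τ ζ ξ * swapMat (regMat hN τ ζ (-ξ))) * B := by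
        rw [h1, mul_one]; simp only [mul_assoc]
    _ = _ := by rw [h3, Matrix.mul_smul, mul_one, Matrix.smul_mul, h2]

theorem partialTranspose_rHat_mul (ξ ξ' ζ : ℂ) (h : ξ + ξ' = -(N * ζ)) :
    partialTranspose (rHat N ξ ζ τ) * partialTranspose (swapMat (rHat N ξ' ζ τ)) =
    (rScalar N τ ζ ξ * rScalar N τ ζ ξ' * (N ^ 2 * oddTheta τ ξ * oddTheta τ ξ')) • 1 := by
  rw [rHat_eq hN hτ, rHat_eq hN hτ, swapMat_smul, swapMat_mul, swapMat_mul, swapMat_kronecker,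
    swapMat_kronecker, partialTranspose_smul, partialTranspose_smul,
    partialTranspose_kronecker_mul_mul, partialTranspose_kronecker_mul_mul,
    smul_mul_smul_comm, mul_smul (rScalar N τ ζ ξ * rScalar N τ ζ ξ') (N ^ 2 * _ * _)]
  congr 1
  have h1 : (((gHalfUnit N)⁻¹).val ⊗ₖ (gHalf N).transpose) *
      (gHalf N ⊗ₖ (((gHalfUnit N)⁻¹).val).transpose) = 1 := by
    rw [← Matrix.mul_kronecker_mul, ← Matrix.transpose_mul, ← coe_gHalfUnit, Units.inv_mul,
      Matrix.transpose_one, Matrix.one_kronecker_one]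
  have h2 : (gHalf N ⊗ₖ (((gHalfUnit N)⁻¹).val).transpose) *
      (((gHalfUnit N)⁻¹).val ⊗ₖ (gHalf N).transpose) = 1 := by
    rw [← Matrix.mul_kronecker_mul, ← Matrix.transpose_mul, ← coe_gHalfUnit, Units.mul_inv,
      Matrix.transpose_one, Matrix.one_kronecker_one]
  have h3 := partialTranspose_regMat_mul hN hτ ξ ξ' ζ h
  generalize ((gHalfUnit N)⁻¹).val ⊗ₖ (gHalf N).transpose = B at *
  generalize gHalf N ⊗ₖ (((gHalfUnit N)⁻¹).val).transpose = A at *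
  generalize partialTranspose (regMat hN τ ζ ξ) = X at *
  generalize partialTranspose (swapMat (regMat hN τ ζ ξ')) = Y at *
  calc A * X * B * (A * Y * B) = A * X * (B * A) * (Y * B) := by simp only [mul_assoc]
    _ = A * (X * Y) * B := by rw [h1, mul_one]; simp only [mul_assoc]
    _ = _ := by rw [h3, Matrix.mul_smul, mul_one, Matrix.smul_mul, h2]

/-- The scalar factors are cross-multiplied here; they are divided out later, off the lattice, where
they do not vanish. -/
theorem gMat_mul_rHat_add_one (ξ ζ : ℂ) :
    rScalar N τ ζ ξ • ((gMat N ⊗ₖ (1 : Matrix (Fin N) (Fin N) ℂ)) * rHat N (ξ + 1) ζ τ) =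
      -rScalar N τ ζ (ξ + 1) • (rHat N ξ ζ τ * (gMat N ⊗ₖ (1 : Matrix (Fin N) (Fin N) ℂ))) := by
  rw [rHat_eq hN hτ, rHat_eq hN hτ]
  have e1 : (gMat N ⊗ₖ (1 : Matrix (Fin N) (Fin N) ℂ)) * (gHalf N ⊗ₖ gHalf N) =
      (gHalf N ⊗ₖ gHalf N) * (gMat N ⊗ₖ 1) := by
    rw [← Matrix.mul_kronecker_mul, ← Matrix.mul_kronecker_mul, ← gHalf_mul_gHalf, mul_one,
      one_mul, mul_assoc]
  have e2 : (((gHalfUnit N)⁻¹).val ⊗ₖ ((gHalfUnit N)⁻¹).val) *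
      (gMat N ⊗ₖ (1 : Matrix (Fin N) (Fin N) ℂ)) =
      (gMat N ⊗ₖ 1) * (((gHalfUnit N)⁻¹).val ⊗ₖ ((gHalfUnit N)⁻¹).val) := by
    rw [← Matrix.mul_kronecker_mul, ← Matrix.mul_kronecker_mul, ← coe_gUnit, mul_one, one_mul,
      ← Units.val_mul, ← Units.val_mul, gUnit, inv_mul_cancel_left, mul_inv_cancel_right]
  have e3 := gMat_mul_regMat_add_one hN (τ := τ) ξ ζ
  generalize ((gHalfUnit N)⁻¹).val ⊗ₖ ((gHalfUnit N)⁻¹).val = B at *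
  generalize gHalf N ⊗ₖ gHalf N = A at *
  rw [Matrix.mul_smul, Matrix.smul_mul, smul_smul, smul_smul, neg_mul, neg_smul, ← smul_neg,
    mul_comm (rScalar N τ ζ ξ)]
  congr 1
  rw [← mul_assoc, ← mul_assoc, e1, mul_assoc A, e3, mul_assoc _ B, e2]
  simp only [mul_assoc, Matrix.mul_neg, Matrix.neg_mul]

theorem ghg_mul_rHat_add_tau (ξ ζ : ℂ) :
    rScalar N τ ζ ξ • ((ghg N ⊗ₖ (1 : Matrix (Fin N) (Fin N) ℂ)) * rHat N (ξ + 1 + τ) ζ τ) =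
      (ex (-2 * ξ - τ - 2 * ζ / N) * rScalar N τ ζ (ξ + 1 + τ)) •
        (rHat N ξ ζ τ * (ghg N ⊗ₖ (1 : Matrix (Fin N) (Fin N) ℂ))) := by
  rw [rHat_eq hN hτ, rHat_eq hN hτ]
  have e1 : (ghg N ⊗ₖ (1 : Matrix (Fin N) (Fin N) ℂ)) * (gHalf N ⊗ₖ gHalf N) =
      (gHalf N ⊗ₖ gHalf N) * ((hMat N * gMat N) ⊗ₖ 1) := by
    rw [← Matrix.mul_kronecker_mul, ← Matrix.mul_kronecker_mul, ← gHalf_mul_gHalf, mul_one,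
      one_mul, ghg]
    simp only [mul_assoc]
  have e2 : (((gHalfUnit N)⁻¹).val ⊗ₖ ((gHalfUnit N)⁻¹).val) *
      (ghg N ⊗ₖ (1 : Matrix (Fin N) (Fin N) ℂ)) =
      ((hMat N * gMat N) ⊗ₖ 1) * (((gHalfUnit N)⁻¹).val ⊗ₖ ((gHalfUnit N)⁻¹).val) := by
    rw [← Matrix.mul_kronecker_mul, ← Matrix.mul_kronecker_mul, ← coe_gUnit, ← coe_ghgUnit hN,
      ← coe_hUnit hN, mul_one, one_mul, ← Units.val_mul, ← Units.val_mul, ← Units.val_mul, gUnit,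
      ghgUnit]
    congr 2; group
  have e3 := hMat_mul_regMat_add_tau hN hτ ξ ζ
  generalize ((gHalfUnit N)⁻¹).val ⊗ₖ ((gHalfUnit N)⁻¹).val = B at *
  generalize gHalf N ⊗ₖ gHalf N = A at *
  rw [Matrix.mul_smul, Matrix.smul_mul, smul_smul, smul_smul,
    show ex (-2 * ξ - τ - 2 * ζ / N) * rScalar N τ ζ (ξ + 1 + τ) * rScalar N τ ζ ξ =
      rScalar N τ ζ ξ * rScalar N τ ζ (ξ + 1 + τ) * ex (-2 * ξ - τ - 2 * ζ / N) by ring,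
    mul_smul _ (ex _)]
  congr 1
  rw [← mul_assoc, ← mul_assoc, e1, mul_assoc A, e3, mul_assoc _ B, e2, Matrix.mul_smul,
    Matrix.smul_mul]
  simp only [mul_assoc]

theorem ghg_kronecker_mul_rHat (ξ ζ : ℂ) :
    (ghg N ⊗ₖ ghg N) * rHat N ξ ζ τ = rHat N ξ ζ τ * (ghg N ⊗ₖ ghg N) := by
  rw [rHat_eq hN hτ]
  have e1 : (ghg N ⊗ₖ ghg N) * (gHalf N ⊗ₖ gHalf N) =
      (gHalf N ⊗ₖ gHalf N) * ((hMat N * gMat N) ⊗ₖ (hMat N * gMat N)) := by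
    rw [← Matrix.mul_kronecker_mul, ← Matrix.mul_kronecker_mul, ← gHalf_mul_gHalf, ghg]
    simp only [mul_assoc]
  have e2 : (((gHalfUnit N)⁻¹).val ⊗ₖ ((gHalfUnit N)⁻¹).val) * (ghg N ⊗ₖ ghg N) =
      ((hMat N * gMat N) ⊗ₖ (hMat N * gMat N)) *
        (((gHalfUnit N)⁻¹).val ⊗ₖ ((gHalfUnit N)⁻¹).val) := by
    have : ((gHalfUnit N)⁻¹).val * ghg N = hMat N * gMat N * ((gHalfUnit N)⁻¹).val := by
      rw [← coe_gUnit, ← coe_ghgUnit hN, ← coe_hUnit hN, ← Units.val_mul, ← Units.val_mul,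
        ← Units.val_mul, gUnit, ghgUnit]
      congr 1; group
    rw [← Matrix.mul_kronecker_mul, ← Matrix.mul_kronecker_mul, this]
  have e3 := hMat_kronecker_mul_regMat hN (τ := τ) ξ ζ
  generalize ((gHalfUnit N)⁻¹).val ⊗ₖ ((gHalfUnit N)⁻¹).val = B at *
  generalize gHalf N ⊗ₖ gHalf N = A at *
  rw [Matrix.mul_smul, Matrix.smul_mul]
  congr 1
  rw [← mul_assoc, ← mul_assoc, e1, mul_assoc A, e3, mul_assoc _ B, e2]
  simp only [mul_assoc]

end

/-! ### The elliptic gamma function -/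

section

variable {a b : ℂ} (ha : ‖a‖ < 1) (hb : ‖b‖ < 1)
include ha hb

theorem summable_norm_mul_pow_mul_pow (x : ℂ) :
    Summable fun n : ℕ × ℕ => ‖-(x * a ^ n.1 * b ^ n.2)‖ := by
  have h := (summable_geometric_of_lt_one (norm_nonneg a) ha).mul_of_nonneg
    (summable_geometric_of_lt_one (norm_nonneg b) hb) (fun _ => by positivity)
    (fun _ => by positivity)
  refine (h.mul_left ‖x‖).congr fun n => ?_
  rw [norm_neg, norm_mul, norm_mul, norm_pow, norm_pow, mul_assoc]

theorem multipliable_poch₂ (x : ℂ) :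
    Multipliable fun n : ℕ × ℕ => 1 - x * a ^ n.1 * b ^ n.2 := by
  simpa [sub_eq_add_neg] using
    multipliable_one_add_of_summable (summable_norm_mul_pow_mul_pow ha hb x)

theorem poch₂_ne_zero {x : ℂ} (h : ∀ m n : ℕ, x * a ^ m * b ^ n ≠ 1) : poch₂ x a b ≠ 0 := by
  have := tprod_one_add_ne_zero_of_summable (f := fun n : ℕ × ℕ => -(x * a ^ n.1 * b ^ n.2))
    (fun n => by rw [← sub_eq_add_neg]; exact sub_ne_zero.2 (h n.1 n.2).symm)
    (summable_norm_mul_pow_mul_pow ha hb x)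
  simpa [poch₂, sub_eq_add_neg] using this

theorem poch₂_eq_tprod (x : ℂ) : poch₂ x a b = ∏' m : ℕ, poch (x * a ^ m) b :=
  (multipliable_poch₂ ha hb x).tprod_prod' fun m => multipliable_poch hb (x * a ^ m)

theorem poch₂_eq_mul_left (x : ℂ) : poch₂ x a b = poch x b * poch₂ (x * a) a b := by
  have e : ∀ m : ℕ, poch (x * a ^ (m + 1)) b = poch (x * a * a ^ m) b := fun m => by
    rw [pow_succ', mul_assoc]
  have hm : Multipliable fun m : ℕ => poch (x * a * a ^ m) b :=
    ((multipliable_poch₂ ha hb (x * a)).hasProd.prod_fiberwise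
      fun m => (multipliable_poch hb (x * a * a ^ m)).hasProd).multipliable
  rw [poch₂_eq_tprod ha hb, poch₂_eq_tprod ha hb, tprod_eq_zero_mul']
  · simp only [e, pow_zero, mul_one]
  · simpa only [e] using hm

omit ha hb in
theorem poch₂_comm (x a b : ℂ) : poch₂ x a b = poch₂ x b a := by
  unfold poch₂
  rw [← (Equiv.prodComm ℕ ℕ).tprod_eq]
  refine tprod_congr fun n => ?_
  simp only [Equiv.prodComm_apply, Prod.fst_swap, Prod.snd_swap]
  ring

end

/-- The elliptic gamma function, in logarithmic variables. -/
def ellGamma (τ σ u : ℂ) : ℂ :=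
  poch₂ (ex (2 * (τ + σ - u))) (ex (2 * τ)) (ex (2 * σ)) /
    poch₂ (ex (2 * u)) (ex (2 * τ)) (ex (2 * σ))

theorem bigTheta_ex (τ ξ : ℂ) :
    bigTheta (ex (2 * τ)) (ex (2 * ξ)) = ex ξ * oddTheta τ ξ := by
  rw [oddTheta, ← mul_assoc, ← ex_add, add_neg_cancel, ex_zero, one_mul]

theorem ellGamma_comm (τ σ u : ℂ) : ellGamma τ σ u = ellGamma σ τ u := by
  rw [ellGamma, ellGamma, poch₂_comm, poch₂_comm (ex (2 * u)), add_comm τ]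

theorem ellGamma_add_one (τ σ u : ℂ) : ellGamma τ σ (u + 1) = ellGamma τ σ u := by
  rw [ellGamma, ellGamma, mul_add, ex_add, mul_one, ex_two, mul_one,
    show 2 * (τ + σ - (u + 1)) = 2 * (τ + σ - u) - 2 by ring, ex_sub, ex_two, div_one]

section

variable {τ σ : ℂ} (hτ : 0 < τ.im) (hσ : 0 < σ.im)
include hτ hσ

theorem poch₂_ex_ne_zero {u : ℂ} (hu : ∀ a b k : ℤ, u ≠ a * τ + b * σ + k) :
    poch₂ (ex (2 * u)) (ex (2 * τ)) (ex (2 * σ)) ≠ 0 := by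
  refine poch₂_ne_zero (norm_ex_two_mul_lt_one hτ) (norm_ex_two_mul_lt_one hσ) fun m n e => ?_
  rw [← ex_nat_mul, ← ex_nat_mul, ← ex_add, ← ex_add, ex_eq_one_iff] at e
  obtain ⟨k, e⟩ := e
  exact hu (-m) (-n) k (by push_cast; linear_combination e / 2)

theorem ellGamma_ne_zero {u : ℂ} (hu : ∀ a b k : ℤ, u ≠ a * τ + b * σ + k) :
    ellGamma τ σ u ≠ 0 :=
  div_ne_zero (poch₂_ex_ne_zero hτ hσ fun a b k e => hu (1 - a) (1 - b) (-k) (by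
    push_cast; linear_combination -e)) (poch₂_ex_ne_zero hτ hσ hu)

/-- One row splits off each double product, and the two rows form `Θ` up to its third factor `(p;
p)_∞`, which appears on the left. -/
theorem ellGamma_add_right {u : ℂ} (hu : ∀ a b k : ℤ, u ≠ a * τ + b * σ + k) :
    poch (ex (2 * τ)) (ex (2 * τ)) * ellGamma τ σ (u + σ) =
      ex u * oddTheta τ u * ellGamma τ σ u := by
  have hp := norm_ex_two_mul_lt_one hτ
  have hq := norm_ex_two_mul_lt_one hσ
  have e1 := poch₂_eq_mul_left hq hp (ex (2 * u))
  have e2 := poch₂_eq_mul_left hq hp (ex (2 * (τ - u)))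
  rw [← ex_add, ← mul_add, poch₂_comm, poch₂_comm _ (ex (2 * σ))] at e1 e2
  have h1 := poch₂_ex_ne_zero hτ hσ hu
  have h2 := poch₂_ex_ne_zero hτ hσ (u := u + σ) fun a b k e => hu a (b - 1) k (by
    push_cast; linear_combination e)
  rw [← bigTheta_ex, bigTheta, ← ex_neg, ← ex_add, ellGamma, ellGamma,
    show τ + σ - (u + σ) = τ - u by ring, e2, e1, show τ - u + σ = τ + σ - u by ring,
    show 2 * τ + -(2 * u) = 2 * (τ - u) by ring]
  rw [e1] at h1
  have h3 := left_ne_zero_of_mul h1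
  field_simp

theorem ellGamma_add_left {u : ℂ} (hu : ∀ a b k : ℤ, u ≠ a * τ + b * σ + k) :
    poch (ex (2 * σ)) (ex (2 * σ)) * ellGamma τ σ (u + τ) =
      ex u * oddTheta σ u * ellGamma τ σ u := by
  rw [ellGamma_comm, ellGamma_comm τ]
  exact ellGamma_add_right hσ hτ fun a b k e => hu b a k (by rw [e]; ring)

end

/-! ### The normalisation factor of the R-matrix -/

/-- `x` is not a point of `ζℤ + τℤ + ℤ`. -/
def OffLattice (ζ τ x : ℂ) : Prop := ∀ a b k : ℤ, x ≠ a * ζ + b * τ + k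

section

variable {ζ τ x : ℂ}

theorem OffLattice.neg (h : OffLattice ζ τ x) : OffLattice ζ τ (-x) := fun a b k e =>
  h (-a) (-b) (-k) (by push_cast; linear_combination -e)

theorem OffLattice.add (h : OffLattice ζ τ x) (a b k : ℤ) :
    OffLattice ζ τ (x + (a * ζ + b * τ + k)) := fun a' b' k' e =>
  h (a' - a) (b' - b) (k' - k) (by push_cast; linear_combination e)

theorem OffLattice.congr {y : ℂ} (h : OffLattice ζ τ x) (a b k : ℤ)
    (e : y = x + (a * ζ + b * τ + k)) : OffLattice ζ τ y := e ▸ h.add a b k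

/-- In this form `1/κ` obeys two kinds of difference equations: steps of `Nζ` produce theta
functions of modulus `τ`, and steps of `τ` produce those of modulus `Nζ`. -/
theorem kappaInv_eq (N : ℕ) (ξ ζ τ : ℂ) : kappaInv N ξ ζ τ =
    ellGamma τ (N * ζ) (N * ζ + ξ) * ellGamma τ (N * ζ) (ζ - ξ) /
      (ellGamma τ (N * ζ) (N * ζ - ξ) * ellGamma τ (N * ζ) (ζ + ξ)) := by
  unfold kappaInv ellGamma
  simp only [← ex_neg, ← ex_add]
  rw [show 2 * N * ζ + -(2 * ξ) = 2 * (N * ζ - ξ) by ring, show 2 * ζ + 2 * ξ = 2 * (ζ + ξ) by ring,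
    show 2 * τ + -(2 * ξ) = 2 * (τ + N * ζ - (N * ζ + ξ)) by ring,
    show 2 * τ + (2 * N * ζ + -(2 * ζ)) + 2 * ξ = 2 * (τ + N * ζ - (ζ - ξ)) by ring,
    show 2 * N * ζ + 2 * ξ = 2 * (N * ζ + ξ) by ring, show 2 * ζ + -(2 * ξ) = 2 * (ζ - ξ) by ring,
    show 2 * τ + 2 * ξ = 2 * (τ + N * ζ - (N * ζ - ξ)) by ring,
    show 2 * τ + (2 * N * ζ + -(2 * ζ)) + -(2 * ξ) = 2 * (τ + N * ζ - (ζ + ξ)) by ring,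
    show 2 * N * ζ = 2 * (N * ζ) by ring]
  simp only [div_eq_mul_inv, mul_inv, inv_inv]
  ring

theorem kappaInv_add_one (N : ℕ) (ξ ζ τ : ℂ) : kappaInv N (ξ + 1) ζ τ = kappaInv N ξ ζ τ := by
  have h : ∀ u, ellGamma τ (N * ζ) (u - 1) = ellGamma τ (N * ζ) u := fun u => by
    rw [← ellGamma_add_one, sub_add_cancel]
  rw [kappaInv_eq, kappaInv_eq, ← add_assoc, ← add_assoc, ellGamma_add_one, ellGamma_add_one,
    ← sub_sub, ← sub_sub, h, h]

variable {N : ℕ} (hN : N ≠ 0) (hζ : 0 < ζ.im) (hτ : 0 < τ.im)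

include hN hζ in
theorem natCast_mul_im_pos : 0 < ((N : ℂ) * ζ).im := by
  have : (0 : ℝ) < N := Nat.cast_pos.2 (Nat.pos_of_ne_zero hN)
  simpa using mul_pos this hζ

theorem OffLattice.ne (h : OffLattice ζ τ x) (a b k : ℤ) : x ≠ a * τ + b * (N * ζ) + k := fun e =>
  h (b * N) a k (by push_cast; linear_combination e)

theorem OffLattice.oddTheta_ne_zero (hτ : 0 < τ.im) (h : OffLattice ζ τ x) :
    oddTheta τ x ≠ 0 := fun e => by
  obtain ⟨a, b, e⟩ := (oddTheta_eq_zero_iff hτ _).1 e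
  exact h 0 b a (by push_cast; linear_combination e)

include hN hζ in
theorem OffLattice.oddTheta_mul_ne_zero (h : OffLattice ζ τ x) : oddTheta (N * ζ) x ≠ 0 :=
    fun e => by
  obtain ⟨a, b, e⟩ := (oddTheta_eq_zero_iff (natCast_mul_im_pos hN hζ) _).1 e
  exact h (b * N) 0 a (by push_cast; linear_combination e)

include hN hζ hτ

theorem kappaInv_mul_kappaInv_neg (h : OffLattice ζ τ x) :
    kappaInv N x ζ τ * kappaInv N (-x) ζ τ = 1 := by
  have hσ := natCast_mul_im_pos hN hζ
  have h1 := ellGamma_ne_zero hτ hσ (u := N * ζ + x) (h.congr N 0 0 (by push_cast; ring)).ne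
  have h2 := ellGamma_ne_zero hτ hσ (u := N * ζ - x) (h.neg.congr N 0 0 (by push_cast; ring)).ne
  have h3 := ellGamma_ne_zero hτ hσ (u := ζ + x) (h.congr 1 0 0 (by push_cast; ring)).ne
  have h4 := ellGamma_ne_zero hτ hσ (u := ζ - x) (h.neg.congr 1 0 0 (by push_cast; ring)).ne
  rw [kappaInv_eq, kappaInv_eq, ← sub_eq_add_neg, ← sub_eq_add_neg, sub_neg_eq_add, sub_neg_eq_add]
  field_simp

/-- At crossing-related arguments the gamma functions pair off with arguments differing by `Nζ`, so
four difference equations reduce the product to theta functions of modulus `τ`. -/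
theorem kappaInv_mul_kappaInv_crossing {x' : ℂ} (h : OffLattice ζ τ x) (hx : x + x' = -(N * ζ)) :
    kappaInv N x ζ τ * kappaInv N x' ζ τ * (oddTheta τ x * oddTheta τ x') =
      ex (2 * ζ - 2 * (N * ζ)) * (oddTheta τ (x + ζ) * oddTheta τ (x' + ζ)) := by
  obtain rfl : x' = -(N * ζ) - x := by linear_combination hx
  have hσ := natCast_mul_im_pos hN hζ
  have g1 := ellGamma_add_right hτ hσ (u := -x) h.neg.ne
  have g2 := ellGamma_add_right hτ hσ (u := N * ζ + x) (h.congr N 0 0 (by push_cast; ring)).ne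
  have g3 := ellGamma_add_right hτ hσ (u := ζ + x) (h.congr 1 0 0 (by push_cast; ring)).ne
  have g4 := ellGamma_add_right hτ hσ (u := ζ - N * ζ - x)
    (h.neg.congr (1 - N) 0 0 (by push_cast; ring)).ne
  have h1 := ellGamma_ne_zero hτ hσ (u := -x) h.neg.ne
  have h2 := ellGamma_ne_zero hτ hσ (u := N * ζ + x) (h.congr N 0 0 (by push_cast; ring)).ne
  have h3 := ellGamma_ne_zero hτ hσ (u := ζ + x) (h.congr 1 0 0 (by push_cast; ring)).ne
  have h4 := ellGamma_ne_zero hτ hσ (u := ζ - N * ζ - x)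
    (h.neg.congr (1 - N) 0 0 (by push_cast; ring)).ne
  have h5 := ellGamma_ne_zero hτ hσ (u := N * ζ - x) (h.neg.congr N 0 0 (by push_cast; ring)).ne
  have h6 := ellGamma_ne_zero hτ hσ (u := N * ζ + x + N * ζ)
    (h.congr (2 * N) 0 0 (by push_cast; ring)).ne
  have t1 := h.oddTheta_ne_zero hτ
  have t2 := (h.congr (y := N * ζ + x) N 0 0 (by push_cast; ring)).oddTheta_ne_zero hτ
  have hc := poch_self_ne_zero (norm_ex_two_mul_lt_one hτ)
  rw [kappaInv_eq, kappaInv_eq, show N * ζ + (-(N * ζ) - x) = -x by ring,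
    show ζ - (-(N * ζ) - x) = ζ + x + N * ζ by ring,
    show N * ζ - (-(N * ζ) - x) = N * ζ + x + N * ζ by ring,
    show ζ + (-(N * ζ) - x) = ζ - N * ζ - x by ring]
  rw [show -x + N * ζ = N * ζ - x by ring] at g1
  rw [show ζ - N * ζ - x + N * ζ = ζ - x by ring] at g4
  rw [oddTheta_neg hτ] at g1
  rw [show -(N * ζ) - x = -(N * ζ + x) by ring, oddTheta_neg hτ, add_comm x,
    show -(N * ζ + x) + ζ = ζ - N * ζ - x by ring]
  generalize poch (ex (2 * τ)) (ex (2 * τ)) = C at *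
  have e1 : ellGamma τ (N * ζ) (N * ζ - x) =
      -(ex (-x) * oddTheta τ x * ellGamma τ (N * ζ) (-x)) / C := by
    rw [eq_div_iff hc]; linear_combination g1
  have e2 := eq_div_of_mul_eq hc ((mul_comm _ _).trans g2)
  have e3 := eq_div_of_mul_eq hc ((mul_comm _ _).trans g3)
  have e4 := eq_div_of_mul_eq hc ((mul_comm _ _).trans g4)
  rw [e1, e2, e3, e4]
  have k1 := ex_ne_zero (-x)
  have k2 := ex_ne_zero (N * ζ + x)
  have k3 : ex (ζ + x) * ex (ζ - N * ζ - x) =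
      ex (2 * ζ - 2 * (N * ζ)) * (ex (-x) * ex (N * ζ + x)) := by
    simp only [← ex_add]; congr 1; ring
  clear e1 e2 e3 e4 g1 g2 g3 g4
  generalize ellGamma τ (N * ζ) (ζ - N * ζ - x) = G4 at *
  generalize oddTheta τ (ζ - N * ζ - x) = T4 at *
  generalize ex (ζ - N * ζ - x) = E4 at *
  generalize ex (2 * ζ - 2 * (N * ζ)) = E at *
  field_simp
  linear_combination oddTheta τ (ζ + x) * T4 * k3

/-- Four steps of `τ` in the gamma functions; the theta functions of modulus `Nζ` that arise are
those occurring in `uFun`. -/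
theorem kappaInv_add_tau (h : OffLattice ζ τ x) :
    kappaInv N (x + τ) ζ τ *
      (oddTheta (N * ζ) (ζ - x - τ) * oddTheta (N * ζ) (ζ + x)) =
    kappaInv N x ζ τ * (-ex (2 * τ - 2 * ζ) *
      (oddTheta (N * ζ) x * oddTheta (N * ζ) (x + τ))) := by
  have hσ := natCast_mul_im_pos hN hζ
  have g1 := ellGamma_add_left hτ hσ (u := N * ζ + x) (h.congr N 0 0 (by push_cast; ring)).ne
  have g2 := ellGamma_add_left hτ hσ (u := N * ζ - x - τ)
    (h.neg.congr N (-1) 0 (by push_cast; ring)).ne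
  have g3 := ellGamma_add_left hτ hσ (u := ζ + x) (h.congr 1 0 0 (by push_cast; ring)).ne
  have g4 := ellGamma_add_left hτ hσ (u := ζ - x - τ)
    (h.neg.congr 1 (-1) 0 (by push_cast; ring)).ne
  have h1 := ellGamma_ne_zero hτ hσ (u := N * ζ + x) (h.congr N 0 0 (by push_cast; ring)).ne
  have h2 := ellGamma_ne_zero hτ hσ (u := N * ζ - x - τ)
    (h.neg.congr N (-1) 0 (by push_cast; ring)).ne
  have h3 := ellGamma_ne_zero hτ hσ (u := ζ + x) (h.congr 1 0 0 (by push_cast; ring)).ne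
  have h4 := ellGamma_ne_zero hτ hσ (u := ζ - x - τ)
    (h.neg.congr 1 (-1) 0 (by push_cast; ring)).ne
  have t3 := (h.congr (y := ζ + x) 1 0 0 (by push_cast; ring)).oddTheta_mul_ne_zero hN hζ
  have t4 := (h.neg.congr (y := ζ - x - τ) 1 (-1) 0
    (by push_cast; ring)).oddTheta_mul_ne_zero hN hζ
  have t5 := (h.congr (y := x + τ) 0 1 0 (by push_cast; ring)).oddTheta_mul_ne_zero hN hζ
  have k4 := ex_ne_zero (-2 * x - N * ζ)
  have k5 := ex_ne_zero (2 * (x + τ) - N * ζ)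
  have hc := poch_self_ne_zero (norm_ex_two_mul_lt_one hσ)
  rw [show N * ζ - x - τ + τ = N * ζ - x by ring] at g2
  rw [show ζ - x - τ + τ = ζ - x by ring] at g4
  have s1 : oddTheta (N * ζ) (N * ζ + x) =
      -ex (-2 * x - N * ζ) * oddTheta (N * ζ) x := by
    rw [add_comm, oddTheta_add_tau hσ]
  have s2 : oddTheta (N * ζ) (N * ζ - x - τ) =
      ex (2 * (x + τ) - N * ζ) * oddTheta (N * ζ) (x + τ) := by
    rw [show N * ζ - x - τ = -(x + τ) + N * ζ by ring, oddTheta_add_tau hσ, oddTheta_neg hσ,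
      mul_neg, neg_mul, neg_neg, neg_mul, mul_neg, neg_neg]
  rw [kappaInv_eq, kappaInv_eq, ← add_assoc, ← add_assoc, ← sub_sub, ← sub_sub]
  have e1 := eq_div_of_mul_eq hc ((mul_comm _ _).trans g1)
  have e2 := eq_div_of_mul_eq hc ((mul_comm _ _).trans g2)
  have e3 := eq_div_of_mul_eq hc ((mul_comm _ _).trans g3)
  have e4 := eq_div_of_mul_eq hc ((mul_comm _ _).trans g4)
  rw [e1, e2, e3, e4]
  have k1 := ex_ne_zero (ζ + x)
  have k2 := ex_ne_zero (N * ζ - x - τ)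
  have k3 : ex (N * ζ + x) * ex (N * ζ - x - τ) * ex (-2 * x - N * ζ) *
      ex (2 * (x + τ) - N * ζ) =
      ex (2 * τ - 2 * ζ) * (ex (ζ + x) * ex (ζ - x - τ)) := by
    simp only [← ex_add]; congr 1; ring
  rw [s1] at *
  rw [s2] at *
  clear e1 e2 e3 e4 g1 g2 g3 g4 s1 s2
  generalize ellGamma τ (N * ζ) (N * ζ - x - τ) = G2 at *
  generalize ellGamma τ (N * ζ) (ζ - x - τ) = G4 at *
  generalize oddTheta (N * ζ) (ζ - x - τ) = T4 at *
  generalize ex (N * ζ - x - τ) = E2 at *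
  generalize ex (ζ - x - τ) = E4 at *
  generalize ex (2 * τ - 2 * ζ) = E at *
  generalize ex (-2 * x - N * ζ) = E5 at *
  generalize ex (2 * (x + τ) - N * ζ) = E6 at *
  generalize ellGamma τ (N * ζ) (N * ζ + x) = G1 at *
  generalize poch (ex (2 * (N * ζ))) (ex (2 * (N * ζ))) = C at *
  field_simp
  linear_combination -oddTheta (N * ζ) x * k3

end

/-! ### The structure functions -/

theorem tauN_sub (N : ℕ) (ζ ξ : ℂ) : tauN N ζ (ζ / 2 - ξ) =
    ex (2 * (ζ / 2 - ξ) / N) * (oddTheta (N * ζ) (ζ - ξ) / oddTheta (N * ζ) ξ) := by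
  rw [tauN, ← ex_add, ← ex_add, show ζ + 2 * (ζ / 2 - ξ) = 2 * (ζ - ξ) by ring,
    show ζ + -(2 * (ζ / 2 - ξ)) = 2 * ξ by ring, show 2 * N * ζ = 2 * (N * ζ) by ring,
    bigTheta_ex, bigTheta_ex, mul_div_mul_comm, ← mul_assoc, ← ex_sub, ← ex_add]
  congr 2; ring

theorem rScalar_eq (N : ℕ) (τ ζ ξ : ℂ) : rScalar N τ ζ ξ =
    ex (ζ / N - 2 * ξ) * (oddTheta (N * ζ) (ζ - ξ) / oddTheta (N * ζ) ξ) * kappaInv N ξ ζ τ /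
      (N * oddTheta τ (ξ + ζ)) := by
  rw [rScalar, tauN_sub, show ζ / N - 2 * ξ = 2 * (ζ / 2 - ξ) / N + ξ * (2 / N - 2) by ring,
    ex_add]
  ring

section

variable {N : ℕ} (hN : N ≠ 0) {ζ : ℂ} (hζ : 0 < ζ.im)
include hN hζ

theorem uFun_eq (x : ℂ) : uFun N ζ x = -(ex (2 * ζ / N) *
    (oddTheta (N * ζ) (ζ + x) * oddTheta (N * ζ) (ζ - x) / oddTheta (N * ζ) x ^ 2)) := by
  have hσ := natCast_mul_im_pos hN hζ
  simp only [uFun, qpow]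
  rw [← ex_add, ← ex_add, show 2 * ζ + 2 * x = 2 * (ζ + x) by ring,
    show 2 * ζ + -(2 * x) = 2 * (ζ - x) by ring, show 2 * N * ζ = 2 * (N * ζ) by ring,
    show -(2 * x) = 2 * -x by ring, bigTheta_ex, bigTheta_ex, bigTheta_ex, bigTheta_ex,
    oddTheta_neg hσ, ex_neg, show ζ * (2 / N - 2) = 2 * ζ / N - (ζ + x) - (ζ - x) by ring, ex_sub,
    ex_sub]
  have h1 := ex_ne_zero (ζ + x)
  have h2 := ex_ne_zero (ζ - x)
  have h3 := ex_ne_zero x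
  generalize ex (ζ + x) = a at *
  generalize ex (ζ - x) = b at *
  generalize oddTheta (N * ζ) x = t
  rcases eq_or_ne t 0 with rfl | ht
  · simp
  · field_simp

theorem uFun_neg (x : ℂ) : uFun N ζ (-x) = uFun N ζ x := by
  rw [uFun_eq hN hζ, uFun_eq hN hζ, oddTheta_neg (natCast_mul_im_pos hN hζ), sub_neg_eq_add,
    ← sub_eq_add_neg, neg_sq, mul_comm (oddTheta _ (ζ - x))]

theorem uFun_add_one (x : ℂ) : uFun N ζ (x + 1) = uFun N ζ x := by
  have : oddTheta (N * ζ) (ζ - (x + 1)) = -oddTheta (N * ζ) (ζ - x) := by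
    rw [show ζ - x = ζ - (x + 1) + 1 by ring, oddTheta_add_one, neg_neg]
  rw [uFun_eq hN hζ, uFun_eq hN hζ, this, ← add_assoc, oddTheta_add_one, oddTheta_add_one, neg_sq,
    neg_mul_neg]

/-- Numerator and denominator have the same automorphy factor. With evenness and period `1`, this
periodicity is all that `𝒴_{mn} = 1` needs. -/
theorem uFun_add_natCast_mul (x : ℂ) : uFun N ζ (x + N * ζ) = uFun N ζ x := by
  have hσ := natCast_mul_im_pos hN hζ
  have e : oddTheta (N * ζ) (ζ - (x + N * ζ)) =
      -ex (-2 * (x - ζ) - N * ζ) * oddTheta (N * ζ) (ζ - x) := by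
    rw [show ζ - (x + N * ζ) = -(x - ζ + N * ζ) by ring, oddTheta_neg hσ, oddTheta_add_tau hσ,
      ← neg_sub x ζ, oddTheta_neg hσ]
    ring
  have k : ex (-2 * (ζ + x) - N * ζ) * ex (-2 * (x - ζ) - N * ζ) = ex (-2 * x - N * ζ) ^ 2 := by
    rw [sq, ← ex_add, ← ex_add]; congr 1; ring
  rw [uFun_eq hN hζ, uFun_eq hN hζ, e, ← add_assoc, oddTheta_add_tau hσ, oddTheta_add_tau hσ,
    mul_pow, neg_sq, ← k, mul_mul_mul_comm, neg_mul_neg, mul_div_mul_left]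
  exact mul_ne_zero (ex_ne_zero _) (ex_ne_zero _)

theorem uFun_add_int (x : ℂ) (k : ℤ) : uFun N ζ (x + k) = uFun N ζ x := by
  simpa using (show Function.Periodic (uFun N ζ) 1 from uFun_add_one hN hζ).int_mul k x

theorem uFun_congr {x y : ℂ} (a k : ℤ) (h : y = x + a * (N * ζ) + k) :
    uFun N ζ y = uFun N ζ x := by
  rw [h, uFun_add_int hN hζ]
  exact (show Function.Periodic (uFun N ζ) (N * ζ) from uFun_add_natCast_mul hN hζ).int_mul a x

theorem uFun_ne_zero {τ x : ℂ} (h : OffLattice ζ τ x) : uFun N ζ x ≠ 0 := by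
  rw [uFun_eq hN hζ]
  have h1 := h.oddTheta_mul_ne_zero hN hζ
  have h2 := (h.congr (y := ζ + x) 1 0 0 (by push_cast; ring)).oddTheta_mul_ne_zero hN hζ
  have h3 := (h.neg.congr (y := ζ - x) 1 0 0 (by push_cast; ring)).oddTheta_mul_ne_zero hN hζ
  exact neg_ne_zero.2 (mul_ne_zero (ex_ne_zero _) (div_ne_zero (mul_ne_zero h2 h3) (pow_ne_zero 2 h1)))

omit hN hζ in
theorem OffLattice.add_int_mul {τ x : ℂ} (h : OffLattice ζ τ x) (a : ℤ) :
    OffLattice ζ τ (x + a * (τ + 1)) :=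
  h.congr 0 a a (by push_cast; ring)

omit hN hζ in
theorem fFun_zero (τ x : ℂ) : fFun N ζ τ 0 x = 1 := by
  rw [show (0 : ℤ) = Int.ofNat 0 from rfl, fFun]; simp

/-- A single recursion covering both branches of the definition. Being off the lattice matters for
negative `a`, where values of `uFun` are inverted. -/
theorem fFun_add_one {τ x : ℂ} (h : OffLattice ζ τ x) (a : ℤ) :
    fFun N ζ τ (a + 1) x = fFun N ζ τ a x * uFun N ζ (x + a * (τ + 1)) := by
  rcases a with a | a
  · rw [show Int.ofNat a + 1 = Int.ofNat (a + 1) from rfl, fFun, fFun, Finset.prod_range_succ]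
    simp
  · have hu := uFun_ne_zero hN hζ (h.add_int_mul (Int.negSucc a))
    have e : x + (Int.negSucc a : ℤ) * (τ + 1) = x - (a + 1) * (τ + 1) := by
      push_cast [Int.negSucc_eq]; ring
    rw [e] at hu ⊢
    rcases a with - | a
    · rw [show Int.negSucc 0 + 1 = Int.ofNat 0 from rfl, fFun, fFun]
      simp only [Nat.cast_zero, zero_add, Finset.range_one, Finset.prod_singleton,
        Finset.range_zero, Finset.prod_empty] at hu ⊢
      rw [inv_mul_cancel₀ hu]
    · rw [show Int.negSucc (a + 1) + 1 = Int.negSucc a from rfl, fFun, fFun,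
        Finset.prod_range_succ _ (a + 1), mul_assoc, inv_mul_cancel₀ hu, mul_one]

theorem fFun_ne_zero {τ x : ℂ} (h : OffLattice ζ τ x) (a : ℤ) : fFun N ζ τ a x ≠ 0 := by
  induction a with
  | zero => rw [fFun_zero]; exact one_ne_zero
  | succ n ih =>
    rw [fFun_add_one hN hζ h]
    exact mul_ne_zero ih (uFun_ne_zero hN hζ (h.add_int_mul _))
  | pred n ih =>
    have := fFun_add_one hN hζ h (-n - 1)
    rw [sub_add_cancel] at this
    exact left_ne_zero_of_mul (this ▸ ih)

/-- The left side does not change under `a ↦ a + 1`, because `uFun` is even. It converts `ℱ_a` at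
the reflected point into `ℱ_{-a}`, the form in which `𝒴_{mn}` is defined. -/
theorem fFun_neg_mul_fFun_neg {τ x : ℂ} (h : OffLattice ζ τ x) (a : ℤ) :
    fFun N ζ τ a (-x) * fFun N ζ τ (-a) x * uFun N ζ (x - a * (τ + 1)) = uFun N ζ x := by
  have step : ∀ a : ℤ, fFun N ζ τ (a + 1) (-x) * fFun N ζ τ (-(a + 1)) x *
      uFun N ζ (x - ((a + 1 : ℤ) : ℂ) * (τ + 1)) =
      fFun N ζ τ a (-x) * fFun N ζ τ (-a) x * uFun N ζ (x - a * (τ + 1)) := by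
    intro a
    have h1 := fFun_add_one hN hζ h (-(a + 1))
    have h2 := fFun_add_one hN hζ h.neg a
    rw [show -(a + 1) + 1 = -a by ring] at h1
    rw [show -x + a * (τ + 1) = -(x - a * (τ + 1)) by ring, uFun_neg hN hζ] at h2
    rw [h1, h2, show x + ((-(a + 1) : ℤ) : ℂ) * (τ + 1) = x - ((a + 1 : ℤ) : ℂ) * (τ + 1) by
      push_cast; ring]
    ring
  induction a with
  | zero => simp [fFun_zero]
  | succ n ih => rw [step, ih]
  | pred n ih => rw [← step, sub_add_cancel, ih]

end

/-! ### Properties of the R-matrix -/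

section

variable {N : ℕ} (hN : N ≠ 0) {ζ τ ξ : ℂ} (hζ : 0 < ζ.im) (hτ : 0 < τ.im)
include hN hζ hτ

theorem rScalar_ne_zero (h : OffLattice ζ τ ξ) : rScalar N τ ζ ξ ≠ 0 := by
  rw [rScalar_eq]
  have hN' : (N : ℂ) ≠ 0 := Nat.cast_ne_zero.2 hN
  have h1 := (h.congr (y := ξ + ζ) 1 0 0 (by push_cast; ring)).oddTheta_ne_zero hτ
  have h2 := (h.neg.congr (y := ζ - ξ) 1 0 0 (by push_cast; ring)).oddTheta_mul_ne_zero hN hζ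
  have h3 := h.oddTheta_mul_ne_zero hN hζ
  have h4 := left_ne_zero_of_mul_eq_one (kappaInv_mul_kappaInv_neg hN hζ hτ h)
  exact div_ne_zero (mul_ne_zero (mul_ne_zero (ex_ne_zero _) (div_ne_zero h2 h3)) h4)
    (mul_ne_zero hN' h1)

/-- The factors `1/κ` cancel, as do the theta functions of modulus `τ`; what remains of the two
`τ_N` factors is `𝒰`. -/
theorem rHat_unitarity (h : OffLattice ζ τ ξ) :
    rHat N ξ ζ τ * swapMat (rHat N (-ξ) ζ τ) = uFun N ζ ξ • 1 := by
  rw [rHat_mul_swapMat hN hτ]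
  congr 1
  have hσ := natCast_mul_im_pos hN hζ
  have hN' : (N : ℂ) ≠ 0 := Nat.cast_ne_zero.2 hN
  have h1 := (h.congr (y := ξ + ζ) 1 0 0 (by push_cast; ring)).oddTheta_ne_zero hτ
  have h2 := (h.neg.congr (y := -ξ + ζ) 1 0 0 (by push_cast; ring)).oddTheta_ne_zero hτ
  have h3 := h.oddTheta_mul_ne_zero hN hζ
  have h4 := kappaInv_mul_kappaInv_neg hN hζ hτ h
  have k : ex (ζ / N - 2 * ξ) * ex (ζ / N - 2 * -ξ) = ex (2 * ζ / N) := by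
    rw [← ex_add]; congr 1; ring
  rw [rScalar_eq, rScalar_eq, uFun_eq hN hζ, oddTheta_neg hσ, sub_neg_eq_add, ← k,
    add_comm ζ ξ, sub_eq_neg_add ζ ξ]
  generalize ex (ζ / N - 2 * ξ) = a at *
  generalize ex (ζ / N - 2 * -ξ) = b at *
  generalize oddTheta τ (-ξ + ζ) = c at *
  generalize kappaInv N ξ ζ τ = k1 at *
  generalize kappaInv N (-ξ) ζ τ = k2 at *
  generalize oddTheta (N * ζ) (-ξ + ζ) = T at *
  field_simp
  linear_combination -a * b * T * oddTheta (N * ζ) (ξ + ζ) * h4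

theorem rHat_crossing {ξ' : ℂ} (h : OffLattice ζ τ ξ) (hx : ξ + ξ' = -(N * ζ)) :
    partialTranspose (rHat N ξ ζ τ) * partialTranspose (swapMat (rHat N ξ' ζ τ)) =
      uFun N ζ ξ • 1 := by
  rw [partialTranspose_rHat_mul hN hτ _ _ _ hx]
  congr 1
  have hσ := natCast_mul_im_pos hN hζ
  have hN' : (N : ℂ) ≠ 0 := Nat.cast_ne_zero.2 hN
  have h4 := kappaInv_mul_kappaInv_crossing hN hζ hτ h hx
  have h1 := (h.congr (y := ξ + ζ) 1 0 0 (by push_cast; ring)).oddTheta_ne_zero hτ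
  have h2 := (h.neg.congr (y := ξ' + ζ) (1 - N) 0 0
    (by push_cast; linear_combination hx)).oddTheta_ne_zero hτ
  have h3 := h.oddTheta_mul_ne_zero hN hζ
  have s1 : oddTheta (N * ζ) (ζ - ξ') =
      -ex (-2 * (ξ + ζ) - N * ζ) * oddTheta (N * ζ) (ζ + ξ) := by
    rw [show ζ - ξ' = ξ + ζ + N * ζ by linear_combination -hx, oddTheta_add_tau hσ, add_comm ζ]
  have s2 : oddTheta (N * ζ) ξ' = ex (-2 * ξ - N * ζ) * oddTheta (N * ζ) ξ := by
    rw [show ξ' = -(ξ + N * ζ) by linear_combination hx, oddTheta_neg hσ, oddTheta_add_tau hσ]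
    ring
  have k : ex (ζ / N - 2 * ξ) * ex (ζ / N - 2 * ξ') * ex (-2 * (ξ + ζ) - N * ζ) *
      ex (2 * ζ - 2 * (N * ζ)) = ex (2 * ζ / N) * ex (-2 * ξ - N * ζ) := by
    simp only [← ex_add]; congr 1; linear_combination -2 * hx
  rw [rScalar_eq, rScalar_eq, uFun_eq hN hζ, s1, s2]
  have k2 := ex_ne_zero (-2 * ξ - N * ζ)
  generalize ex (-2 * ξ - N * ζ) = a at *
  generalize ex (-2 * (ξ + ζ) - N * ζ) = b at *
  generalize ex (2 * ζ - 2 * (N * ζ)) = b' at *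
  generalize ex (ζ / N - 2 * ξ) = c at *
  generalize ex (ζ / N - 2 * ξ') = d at *
  generalize ex (2 * ζ / N) = e at *
  generalize kappaInv N ξ ζ τ = k1 at *
  generalize oddTheta (N * ζ) (ζ - ξ) = T at *
  field_simp
  linear_combination -oddTheta (N * ζ) (ζ + ξ) * T * c * d * b * h4 -
    oddTheta (N * ζ) (ζ + ξ) * T * oddTheta τ (ξ + ζ) * oddTheta τ (ξ' + ζ) * k

/-- Both scalar factors change by the same sign. Since `g^N = 1`, this conjugation gives `R̂` the
period `N` in `ξ`, in general not `1`. -/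
theorem gMat_mul_rHat (h : OffLattice ζ τ ξ) :
    (gMat N ⊗ₖ (1 : Matrix (Fin N) (Fin N) ℂ)) * rHat N (ξ + 1) ζ τ =
      rHat N ξ ζ τ * (gMat N ⊗ₖ (1 : Matrix (Fin N) (Fin N) ℂ)) := by
  have e : rScalar N τ ζ (ξ + 1) = -rScalar N τ ζ ξ := by
    have : oddTheta (N * ζ) (ζ - (ξ + 1)) = -oddTheta (N * ζ) (ζ - ξ) := by
      rw [show ζ - ξ = ζ - (ξ + 1) + 1 by ring, oddTheta_add_one, neg_neg]
    rw [rScalar_eq, rScalar_eq, kappaInv_add_one, oddTheta_add_one, this, add_right_comm,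
      oddTheta_add_one, show ζ / N - 2 * (ξ + 1) = ζ / N - 2 * ξ - 2 by ring, ex_sub, ex_two]
    ring
  have := gMat_mul_rHat_add_one hN hτ ξ ζ
  rw [e, neg_neg] at this
  exact smul_right_injective _ (rScalar_ne_zero hN hζ hτ h) this

theorem rHat_add_natCast (h : OffLattice ζ τ ξ) : rHat N (ξ + N) ζ τ = rHat N ξ ζ τ := by
  have key : ∀ n : ℕ, ((gMat N ^ n) ⊗ₖ (1 : Matrix (Fin N) (Fin N) ℂ)) * rHat N (ξ + n) ζ τ =
      rHat N ξ ζ τ * ((gMat N ^ n) ⊗ₖ (1 : Matrix (Fin N) (Fin N) ℂ)) := by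
    intro n
    induction n with
    | zero => simp
    | succ n ih =>
      have e : (gMat N ^ (n + 1)) ⊗ₖ (1 : Matrix (Fin N) (Fin N) ℂ) =
          ((gMat N ^ n) ⊗ₖ 1) * (gMat N ⊗ₖ 1) := by
        rw [← Matrix.mul_kronecker_mul, pow_succ, one_mul]
      rw [e, mul_assoc, Nat.cast_succ, ← add_assoc,
        gMat_mul_rHat hN hζ hτ (h.congr 0 0 n (by push_cast; ring)), ← mul_assoc, ih, mul_assoc]
  have := key N
  rwa [gMat_pow_self hN, Matrix.one_kronecker_one, one_mul, mul_one] at this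

theorem rHat_add_int_mul (h : OffLattice ζ τ ξ) (j : ℤ) :
    rHat N (ξ + j * N) ζ τ = rHat N ξ ζ τ := by
  have step : ∀ j : ℤ, rHat N (ξ + ((j + 1 : ℤ) : ℂ) * N) ζ τ = rHat N (ξ + j * N) ζ τ := by
    intro j
    rw [← rHat_add_natCast hN hζ hτ (h.congr (y := ξ + j * N) 0 0 (j * N) (by push_cast; ring))]
    congr 1; push_cast; ring
  induction j with
  | zero => simp
  | succ n ih => rw [step, ih]
  | pred n ih => rw [← step, sub_add_cancel, ih]

/-- The step `z ↦ -p^{1/2} z`. Conjugating `hg` by `g^{1/2}` turns it into `ghg`, and the gamma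
difference equations show that the scalar is `𝒰⁻¹`. -/
theorem ghg_mul_rHat (h : OffLattice ζ τ ξ) :
    (ghg N ⊗ₖ (1 : Matrix (Fin N) (Fin N) ℂ)) * rHat N (ξ + (τ + 1)) ζ τ =
      (uFun N ζ ξ)⁻¹ • (rHat N ξ ζ τ * (ghg N ⊗ₖ (1 : Matrix (Fin N) (Fin N) ℂ))) := by
  have hσ := natCast_mul_im_pos hN hζ
  have hN' : (N : ℂ) ≠ 0 := Nat.cast_ne_zero.2 hN
  have hr := rScalar_ne_zero hN hζ hτ h
  refine smul_right_injective _ hr ?_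
  have := ghg_mul_rHat_add_tau hN hτ ξ ζ
  rw [add_comm τ, ← add_assoc]
  refine this.trans ?_
  change _ = rScalar N τ ζ ξ • ((uFun N ζ ξ)⁻¹ • _)
  rw [smul_smul]
  congr 1
  have e1 : kappaInv N (ξ + 1 + τ) ζ τ = kappaInv N (ξ + τ) ζ τ := by
    rw [add_right_comm, kappaInv_add_one]
  have e2 : oddTheta (N * ζ) (ζ - (ξ + 1 + τ)) = -oddTheta (N * ζ) (ζ - ξ - τ) := by
    rw [show ζ - ξ - τ = ζ - (ξ + 1 + τ) + 1 by ring, oddTheta_add_one, neg_neg]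
  have e3 : oddTheta (N * ζ) (ξ + 1 + τ) = -oddTheta (N * ζ) (ξ + τ) := by
    rw [add_right_comm, oddTheta_add_one]
  have e4 : oddTheta τ (ξ + 1 + τ + ζ) = ex (-2 * (ξ + ζ) - τ) * oddTheta τ (ξ + ζ) := by
    rw [show ξ + 1 + τ + ζ = ξ + ζ + τ + 1 by ring, oddTheta_add_one, oddTheta_add_tau hτ]; ring
  have hk := kappaInv_add_tau hN hζ hτ h
  have hk0 := left_ne_zero_of_mul_eq_one (kappaInv_mul_kappaInv_neg hN hζ hτ h)
  have t1 := (h.congr (y := ξ + ζ) 1 0 0 (by push_cast; ring)).oddTheta_ne_zero hτ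
  have t2 := (h.neg.congr (y := ζ - ξ) 1 0 0 (by push_cast; ring)).oddTheta_mul_ne_zero hN hζ
  have t3 := h.oddTheta_mul_ne_zero hN hζ
  have t4 := (h.congr (y := ξ + τ) 0 1 0 (by push_cast; ring)).oddTheta_mul_ne_zero hN hζ
  have t5 := (h.congr (y := ζ + ξ) 1 0 0 (by push_cast; ring)).oddTheta_mul_ne_zero hN hζ
  have t6 := (h.neg.congr (y := ζ - ξ - τ) 1 (-1) 0
    (by push_cast; ring)).oddTheta_mul_ne_zero hN hζ
  have k : ex (-2 * ξ - τ - 2 * ζ / N) * ex (ζ / N - 2 * (ξ + 1 + τ)) * ex (2 * τ - 2 * ζ) *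
      ex (2 * ζ / N) = ex (ζ / N - 2 * ξ) * ex (-2 * (ξ + ζ) - τ) := by
    simp only [← ex_add]
    rw [ex_eq_ex_iff]
    exact ⟨-1, by push_cast; ring⟩
  rw [rScalar_eq, rScalar_eq, uFun_eq hN hζ, e1, e2, e3, e4]
  have k1 := ex_ne_zero (-2 * (ξ + ζ) - τ)
  have k2 := ex_ne_zero (2 * ζ / N)
  generalize ex (-2 * (ξ + ζ) - τ) = a at *
  generalize ex (2 * ζ / N) = b at *
  generalize ex (ζ / N - 2 * ξ) = c at *
  generalize ex (-2 * ξ - τ - 2 * ζ / N) = d at *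
  generalize ex (ζ / N - 2 * (ξ + 1 + τ)) = e at *
  generalize ex (2 * τ - 2 * ζ) = f at *
  generalize oddTheta (N * ζ) (ζ - ξ) = T at *
  generalize oddTheta (N * ζ) (ζ - ξ - τ) = T' at *
  generalize kappaInv N ξ ζ τ = K at *
  generalize kappaInv N (ξ + τ) ζ τ = K' at *
  have hK' : K' = K * (-f * (oddTheta (N * ζ) ξ * oddTheta (N * ζ) (ξ + τ))) /
      (T' * oddTheta (N * ζ) (ζ + ξ)) := by
    rw [eq_div_iff (mul_ne_zero t6 t5)]; exact hk
  rw [hK']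
  field_simp
  linear_combination -k

end

section

variable {N : ℕ} (hN : N ≠ 0) {ζ τ ξ : ℂ}

/-- Iterating the one-step relation multiplies the values of `𝒰` along the orbit, which is how `ℱ_n`
is defined. -/
theorem ghg_zpow_mul_rHat (hζ : 0 < ζ.im) (hτ : 0 < τ.im) (h : OffLattice ζ τ ξ) (n : ℤ) :
    ((ghgUnit hN ^ n).val ⊗ₖ (1 : Matrix (Fin N) (Fin N) ℂ)) * rHat N (ξ + n * (τ + 1)) ζ τ =
      (fFun N ζ τ n ξ)⁻¹ •
        (rHat N ξ ζ τ * ((ghgUnit hN ^ n).val ⊗ₖ (1 : Matrix (Fin N) (Fin N) ℂ))) := by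
  have hmul : ∀ A B : (Matrix (Fin N) (Fin N) ℂ)ˣ,
      (A * B).val ⊗ₖ (1 : Matrix (Fin N) (Fin N) ℂ) = (A.val ⊗ₖ 1) * (B.val ⊗ₖ 1) := by
    intro A B
    rw [← Matrix.mul_kronecker_mul, one_mul, Units.val_mul]
  have e : ∀ n : ℤ, ((ghgUnit hN ^ (n + 1)).val ⊗ₖ (1 : Matrix (Fin N) (Fin N) ℂ)) *
      rHat N (ξ + ((n + 1 : ℤ) : ℂ) * (τ + 1)) ζ τ =
      (uFun N ζ (ξ + n * (τ + 1)))⁻¹ • ((((ghgUnit hN ^ n).val ⊗ₖ 1) *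
        rHat N (ξ + n * (τ + 1)) ζ τ) * ((ghgUnit hN).val ⊗ₖ 1)) := by
    intro n
    rw [zpow_add_one, hmul, mul_assoc, coe_ghgUnit, show ξ + ((n + 1 : ℤ) : ℂ) * (τ + 1) =
      ξ + n * (τ + 1) + (τ + 1) by push_cast; ring,
      ghg_mul_rHat hN hζ hτ (h.add_int_mul n), Matrix.mul_smul, mul_assoc]
  induction n with
  | zero => simp [fFun_zero]
  | succ n ih =>
    rw [e, ih, fFun_add_one hN hζ h, zpow_add_one, hmul, Matrix.smul_mul, smul_smul, mul_inv,
      mul_assoc, mul_comm (uFun _ _ _)⁻¹]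
  | pred n ih =>
    have hu := uFun_ne_zero hN hζ (h.add_int_mul (-n - 1))
    have h1 := e (-n - 1)
    have hf := fFun_add_one hN hζ h (-n - 1)
    have hz : ghgUnit hN ^ (-(n : ℤ)) = ghgUnit hN ^ (-(n : ℤ) - 1) * ghgUnit hN := by
      rw [← zpow_add_one, sub_add_cancel]
    rw [sub_add_cancel] at h1 hf
    rw [ih, hf, hz, hmul, mul_inv, mul_comm, mul_smul, ← mul_assoc, ← Matrix.smul_mul] at h1
    have h2 := smul_right_injective _ (inv_ne_zero hu) h1
    have h3 := congrArg (· * ((ghgUnit hN)⁻¹.val ⊗ₖ (1 : Matrix (Fin N) (Fin N) ℂ))) h2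
    simp only [mul_assoc, ← hmul, mul_inv_cancel] at h3
    simpa [← mul_assoc] using h3.symm

theorem ghg_zpow_kronecker_mul_rHat (hτ : 0 < τ.im) (n : ℤ) :
    ((ghgUnit hN ^ n).val ⊗ₖ (ghgUnit hN ^ n).val) * rHat N ξ ζ τ =
      rHat N ξ ζ τ * ((ghgUnit hN ^ n).val ⊗ₖ (ghgUnit hN ^ n).val) := by
  have hc : Commute (ghg N ⊗ₖ ghg N) (rHat N ξ ζ τ) := ghg_kronecker_mul_rHat hN hτ ξ ζ
  let u : (Matrix (Fin N × Fin N) (Fin N × Fin N) ℂ)ˣ :=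
    ⟨(ghgUnit hN).val ⊗ₖ (ghgUnit hN).val, (ghgUnit hN)⁻¹.val ⊗ₖ (ghgUnit hN)⁻¹.val, by
      rw [← Matrix.mul_kronecker_mul, Units.mul_inv, Matrix.one_kronecker_one], by
      rw [← Matrix.mul_kronecker_mul, Units.inv_mul, Matrix.one_kronecker_one]⟩
  have hu : ∀ n : ℤ, (u ^ n).val = (ghgUnit hN ^ n).val ⊗ₖ (ghgUnit hN ^ n).val := by
    intro n
    induction n with
    | zero => simp
    | succ n ih => rw [zpow_add_one, zpow_add_one, Units.val_mul, Units.val_mul, ih,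
        Matrix.mul_kronecker_mul]
    | pred n ih => rw [zpow_sub_one, zpow_sub_one, Units.val_mul, Units.val_mul, ih,
        Matrix.mul_kronecker_mul]; rfl
  rw [← hu]
  exact (show Commute u.val _ from hc).units_zpow_left n

end

/-! ### Matrices over a complex algebra -/

section

variable {N : ℕ} {A : Type*} [Ring A]

theorem kronecker_one_mul_kronecker_one (B C : Matrix (Fin N) (Fin N) A) :
    (B ⊗ₖ (1 : Matrix (Fin N) (Fin N) A)) * (C ⊗ₖ (1 : Matrix (Fin N) (Fin N) A)) =
      (B * C) ⊗ₖ (1 : Matrix (Fin N) (Fin N) A) := by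
  ext i j
  rw [kronecker_one_mul_apply]
  simp [Matrix.mul_apply, Matrix.one_apply]

theorem one_kronecker_mul_one_kronecker (B C : Matrix (Fin N) (Fin N) A) :
    ((1 : Matrix (Fin N) (Fin N) A) ⊗ₖ B) * ((1 : Matrix (Fin N) (Fin N) A) ⊗ₖ C) =
      (1 : Matrix (Fin N) (Fin N) A) ⊗ₖ (B * C) := by
  ext i j
  rw [one_kronecker_mul_apply]
  simp [Matrix.mul_apply, Matrix.one_apply]

theorem trace_swapMat (X : Matrix (Fin N × Fin N) (Fin N × Fin N) A) :
    Matrix.trace (swapMat X) = Matrix.trace X :=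
  (Equiv.prodComm (Fin N) (Fin N)).sum_comp fun i => X i i

theorem swapMat_kronecker_one (B : Matrix (Fin N) (Fin N) A) :
    swapMat (B ⊗ₖ (1 : Matrix (Fin N) (Fin N) A)) = (1 : Matrix (Fin N) (Fin N) A) ⊗ₖ B := by
  ext i j; simp [swapMat, Matrix.one_apply]

theorem swapMat_one_kronecker (B : Matrix (Fin N) (Fin N) A) :
    swapMat ((1 : Matrix (Fin N) (Fin N) A) ⊗ₖ B) = B ⊗ₖ (1 : Matrix (Fin N) (Fin N) A) := by
  ext i j; simp [swapMat, Matrix.one_apply]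

omit [Ring A] in
theorem swapMat_swapMat (X : Matrix (Fin N × Fin N) (Fin N × Fin N) A) :
    swapMat (swapMat X) = X := rfl

variable [Algebra ℂ A]

/-- A matrix of numbers as a matrix over a complex algebra. -/
def ofNum {n : Type*} (X : Matrix n n ℂ) : Matrix n n A := X.map (algebraMap ℂ A)

theorem ofNum_apply {n : Type*} (X : Matrix n n ℂ) (i j : n) :
    (ofNum X : Matrix n n A) i j = algebraMap ℂ A (X i j) := rfl

theorem ofNum_mul {n : Type*} [Fintype n] (X Y : Matrix n n ℂ) :
    (ofNum (X * Y) : Matrix n n A) = ofNum X * ofNum Y := Matrix.map_mul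

theorem ofNum_one {n : Type*} [DecidableEq n] : (ofNum 1 : Matrix n n A) = 1 :=
  Matrix.map_one _ (map_zero _) (map_one _)

theorem ofNum_smul {n : Type*} (a : ℂ) (X : Matrix n n ℂ) :
    (ofNum (a • X) : Matrix n n A) = a • ofNum X := by
  ext i j; simp [ofNum, Algebra.smul_def]

theorem swapMat_ofNum (X : Matrix (Fin N × Fin N) (Fin N × Fin N) ℂ) :
    swapMat (ofNum X : Matrix _ _ A) = ofNum (swapMat X) := rfl

/-- Cyclicity of the trace fails over a noncommutative ring, but numerical matrices may still be
moved around. -/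
theorem trace_ofNum_mul {n : Type*} [Fintype n] (X : Matrix n n ℂ) (Z : Matrix n n A) :
    Matrix.trace (ofNum X * Z) = Matrix.trace (Z * ofNum X) := by
  simp only [Matrix.trace, Matrix.diag, Matrix.mul_apply, ofNum_apply]
  rw [Finset.sum_comm]
  exact Finset.sum_congr rfl fun i _ => Finset.sum_congr rfl fun j _ => Algebra.commutes _ _

theorem ofNum_kronecker_one (P : Matrix (Fin N) (Fin N) ℂ) :
    (ofNum (P ⊗ₖ (1 : Matrix (Fin N) (Fin N) ℂ)) : Matrix _ _ A) =
      ofNum P ⊗ₖ (1 : Matrix (Fin N) (Fin N) A) := by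
  ext i j
  by_cases h : i.2 = j.2 <;> simp [ofNum, Matrix.one_apply, h]

theorem ofNum_one_kronecker (P : Matrix (Fin N) (Fin N) ℂ) :
    (ofNum ((1 : Matrix (Fin N) (Fin N) ℂ) ⊗ₖ P) : Matrix _ _ A) =
      (1 : Matrix (Fin N) (Fin N) A) ⊗ₖ ofNum P := by
  ext i j
  by_cases h : i.1 = j.1 <;> simp [ofNum, Matrix.one_apply, h]

theorem ofNum_kronecker_one_mul (P : Matrix (Fin N) (Fin N) ℂ) (K : Matrix (Fin N) (Fin N) A) :
    ofNum (P ⊗ₖ (1 : Matrix (Fin N) (Fin N) ℂ)) * ((1 : Matrix (Fin N) (Fin N) A) ⊗ₖ K) =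
      ((1 : Matrix (Fin N) (Fin N) A) ⊗ₖ K) * ofNum (P ⊗ₖ (1 : Matrix (Fin N) (Fin N) ℂ)) := by
  rw [ofNum_kronecker_one]
  ext i j
  rw [kronecker_one_mul_apply, mul_kronecker_one_apply]
  simp [Matrix.one_apply, ofNum_apply, Algebra.commutes]

theorem ofNum_one_kronecker_mul (P : Matrix (Fin N) (Fin N) ℂ) (K : Matrix (Fin N) (Fin N) A) :
    ofNum ((1 : Matrix (Fin N) (Fin N) ℂ) ⊗ₖ P) * (K ⊗ₖ (1 : Matrix (Fin N) (Fin N) A)) =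
      (K ⊗ₖ (1 : Matrix (Fin N) (Fin N) A)) * ofNum ((1 : Matrix (Fin N) (Fin N) ℂ) ⊗ₖ P) := by
  rw [ofNum_one_kronecker]
  ext i j
  rw [one_kronecker_mul_apply, mul_one_kronecker_apply]
  simp [Matrix.one_apply, ofNum_apply, Algebra.commutes]

/-! ### Products of traces -/

/-- A contraction of indices: read with partial transposes, `X` and `Y` produce the two copies of
`M`. Entries of `B` stay to the left of those of `C`, so no commutation in `A` is used. -/
theorem trace_mul_trace_of_partialTranspose {X Y : Matrix (Fin N × Fin N) (Fin N × Fin N) ℂ}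
    {M : Matrix (Fin N) (Fin N) ℂ}
    (h : partialTranspose X * partialTranspose Y = M ⊗ₖ M.transpose)
    (B C : Matrix (Fin N) (Fin N) A) :
    Matrix.trace (ofNum M * B) * Matrix.trace (ofNum M * C) =
      Matrix.trace (ofNum Y * (B ⊗ₖ (1 : Matrix (Fin N) (Fin N) A)) * ofNum X *
        ((1 : Matrix (Fin N) (Fin N) A) ⊗ₖ C)) := by
  have e : ∀ r i o l : Fin N, ∑ s, ∑ t, X (r, t) (s, l) * Y (s, o) (i, t) = M r i * M o l := by
    intro r i o l
    have := congrFun (congrFun h (r, l)) (i, o)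
    simpa [Matrix.mul_apply, Fintype.sum_prod_type, partialTranspose] using this
  have e1 : ∀ B : Matrix (Fin N) (Fin N) A,
      Matrix.trace (ofNum M * B) = ∑ r, ∑ i, M r i • B i r := by
    intro B
    simp [Matrix.trace, Matrix.mul_apply, ofNum_apply, Algebra.smul_def]
  have e2 : Matrix.trace (ofNum M * B) * Matrix.trace (ofNum M * C) =
      ∑ o, ∑ l, ∑ r, ∑ i, (∑ s, ∑ t, X (r, t) (s, l) * Y (s, o) (i, t)) • (B i r * C l o) := by
    simp only [e]
    rw [e1, e1]
    simp only [Finset.mul_sum, Finset.sum_mul, smul_mul_smul_comm]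
  have e3 : Matrix.trace (ofNum Y * (B ⊗ₖ (1 : Matrix (Fin N) (Fin N) A)) * ofNum X *
        ((1 : Matrix (Fin N) (Fin N) A) ⊗ₖ C)) = ∑ s, ∑ o, ∑ l, ∑ r, ∑ t, ∑ i,
          (X (r, t) (s, l) * Y (s, o) (i, t)) • (B i r * C l o) := by
    rw [Matrix.trace, Fintype.sum_prod_type]
    refine Finset.sum_congr rfl fun s _ => Finset.sum_congr rfl fun o _ => ?_
    rw [Matrix.diag, mul_one_kronecker_apply]
    refine Finset.sum_congr rfl fun l _ => ?_
    rw [Matrix.mul_apply, Fintype.sum_prod_type, Finset.sum_mul]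
    refine Finset.sum_congr rfl fun r _ => ?_
    rw [Finset.sum_mul]
    refine Finset.sum_congr rfl fun t _ => ?_
    rw [mul_kronecker_one_apply, Finset.sum_mul, Finset.sum_mul]
    refine Finset.sum_congr rfl fun i _ => ?_
    rw [ofNum_apply, ofNum_apply, ← Algebra.smul_def, ← Algebra.commutes, ← Algebra.smul_def,
      smul_smul, smul_mul_assoc]
  rw [e2, e3]
  symm
  rw [Finset.sum_comm]
  refine Finset.sum_congr rfl fun o _ => ?_
  rw [Finset.sum_comm]
  refine Finset.sum_congr rfl fun l _ => ?_
  rw [Finset.sum_comm]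
  refine Finset.sum_congr rfl fun r _ => ?_
  simp only [Finset.sum_smul]
  symm
  rw [Finset.sum_comm]
  exact Finset.sum_congr rfl fun s _ => Finset.sum_comm

/-- The glued matrix `X` stands exactly between the inverse from the first trace and the `L` of the
second, where the exchange relation can move them past one another. -/
theorem trace_mul_trace_eq {X Xs Y : Matrix (Fin N × Fin N) (Fin N × Fin N) ℂ}
    {M P : Matrix (Fin N) (Fin N) ℂ} {L' Li K' Ki : Matrix (Fin N) (Fin N) A}
    (h : partialTranspose X * partialTranspose Y = M ⊗ₖ M.transpose)
    (hX : (Li ⊗ₖ (1 : Matrix (Fin N) (Fin N) A)) * ofNum X *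
        ((1 : Matrix (Fin N) (Fin N) A) ⊗ₖ K') =
      ((1 : Matrix (Fin N) (Fin N) A) ⊗ₖ K') * ofNum Xs *
        (Li ⊗ₖ (1 : Matrix (Fin N) (Fin N) A))) :
    Matrix.trace (ofNum M * L' * ofNum P * Li) * Matrix.trace (ofNum M * K' * ofNum P * Ki) =
      Matrix.trace (ofNum Y * ((L' ⊗ₖ (1 : Matrix (Fin N) (Fin N) A)) *
        ((1 : Matrix (Fin N) (Fin N) A) ⊗ₖ K')) *
        ofNum ((P ⊗ₖ (1 : Matrix (Fin N) (Fin N) ℂ)) * Xs *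
          ((1 : Matrix (Fin N) (Fin N) ℂ) ⊗ₖ P)) *
        ((Li ⊗ₖ (1 : Matrix (Fin N) (Fin N) A)) * ((1 : Matrix (Fin N) (Fin N) A) ⊗ₖ Ki))) := by
  have h1 := trace_mul_trace_of_partialTranspose h (L' * ofNum P * Li) (K' * ofNum P * Ki)
  simp only [← mul_assoc] at h1
  rw [h1]
  simp only [← kronecker_one_mul_kronecker_one, ← one_kronecker_mul_one_kronecker, ofNum_mul,
    ← ofNum_kronecker_one, ← ofNum_one_kronecker]
  congr 1
  have c1 := ofNum_kronecker_one_mul P K'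
  have c2 := ofNum_one_kronecker_mul P Li
  generalize Li ⊗ₖ (1 : Matrix (Fin N) (Fin N) A) = Li1 at *
  generalize (1 : Matrix (Fin N) (Fin N) A) ⊗ₖ K' = K2 at *
  generalize (1 : Matrix (Fin N) (Fin N) A) ⊗ₖ Ki = Ki2 at *
  generalize L' ⊗ₖ (1 : Matrix (Fin N) (Fin N) A) = L1 at *
  generalize (ofNum (P ⊗ₖ (1 : Matrix (Fin N) (Fin N) ℂ)) : Matrix _ _ A) = P1 at *
  generalize (ofNum ((1 : Matrix (Fin N) (Fin N) ℂ) ⊗ₖ P) : Matrix _ _ A) = P2 at *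
  generalize (ofNum X : Matrix _ _ A) = X at *
  generalize (ofNum Xs : Matrix _ _ A) = Xs at *
  generalize (ofNum Y : Matrix _ _ A) = Y at *
  calc Y * (L1 * P1 * Li1) * X * (K2 * P2 * Ki2) = Y * L1 * P1 * (Li1 * X * K2) * P2 * Ki2 := by
        simp only [mul_assoc]
    _ = Y * L1 * (P1 * K2) * Xs * (Li1 * P2) * Ki2 := by rw [hX]; simp only [mul_assoc]
    _ = _ := by rw [c1, ← c2]; simp only [mul_assoc]

end

/-! ### Exchange relations -/

section

variable {N : ℕ} {A : Type*} [Ring A] [Algebra ℂ A]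
  {R Rs : Matrix (Fin N × Fin N) (Fin N × Fin N) ℂ} {L Li K Ki : Matrix (Fin N) (Fin N) A}

/-- The exchange relation of `K` and `L` in the form `L₁⁻¹ R₂₁ K₂ = K₂ R*₂₁ L₁⁻¹`. -/
theorem inv_mul_mul_of_rll (h : rllLeft R K L = rllRight Rs K L) (h1 : L * Li = 1)
    (h2 : Li * L = 1) :
    (Li ⊗ₖ (1 : Matrix (Fin N) (Fin N) A)) * ofNum (swapMat R) *
        ((1 : Matrix (Fin N) (Fin N) A) ⊗ₖ K) =
      ((1 : Matrix (Fin N) (Fin N) A) ⊗ₖ K) * ofNum (swapMat Rs) *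
        (Li ⊗ₖ (1 : Matrix (Fin N) (Fin N) A)) := by
  have h3 := congrArg swapMat h
  simp only [rllLeft, rllRight, swapMat_mul, swapMat_kronecker_one, swapMat_one_kronecker] at h3
  change ofNum (swapMat R) * _ * _ = _ * _ * ofNum (swapMat Rs) at h3
  have e1 : (L ⊗ₖ (1 : Matrix (Fin N) (Fin N) A)) * (Li ⊗ₖ (1 : Matrix (Fin N) (Fin N) A)) = 1 := by
    rw [kronecker_one_mul_kronecker_one, h1, Matrix.one_kronecker_one]
  have e2 : (Li ⊗ₖ (1 : Matrix (Fin N) (Fin N) A)) * (L ⊗ₖ (1 : Matrix (Fin N) (Fin N) A)) = 1 := by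
    rw [kronecker_one_mul_kronecker_one, h2, Matrix.one_kronecker_one]
  generalize Li ⊗ₖ (1 : Matrix (Fin N) (Fin N) A) = Li1 at *
  generalize L ⊗ₖ (1 : Matrix (Fin N) (Fin N) A) = L1 at *
  generalize (1 : Matrix (Fin N) (Fin N) A) ⊗ₖ K = K2 at *
  calc Li1 * ofNum (swapMat R) * K2 = Li1 * (ofNum (swapMat R) * K2 * L1) * Li1 := by
        rw [mul_assoc Li1 _ Li1, mul_assoc _ L1 Li1, e1, mul_one, mul_assoc]
    _ = _ := by rw [h3, ← mul_assoc, ← mul_assoc, e2, one_mul]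

/-- The exchange relation of the inverse matrices. -/
theorem inv_mul_inv_mul_of_rll (h : rllLeft R L K = rllRight Rs L K) (hL : L * Li = 1)
    (hL' : Li * L = 1) (hK : K * Ki = 1) (hK' : Ki * K = 1) :
    (Li ⊗ₖ (1 : Matrix (Fin N) (Fin N) A)) * ((1 : Matrix (Fin N) (Fin N) A) ⊗ₖ Ki) * ofNum R =
      ofNum Rs * (((1 : Matrix (Fin N) (Fin N) A) ⊗ₖ Ki) *
        (Li ⊗ₖ (1 : Matrix (Fin N) (Fin N) A))) := by
  change ofNum R * _ * _ = _ * _ * ofNum Rs at h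
  have e1 : (L ⊗ₖ (1 : Matrix (Fin N) (Fin N) A)) * (Li ⊗ₖ (1 : Matrix (Fin N) (Fin N) A)) = 1 := by
    rw [kronecker_one_mul_kronecker_one, hL, Matrix.one_kronecker_one]
  have e2 : (Li ⊗ₖ (1 : Matrix (Fin N) (Fin N) A)) * (L ⊗ₖ (1 : Matrix (Fin N) (Fin N) A)) = 1 := by
    rw [kronecker_one_mul_kronecker_one, hL', Matrix.one_kronecker_one]
  have e3 : ((1 : Matrix (Fin N) (Fin N) A) ⊗ₖ K) * ((1 : Matrix (Fin N) (Fin N) A) ⊗ₖ Ki) = 1 := by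
    rw [one_kronecker_mul_one_kronecker, hK, Matrix.one_kronecker_one]
  have e4 : ((1 : Matrix (Fin N) (Fin N) A) ⊗ₖ Ki) * ((1 : Matrix (Fin N) (Fin N) A) ⊗ₖ K) = 1 := by
    rw [one_kronecker_mul_one_kronecker, hK', Matrix.one_kronecker_one]
  generalize Li ⊗ₖ (1 : Matrix (Fin N) (Fin N) A) = Li1 at *
  generalize L ⊗ₖ (1 : Matrix (Fin N) (Fin N) A) = L1 at *
  generalize (1 : Matrix (Fin N) (Fin N) A) ⊗ₖ K = K2 at *
  generalize (1 : Matrix (Fin N) (Fin N) A) ⊗ₖ Ki = Ki2 at *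
  calc Li1 * Ki2 * ofNum R = Li1 * Ki2 * (ofNum R * L1 * K2) * (Ki2 * Li1) := by
        rw [mul_assoc (Li1 * Ki2) _ (Ki2 * Li1), mul_assoc (ofNum R * L1), ← mul_assoc K2, e3,
          one_mul, mul_assoc (ofNum R), e1, mul_one]
    _ = Li1 * (Ki2 * K2) * L1 * ofNum Rs * (Ki2 * Li1) := by rw [h]; simp only [mul_assoc]
    _ = _ := by rw [e4, mul_one, e2, one_mul]

end

/-! ### Commutation of the generators -/

theorem Generic.neg {ζ τ c x : ℂ} (h : Generic ζ τ c x) : Generic ζ τ c (-x) := fun a b d k e =>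
  h (-a) (-b) (-d) (-k) (by push_cast; linear_combination -e)

theorem Generic.add_shift {ζ τ c x : ℂ} (h : Generic ζ τ c x) (n : ℤ) :
    Generic ζ τ c (x + shift ζ τ c n) := fun a b d k e =>
  h a b (d - n) (k - n) (by rw [shift] at e; push_cast; linear_combination e)

theorem Generic.offLattice {ζ τ c x : ℂ} (h : Generic ζ τ c x) : OffLattice ζ τ x :=
  fun a b k e => h a b 0 k (by rw [e]; push_cast; ring)

theorem Generic.offLattice_tauStar {ζ τ c x : ℂ} (h : Generic ζ τ c x) :
    OffLattice ζ (tauStar ζ τ c) x :=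
  fun a b k e => h a 0 b k (by rw [e]; push_cast; ring)

theorem mul_eq_smul_one_comm {n : Type*} [Fintype n] [DecidableEq n] {X Y : Matrix n n ℂ} {a : ℂ}
    (ha : a ≠ 0) (h : X * Y = a • 1) : Y * X = a • 1 := by
  have h1 : (a⁻¹ • X) * Y = 1 := by
    rw [Matrix.smul_mul, h, smul_smul, inv_mul_cancel₀ ha, one_smul]
  have h2 := mul_eq_one_comm.1 h1
  rw [Matrix.mul_smul] at h2
  rw [← h2, smul_smul, mul_inv_cancel₀ ha, one_smul]

/-- The matrices `L(z)` and `L(z)⁻¹` are mutually inverse and satisfy the exchange relations. -/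
structure ExchangeRelations (N : ℕ) (ζ τ c : ℂ) (D : Set ℂ) {A : Type*} [Ring A] [Algebra ℂ A]
    (L Linv : ℂ → Matrix (Fin N) (Fin N) A) : Prop where
  mul_inv : ∀ ξ ∈ D, L ξ * Linv ξ = 1
  inv_mul : ∀ ξ ∈ D, Linv ξ * L ξ = 1
  rll : ∀ ξ ∈ D, ∀ η ∈ D, Generic ζ τ c (ξ - η) →
    rllLeft (rHat N (ξ - η) ζ τ) (L ξ) (L η) =
      rllRight (rHat N (ξ - η) ζ (tauStar ζ τ c)) (L ξ) (L η)

section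

variable {N : ℕ} (hN : N ≠ 0) {ζ : ℂ} (hζ : 0 < ζ.im)

theorem units_kronecker_one_mul (u v : (Matrix (Fin N) (Fin N) ℂ)ˣ) :
    (u.val ⊗ₖ (1 : Matrix (Fin N) (Fin N) ℂ)) * (v.val ⊗ₖ (1 : Matrix (Fin N) (Fin N) ℂ)) =
      (u * v).val ⊗ₖ (1 : Matrix (Fin N) (Fin N) ℂ) := by
  rw [← Matrix.mul_kronecker_mul, one_mul, Units.val_mul]

theorem units_one_kronecker_mul (u v : (Matrix (Fin N) (Fin N) ℂ)ˣ) :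
    ((1 : Matrix (Fin N) (Fin N) ℂ) ⊗ₖ u.val) * ((1 : Matrix (Fin N) (Fin N) ℂ) ⊗ₖ v.val) =
      (1 : Matrix (Fin N) (Fin N) ℂ) ⊗ₖ (u * v).val := by
  rw [← Matrix.mul_kronecker_mul, one_mul, Units.val_mul]

include hζ in
theorem rHat_add_int_mul_tau {τ x : ℂ} (hτ : 0 < τ.im) (h : OffLattice ζ τ x) (n : ℤ) :
    rHat N (x + n * (τ + 1)) ζ τ = (fFun N ζ τ n x)⁻¹ •
      (((ghgUnit hN ^ (-n)).val ⊗ₖ (1 : Matrix (Fin N) (Fin N) ℂ)) * rHat N x ζ τ *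
        ((ghgUnit hN ^ n).val ⊗ₖ (1 : Matrix (Fin N) (Fin N) ℂ))) := by
  have h1 := congrArg (((ghgUnit hN ^ (-n)).val ⊗ₖ (1 : Matrix (Fin N) (Fin N) ℂ)) * ·)
    (ghg_zpow_mul_rHat hN hζ hτ h n)
  simp only at h1
  rw [← mul_assoc, units_kronecker_one_mul, ← zpow_add, neg_add_cancel, zpow_zero, Units.val_one,
    Matrix.one_kronecker_one, one_mul] at h1
  rw [h1, Matrix.mul_smul, mul_assoc]

include hζ in
-- Quasi-periodicity rewrites the middle factor as `R̂₂₁(-x)` between powers of `M`. Unitarity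
-- contracts it with one outer R-matrix, and the other one is returned to the shifted argument.
theorem rHat_mul_mul_rHat {τ x : ℂ} (hτ : 0 < τ.im) (h : OffLattice ζ τ x) (n : ℤ) :
    rHat N x ζ τ * (((ghgUnit hN ^ (-n)).val ⊗ₖ (1 : Matrix (Fin N) (Fin N) ℂ)) *
      swapMat (rHat N (-x + n * (τ + 1)) ζ τ) *
      ((1 : Matrix (Fin N) (Fin N) ℂ) ⊗ₖ (ghgUnit hN ^ (-n)).val)) * rHat N x ζ τ =
    (uFun N ζ x * fFun N ζ τ n x * (fFun N ζ τ n (-x))⁻¹) •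
      (((1 : Matrix (Fin N) (Fin N) ℂ) ⊗ₖ (ghgUnit hN ^ (-n)).val) *
        rHat N (x + n * (τ + 1)) ζ τ *
        ((ghgUnit hN ^ (-n)).val ⊗ₖ (1 : Matrix (Fin N) (Fin N) ℂ))) := by
  have hu := mul_eq_smul_one_comm (uFun_ne_zero hN hζ h) (rHat_unitarity hN hζ hτ h)
  have hf := fFun_ne_zero hN hζ h n
  have hG := ghg_zpow_kronecker_mul_rHat hN (ζ := ζ) (ξ := x) hτ (-n)
  rw [kronecker_eq_mul] at hG
  rw [rHat_add_int_mul_tau hN hζ hτ h.neg, rHat_add_int_mul_tau hN hζ hτ h, swapMat_smul,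
    swapMat_mul, swapMat_mul, swapMat_kronecker, swapMat_kronecker]
  have e1 : ((ghgUnit hN ^ n).val ⊗ₖ (1 : Matrix (Fin N) (Fin N) ℂ)) *
      ((ghgUnit hN ^ (-n)).val ⊗ₖ (1 : Matrix (Fin N) (Fin N) ℂ)) = 1 := by
    rw [units_kronecker_one_mul, ← zpow_add, add_neg_cancel, zpow_zero, Units.val_one,
      Matrix.one_kronecker_one]
  have e2 : ((1 : Matrix (Fin N) (Fin N) ℂ) ⊗ₖ (ghgUnit hN ^ n).val) *
      ((1 : Matrix (Fin N) (Fin N) ℂ) ⊗ₖ (ghgUnit hN ^ (-n)).val) = 1 := by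
    rw [units_one_kronecker_mul, ← zpow_add, add_neg_cancel, zpow_zero, Units.val_one,
      Matrix.one_kronecker_one]
  have e3 : ((ghgUnit hN ^ (-n)).val ⊗ₖ (1 : Matrix (Fin N) (Fin N) ℂ)) *
      ((1 : Matrix (Fin N) (Fin N) ℂ) ⊗ₖ (ghgUnit hN ^ (-n)).val) =
      ((1 : Matrix (Fin N) (Fin N) ℂ) ⊗ₖ (ghgUnit hN ^ (-n)).val) *
      ((ghgUnit hN ^ (-n)).val ⊗ₖ (1 : Matrix (Fin N) (Fin N) ℂ)) := by
    rw [← kronecker_eq_mul, ← kronecker_eq_mul']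
  generalize (ghgUnit hN ^ (-n)).val ⊗ₖ (1 : Matrix (Fin N) (Fin N) ℂ) = P1 at *
  generalize (1 : Matrix (Fin N) (Fin N) ℂ) ⊗ₖ (ghgUnit hN ^ (-n)).val = P2 at *
  generalize (ghgUnit hN ^ n).val ⊗ₖ (1 : Matrix (Fin N) (Fin N) ℂ) = G1 at *
  generalize (1 : Matrix (Fin N) (Fin N) ℂ) ⊗ₖ (ghgUnit hN ^ n).val = G2 at *
  generalize swapMat (rHat N (-x) ζ τ) = S at *
  generalize rHat N x ζ τ = R at *
  simp only [Matrix.mul_smul, Matrix.smul_mul, smul_smul]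
  have l : R * (P1 * (P2 * S * G2) * P2) * R = uFun N ζ x • (P1 * P2 * R) := by
    calc R * (P1 * (P2 * S * G2) * P2) * R = R * (P1 * P2) * S * (G2 * P2) * R := by
          simp only [mul_assoc]
      _ = R * (P1 * P2) * (S * R) := by rw [e2, mul_one, mul_assoc]
      _ = _ := by rw [hu, ← hG, Matrix.mul_smul, mul_one]
  have r : P2 * (P1 * R * G1) * P1 = P1 * P2 * R := by
    calc P2 * (P1 * R * G1) * P1 = P2 * P1 * R * (G1 * P1) := by simp only [mul_assoc]
      _ = _ := by rw [e1, mul_one, e3]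
  rw [l, r, smul_smul]
  congr 1
  field_simp

variable {τ c : ℂ} {m n : ℤ} (hτ : 0 < τ.im) (hτs : 0 < (tauStar ζ τ c).im)
  (hS : OnSurfaceCover N ζ τ c m n)
  {A : Type*} [Ring A] [Algebra ℂ A] {D : Set ℂ} {L Linv : ℂ → Matrix (Fin N) (Fin N) A}
  (hL : ExchangeRelations N ζ τ c D L Linv)

include hζ hτ hS hL in
-- The ordered form of a product of two generators. Exchanging `ξ` and `η` in it can then be
-- compared using the relations for `L₁L₂` and for the inverses.
theorem tGen_mul_tGen {ξ η : ℂ} (hξ : ξ ∈ tDomain ζ τ c n D) (hη : η ∈ tDomain ζ τ c n D)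
    (hg : Generic ζ τ c (ξ - η)) :
    tGen N ζ τ c m n L Linv ξ * tGen N ζ τ c m n L Linv η =
      (uFun N ζ (ξ - η + m * (τ + 1)) * fFun N ζ τ m (ξ - η))⁻¹ •
      Matrix.trace (ofNum (((ghgUnit hN ^ (-m)).val ⊗ₖ (ghgUnit hN ^ (-m)).val) *
          rHat N (ξ - η) ζ τ) *
        ((L (ξ + shift ζ τ c n) ⊗ₖ (1 : Matrix (Fin N) (Fin N) A)) *
          ((1 : Matrix (Fin N) (Fin N) A) ⊗ₖ L (η + shift ζ τ c n))) *
        ofNum (((ghgUnit hN ^ (-n)).val ⊗ₖ (1 : Matrix (Fin N) (Fin N) ℂ)) *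
          swapMat (rHat N (-(ξ - η) + n * (tauStar ζ τ c + 1)) ζ (tauStar ζ τ c)) *
          ((1 : Matrix (Fin N) (Fin N) ℂ) ⊗ₖ (ghgUnit hN ^ (-n)).val)) *
        ((Linv ξ ⊗ₖ (1 : Matrix (Fin N) (Fin N) A)) *
          ((1 : Matrix (Fin N) (Fin N) A) ⊗ₖ Linv η))) := by
  obtain ⟨k, ⟨j, hj⟩, hk⟩ := hS
  have hj' : (2 : ℂ) * k = N * j := by exact_mod_cast hj
  set x := ξ - η with hx
  have ho := hg.offLattice
  set u := x + m * (τ + 1) with hu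
  have hou : OffLattice ζ τ u := ho.add_int_mul m
  have hU := uFun_ne_zero hN hζ hou
  -- By the surface equation this argument is `u - 2k`. As `R̂` has period `N`, the integer `2k` has
  -- to be a multiple of `N`.
  have hv : rHat N (x - shift ζ τ c n - N * ζ) ζ τ = rHat N u ζ τ := by
    rw [← rHat_add_int_mul hN hζ hτ hou (-j)]
    congr 1
    rw [shift, hu]; push_cast; linear_combination -hk - hj'
  have hcr := rHat_crossing hN hζ hτ (ξ := x - shift ζ τ c n - N * ζ)
    (ξ' := η + shift ζ τ c n - ξ) (hou.congr 0 0 (-(2 * k)) (by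
      rw [shift, hu]; push_cast; linear_combination -hk)) (by rw [hx]; ring)
  rw [uFun_congr hN hζ (x := u) (y := x - shift ζ τ c n - N * ζ) 0 (-(2 * k)) (by
      rw [shift, hu]; push_cast; linear_combination -hk), hv] at hcr
  have hcr' := mul_eq_smul_one_comm hU hcr
  have hY : ((1 : Matrix (Fin N) (Fin N) ℂ) ⊗ₖ (ghgUnit hN ^ (-m)).val) * rHat N u ζ τ *
      ((ghgUnit hN ^ (-m)).val ⊗ₖ (1 : Matrix (Fin N) (Fin N) ℂ)) = (fFun N ζ τ m x)⁻¹ •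
      (((ghgUnit hN ^ (-m)).val ⊗ₖ (ghgUnit hN ^ (-m)).val) * rHat N x ζ τ) := by
    rw [hu, rHat_add_int_mul_tau hN hζ hτ ho, Matrix.mul_smul, Matrix.smul_mul, mul_assoc,
      mul_assoc, units_kronecker_one_mul, ← zpow_add, add_neg_cancel, zpow_zero, Units.val_one,
      Matrix.one_kronecker_one, mul_one, ← mul_assoc, ← kronecker_eq_mul']
  -- The pair needed for gluing the traces, with the scalars of crossing and quasi-periodicity
  -- normalised away.
  have hpt : partialTranspose (swapMat (rHat N (η + shift ζ τ c n - ξ) ζ τ)) *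
      partialTranspose ((uFun N ζ u * fFun N ζ τ m x)⁻¹ •
        (((ghgUnit hN ^ (-m)).val ⊗ₖ (ghgUnit hN ^ (-m)).val) * rHat N x ζ τ)) =
      (ghgUnit hN ^ (-m)).val ⊗ₖ ((ghgUnit hN ^ (-m)).val).transpose := by
    rw [mul_inv, mul_smul, ← hY, partialTranspose_smul, partialTranspose_kronecker_mul_mul,
      Matrix.transpose_one, Matrix.one_kronecker_one, one_mul, Matrix.mul_smul, ← mul_assoc, hcr',
      Matrix.smul_mul, one_mul, smul_smul, inv_mul_cancel₀ hU, one_smul]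
  have hsh : η + shift ζ τ c n - ξ = -x + shift ζ τ c n := by rw [hx]; ring
  have hrel := inv_mul_mul_of_rll (hL.rll _ hη.2 _ hξ.1
    (by rw [hsh]; exact hg.neg.add_shift n)) (hL.mul_inv _ hξ.1) (hL.inv_mul _ hξ.1)
  have key := trace_mul_trace_eq (L' := L (ξ + shift ζ τ c n)) (Ki := Linv η)
    (P := (ghgUnit hN ^ (-n)).val) hpt hrel
  rw [ofNum_smul, Matrix.smul_mul, Matrix.smul_mul, Matrix.smul_mul, Matrix.trace_smul, hsh] at key
  rw [tGen, tGen]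
  rw [Matrix.coe_units_zpow, Matrix.coe_units_zpow, coe_ghgUnit] at key ⊢
  exact key

include hN hζ hτ hτs hS hL in
-- Before `𝒴_{mn} = 1` is used, the computation amounts to `t(z) t(w) = 𝒴_{mn}(z/w) t(w) t(z)`.
theorem commute_tGen {ξ η : ℂ} (hξ : ξ ∈ tDomain ζ τ c n D) (hη : η ∈ tDomain ζ τ c n D)
    (hg : Generic ζ τ c (ξ - η)) (hY : yFun N ζ τ c m n (ξ - η) = 1) :
    Commute (tGen N ζ τ c m n L Linv ξ) (tGen N ζ τ c m n L Linv η) := by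
  have h1 := tGen_mul_tGen hN hζ hτ hS hL hξ hη hg
  have h2 := tGen_mul_tGen hN hζ hτ hS hL hη hξ (by rw [← neg_sub]; exact hg.neg)
  have r1 := hL.rll _ hξ.2 _ hη.2 (by rw [add_sub_add_right_eq_sub]; exact hg)
  have r2 := inv_mul_inv_mul_of_rll (hL.rll _ hξ.1 _ hη.1 hg) (hL.mul_inv _ hξ.1)
    (hL.inv_mul _ hξ.1) (hL.mul_inv _ hη.1) (hL.inv_mul _ hη.1)
  rw [add_sub_add_right_eq_sub] at r1
  rw [← neg_sub ξ η, neg_neg] at h2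
  set x := ξ - η with hx
  have ho := hg.offLattice
  have hos := hg.offLattice_tauStar
  have hU := uFun_ne_zero hN hζ ho
  have hQ := rHat_mul_mul_rHat hN hζ hτs hos n
  have hun := rHat_unitarity hN hζ hτ ho
  have hG := congrArg swapMat (ghg_zpow_kronecker_mul_rHat hN (ζ := ζ) (ξ := -x) hτ (-m))
  rw [swapMat_mul, swapMat_mul, swapMat_kronecker] at hG
  -- Swapping the tensor legs puts both products on the same footing: `ξ` on the first leg, `η` on
  -- the second.
  rw [← trace_swapMat] at h2
  simp only [swapMat_mul, swapMat_ofNum, swapMat_kronecker_one, swapMat_one_kronecker,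
    swapMat_kronecker, swapMat_swapMat] at h2
  change ofNum _ * _ * _ = _ * _ * ofNum _ at r1
  set F := fFun N ζ τ
  set Fs := fFun N ζ (tauStar ζ τ c)
  -- The reflection identities for `ℱ_m` and `ℱ*_n` reduce this to `𝒴_{mn}(x) = 1`; the surface
  -- equation identifies their two shifted values of `𝒰`.
  have hscal : (uFun N ζ (x + m * (τ + 1)) * F m x)⁻¹ * (uFun N ζ x * Fs n x * (Fs n (-x))⁻¹) =
      uFun N ζ x * (uFun N ζ (-x + m * (τ + 1)) * F m (-x))⁻¹ := by
    obtain ⟨k, -, hk⟩ := hS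
    have i1 := fFun_neg_mul_fFun_neg hN hζ ho m
    have i2 := fFun_neg_mul_fFun_neg hN hζ hos n
    have n1 : F m x ≠ 0 := fFun_ne_zero hN hζ ho m
    have n2 : F m (-x) ≠ 0 := fFun_ne_zero hN hζ ho.neg m
    have n3 : Fs n (-x) ≠ 0 := fFun_ne_zero hN hζ hos.neg n
    have n4 : F (-m) x ≠ 0 := fFun_ne_zero hN hζ ho (-m)
    have n5 : Fs (-n) x ≠ 0 := fFun_ne_zero hN hζ hos (-n)
    have n6 := uFun_ne_zero hN hζ (ho.add_int_mul m)
    have n7 := uFun_ne_zero hN hζ (ho.neg.add_int_mul m)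
    have u1 : uFun N ζ (-x + m * (τ + 1)) = uFun N ζ (x - m * (τ + 1)) := by
      rw [← uFun_neg hN hζ, neg_add, neg_neg, ← sub_eq_add_neg]
    have u2 : uFun N ζ (x - n * (tauStar ζ τ c + 1)) = uFun N ζ (x + m * (τ + 1)) :=
      uFun_congr hN hζ 1 (-(2 * k)) (by push_cast; linear_combination -hk)
    rw [yFun, div_eq_one_iff_eq (mul_ne_zero n1 n4)] at hY
    change Fs n x * Fs (-n) x = F m x * F (-m) x at hY
    change F m (-x) * F (-m) x * _ = _ at i1
    change Fs n (-x) * Fs (-n) x * _ = _ at i2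
    rw [u2] at i2
    rw [← u1] at i1
    have E : Fs n x * uFun N ζ (-x + m * (τ + 1)) * F m (-x) =
        F m x * Fs n (-x) * uFun N ζ (x + m * (τ + 1)) := by
      rw [← mul_right_inj' n4, ← mul_right_inj' n5]
      linear_combination F (-m) x * F m (-x) * uFun N ζ (-x + m * (τ + 1)) * hY +
        F m x * F (-m) x * (i1 - i2)
    field_simp
    linear_combination E
  generalize ((ghgUnit hN ^ (-m)).val ⊗ₖ (ghgUnit hN ^ (-m)).val) = MM at *
  generalize ((ghgUnit hN ^ (-n)).val ⊗ₖ (1 : Matrix (Fin N) (Fin N) ℂ)) = P1 at *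
  generalize ((1 : Matrix (Fin N) (Fin N) ℂ) ⊗ₖ (ghgUnit hN ^ (-n)).val) = P2 at *
  generalize L (ξ + shift ζ τ c n) ⊗ₖ (1 : Matrix (Fin N) (Fin N) A) = L1 at *
  generalize (1 : Matrix (Fin N) (Fin N) A) ⊗ₖ L (η + shift ζ τ c n) = K2 at *
  generalize Linv ξ ⊗ₖ (1 : Matrix (Fin N) (Fin N) A) = Li1 at *
  generalize (1 : Matrix (Fin N) (Fin N) A) ⊗ₖ Linv η = Ki2 at *
  generalize swapMat (rHat N (-x) ζ τ) = R21 at *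
  generalize rHat N x ζ (tauStar ζ τ c) = Rs at *
  generalize rHat N x ζ τ = R at *
  generalize P1 * swapMat (rHat N (-x + n * (tauStar ζ τ c + 1)) ζ (tauStar ζ τ c)) * P2 = Q at *
  generalize P2 * rHat N (x + n * (tauStar ζ τ c + 1)) ζ (tauStar ζ τ c) * P1 = V at *
  -- The scalar `U(x)` is expanded as `R R₂₁` on the right. One factor exchanges the inverses, the
  -- numerical `R₂₁` moves cyclically to the front, and the two `Rs` produced enclose `Q`.
  have key : uFun N ζ x • Matrix.trace (ofNum (MM * R) * (L1 * K2) * ofNum Q * (Li1 * Ki2)) =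
      (uFun N ζ x * Fs n x * (Fs n (-x))⁻¹) •
        Matrix.trace (ofNum (MM * R21) * (K2 * L1) * ofNum V * (Ki2 * Li1)) := by
    calc uFun N ζ x • Matrix.trace (ofNum (MM * R) * (L1 * K2) * ofNum Q * (Li1 * Ki2))
        = Matrix.trace (ofNum (MM * R) * (L1 * K2) * ofNum Q * (Li1 * Ki2) *
            ofNum (R * R21)) := by
          rw [hun, ofNum_smul, ofNum_one, Matrix.mul_smul, mul_one, Matrix.trace_smul]
      _ = Matrix.trace (ofNum MM * (ofNum R * L1 * K2) * ofNum Q * (Li1 * Ki2 * ofNum R) *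
            ofNum R21) := by
          simp only [ofNum_mul, mul_assoc]
      _ = Matrix.trace (ofNum R21 * (ofNum MM * (K2 * L1 * ofNum Rs) * ofNum Q *
            (ofNum Rs * (Ki2 * Li1)))) := by
          rw [r1, r2, trace_ofNum_mul]
      _ = Matrix.trace (ofNum (R21 * MM) * (K2 * L1) * ofNum (Rs * Q * Rs) * (Ki2 * Li1)) := by
          simp only [ofNum_mul, mul_assoc]
      _ = _ := by
          rw [hQ, ← hG, ofNum_smul, Matrix.mul_smul, Matrix.smul_mul, Matrix.trace_smul]
  refine smul_right_injective A hU ?_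
  change uFun N ζ x • _ = uFun N ζ x • _
  rw [h1, h2, smul_smul, mul_comm, mul_smul, key, smul_smul, smul_smul, hscal]

end

/-! ### The functions `ℱ_a ℱ_{-a}` -/

section

/-- The points of `Nζℤ + ℤ`. -/
def IsPeriod (N : ℕ) (ζ w : ℂ) : Prop := ∃ a k : ℤ, w = a * (N * ζ) + k

variable {N : ℕ} (hN : N ≠ 0) {ζ : ℂ} (hζ : 0 < ζ.im)

theorem IsPeriod.int_mul {w : ℂ} (h : IsPeriod N ζ w) (j : ℤ) : IsPeriod N ζ (j * w) := by
  obtain ⟨a, k, rfl⟩ := h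
  exact ⟨j * a, j * k, by push_cast; ring⟩

theorem IsPeriod.neg {w : ℂ} (h : IsPeriod N ζ w) : IsPeriod N ζ (-w) := by
  simpa using h.int_mul (-1)

include hN hζ

theorem IsPeriod.uFun_eq {w : ℂ} (h : IsPeriod N ζ w) {x y : ℂ} (e : y = x + w) :
    uFun N ζ y = uFun N ζ x := by
  obtain ⟨a, k, rfl⟩ := h
  exact uFun_congr hN hζ a k (by rw [e]; ring)

theorem IsPeriod.fFun_eq {w : ℂ} (h : IsPeriod N ζ w) (τ x : ℂ) (a : ℤ) :
    fFun N ζ τ a (x + w) = fFun N ζ τ a x := by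
  rcases a with a | a
  · exact Finset.prod_congr rfl fun k _ => h.uFun_eq hN hζ (by ring)
  · exact Finset.prod_congr rfl fun k _ => congrArg _ (h.uFun_eq hN hζ (by ring))

variable {τ x : ℂ} (hx : OffLattice ζ τ x)
include hx

theorem fFun_neg_mul_fFun (a : ℤ) :
    fFun N ζ τ (-a) x * fFun N ζ τ a (x - a * (τ + 1)) = 1 := by
  -- The hypotheses on one-step recursions integrate to the cocycle relation; it is then applied at
  -- `(-a, a)`.
  have key : ∀ a b : ℤ, fFun N ζ τ (a + b) x = fFun N ζ τ a x * fFun N ζ τ b (x + a * (τ + 1)) := by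
    intro a b
    have hs := fFun_add_one hN hζ hx
    have hs' := fFun_add_one hN hζ (hx.add_int_mul a)
    have e : ∀ b : ℤ, x + a * (τ + 1) + b * (τ + 1) = x + ((a + b : ℤ) : ℂ) * (τ + 1) := by
      intro b; push_cast; ring
    induction b with
    | zero => simp [fFun_zero]
    | succ n ih => rw [← add_assoc, hs, ih, hs', e, mul_assoc]
    | pred n ih =>
      have hu := uFun_ne_zero hN hζ (hx.add_int_mul (a + (-n - 1)))
      have h1 := hs (a + (-n - 1))
      have h2 := hs' (-n - 1)
      rw [add_assoc, sub_add_cancel, ih] at h1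
      rw [sub_add_cancel, e] at h2
      apply mul_right_cancel₀ hu
      rw [← h1, h2, mul_assoc]
  have := key (-a) a
  rw [neg_add_cancel, fFun_zero] at this
  rw [show x + ((-a : ℤ) : ℂ) * (τ + 1) = x - a * (τ + 1) by push_cast; ring] at this
  exact this.symm

theorem fFun_mul_fFun_neg_of_isPeriod {a : ℤ} (h : IsPeriod N ζ (a * (τ + 1))) :
    fFun N ζ τ a x * fFun N ζ τ (-a) x = 1 := by
  rw [← fFun_neg_mul_fFun hN hζ hx a, sub_eq_add_neg, h.neg.fFun_eq hN hζ, mul_comm]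

theorem fFun_mul_fFun_neg_add_one (a : ℤ) :
    fFun N ζ τ (a + 1) x * fFun N ζ τ (-(a + 1)) x * uFun N ζ (x - (a + 1) * (τ + 1)) =
      fFun N ζ τ a x * fFun N ζ τ (-a) x * uFun N ζ (x + a * (τ + 1)) := by
  have h := fFun_add_one hN hζ hx (-(a + 1))
  rw [show -(a + 1) + 1 = -a by ring, show x + ((-(a + 1) : ℤ) : ℂ) * (τ + 1) =
    x - (a + 1) * (τ + 1) by push_cast; ring] at h
  rw [h, fFun_add_one hN hζ hx]
  ring

/-- When `2(τ + 1)` is a period, `uFun` takes equal values at `x ± a(τ + 1)`, so the recursion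
telescopes. -/
theorem fFun_mul_fFun_neg_of_isPeriod_two (h : IsPeriod N ζ (2 * (τ + 1))) (a : ℤ) :
    fFun N ζ τ a x * fFun N ζ τ (-a) x * uFun N ζ (x + a * (τ + 1)) = uFun N ζ x := by
  have step : ∀ a : ℤ, fFun N ζ τ (a + 1) x * fFun N ζ τ (-(a + 1)) x *
      uFun N ζ (x + ((a + 1 : ℤ) : ℂ) * (τ + 1)) =
      fFun N ζ τ a x * fFun N ζ τ (-a) x * uFun N ζ (x + a * (τ + 1)) := by
    intro a
    rw [← fFun_mul_fFun_neg_add_one hN hζ hx a, (h.int_mul (a + 1)).uFun_eq hN hζ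
      (x := x - (a + 1) * (τ + 1)) (y := x + ((a + 1 : ℤ) : ℂ) * (τ + 1)) (by push_cast; ring)]
  induction a with
  | zero => simp [fFun_zero]
  | succ n ih => rw [step, ih]
  | pred n ih => rw [← step, sub_add_cancel, ih]

theorem fFun_mul_fFun_neg_of_eq_one {n : ℤ} (hn : |n| = 1) :
    fFun N ζ τ n x * fFun N ζ τ (-n) x * uFun N ζ (x - (τ + 1)) = uFun N ζ x := by
  have h := fFun_mul_fFun_neg_add_one hN hζ hx 0
  simp only [zero_add, neg_zero, fFun_zero, Int.cast_zero, one_mul, zero_mul, add_zero] at h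
  rcases eq_or_eq_neg_of_abs_eq hn with rfl | rfl
  · exact h
  · rw [neg_neg, mul_comm (fFun N ζ τ (-1) x)]; exact h

/-- The product for index `m + n` is `1`; as `n = ±1`, one step of the recursion reaches index `m`.
-/
theorem fFun_mul_fFun_neg_of_isPeriod_add {m n : ℤ} (hn : |n| = 1)
    (h : IsPeriod N ζ ((m + n : ℤ) * (τ + 1))) :
    fFun N ζ τ m x * fFun N ζ τ (-m) x * uFun N ζ (x - (τ + 1)) = uFun N ζ x := by
  have h1 := fFun_mul_fFun_neg_of_isPeriod hN hζ hx h
  rcases eq_or_eq_neg_of_abs_eq hn with rfl | rfl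
  · have h2 := fFun_mul_fFun_neg_add_one hN hζ hx m
    rw [h1, one_mul, h.neg.uFun_eq hN hζ (x := x) (by push_cast; ring),
      h.uFun_eq hN hζ (x := x - (τ + 1)) (y := x + m * (τ + 1)) (by push_cast; ring)] at h2
    exact h2.symm
  · have h2 := fFun_mul_fFun_neg_add_one hN hζ hx (m + -1)
    rw [h1, one_mul, neg_add_cancel_right, h.neg.uFun_eq hN hζ (x := x - (τ + 1))
        (y := x - (((m + -1 : ℤ) : ℂ) + 1) * (τ + 1)) (by push_cast; ring),
      h.uFun_eq hN hζ (x := x) (y := x + ((m + -1 : ℤ) : ℂ) * (τ + 1)) (by push_cast; ring)] at h2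
    exact h2

end

/-! ### The sufficient conditions -/

theorem exists_of_negSqrtP_eq {τ ζ a : ℂ} (h : negSqrtP τ = qpow ζ (-a)) :
    ∃ k : ℤ, τ + 1 = -(ζ * a) + 2 * k := by
  rw [negSqrtP, qpow] at h
  have : ex (τ + 1) = ex (ζ * -a) := by rw [← h, ex_add, ex_one]; ring
  rw [ex_eq_ex_iff] at this
  obtain ⟨k, hk⟩ := this
  exact ⟨k, by rw [hk]; ring⟩

theorem exists_int_div_mul (a u m : ℤ) (h : u ∣ m) : ∃ j : ℤ, ((a / u : ℚ) : ℂ) * m = j := by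
  obtain ⟨v, rfl⟩ := h
  -- For `u = 0` the quotient `a / u` is zero by convention, and the claim holds trivially.
  rcases eq_or_ne u 0 with rfl | hu
  · exact ⟨0, by simp⟩
  · refine ⟨a * v, ?_⟩
    have : (u : ℂ) ≠ 0 := Int.cast_ne_zero.2 hu
    push_cast
    field_simp

theorem exists_int_of_eq_two_or_dvd {a u m n : ℤ} (h : u = 2 ∨ u ∣ m ∨ u ∣ n) :
    (∃ j : ℤ, 2 * ((a / u : ℚ) : ℂ) = j) ∨ (∃ j : ℤ, ((a / u : ℚ) : ℂ) * m = j) ∨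
      ∃ j : ℤ, ((a / u : ℚ) : ℂ) * n = j :=
  h.imp (fun h => ⟨a, by subst h; push_cast; ring⟩)
    (Or.imp (exists_int_div_mul a u m) (exists_int_div_mul a u n))

section

variable {N : ℕ} (hN : N ≠ 0) {ζ : ℂ} (hζ : 0 < ζ.im)
include hN hζ

/-- Since `n = ±1`, the left side is `𝒰(x) / 𝒰(x - (τ' + 1))`. In each case periods reduce the right
side to the same ratio. The roles of `τ` and `τ'` are left free so as to cover both `|n| = 1` and
`|m| = 1`. -/
theorem fFun_mul_fFun_neg_eq {τ τ' x : ℂ} (hx : OffLattice ζ τ x) (hx' : OffLattice ζ τ' x)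
    {m n : ℤ} (hn : |n| = 1) {l : ℂ}
    (hl : (∃ j : ℤ, 2 * l = j) ∨ (∃ j : ℤ, l * m = j) ∨ ∃ j : ℤ, l * (m + n : ℤ) = j)
    (hτ : negSqrtP τ = qpow ζ (-(N * l)))
    (hτ' : negSqrtP τ' = qpow ζ (-(N * n * (1 - l * m)))) :
    fFun N ζ τ' n x * fFun N ζ τ' (-n) x = fFun N ζ τ m x * fFun N ζ τ (-m) x := by
  obtain ⟨k, hk⟩ := exists_of_negSqrtP_eq hτ
  obtain ⟨k', hk'⟩ := exists_of_negSqrtP_eq hτ'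
  have h1 := fFun_mul_fFun_neg_of_eq_one hN hζ hx' hn
  have hne : uFun N ζ (x - (τ' + 1)) ≠ 0 :=
    uFun_ne_zero hN hζ (hx'.congr 0 (-1) (-1) (by push_cast; ring))
  apply mul_right_cancel₀ hne
  rw [h1]
  rcases hl with ⟨j, hj⟩ | ⟨j, hj⟩ | ⟨j, hj⟩
  · have hp : IsPeriod N ζ (2 * (τ + 1)) :=
      ⟨-j, 4 * k, by rw [hk]; push_cast; linear_combination -ζ * N * hj⟩
    have h2 := fFun_mul_fFun_neg_of_isPeriod_two hN hζ hx hp m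
    -- For `n = 1` the coefficient of `Nζ` is `1`; for `n = -1` it is `-1 + 2lm`, an integer because
    -- `2l` is one.
    have hper : IsPeriod N ζ (-(τ' + 1) - m * (τ + 1)) := by
      rcases eq_or_eq_neg_of_abs_eq hn with rfl | rfl
      · exact ⟨1, -(2 * k') - 2 * k * m, by rw [hk, hk']; push_cast; ring⟩
      · exact ⟨-1 + j * m, -(2 * k') - 2 * k * m, by
          rw [hk, hk']; push_cast; linear_combination ζ * N * m * hj⟩
    rw [hper.uFun_eq hN hζ (x := x + m * (τ + 1)) (y := x - (τ' + 1)) (by ring), h2]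
  · have hp : IsPeriod N ζ (m * (τ + 1)) :=
      ⟨-j, 2 * k * m, by rw [hk]; push_cast; linear_combination -ζ * N * hj⟩
    have hp' : IsPeriod N ζ (τ' + 1) :=
      ⟨-n * (1 - j), 2 * k', by rw [hk']; push_cast; linear_combination ζ * N * n * hj⟩
    rw [fFun_mul_fFun_neg_of_isPeriod hN hζ hx hp, one_mul,
      hp'.neg.uFun_eq hN hζ (x := x) (y := x - (τ' + 1)) (by ring)]
  · push_cast at hj
    have hnn : (n : ℂ) * n = 1 := by
      rcases eq_or_eq_neg_of_abs_eq hn with rfl | rfl <;> norm_num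
    have hp : IsPeriod N ζ ((m + n : ℤ) * (τ + 1)) :=
      ⟨-j, 2 * k * (m + n), by rw [hk]; push_cast; linear_combination -ζ * N * hj⟩
    have hp' : IsPeriod N ζ ((τ + 1) - (τ' + 1)) :=
      ⟨n * (1 - j), 2 * k - 2 * k', by
        rw [hk, hk']; push_cast
        linear_combination (-ζ * N * n) * hj + ζ * N * l * hnn⟩
    rw [hp'.uFun_eq hN hζ (x := x - (τ + 1)) (y := x - (τ' + 1)) (by ring),
      fFun_mul_fFun_neg_of_isPeriod_add hN hζ hx hn hp]

theorem yFun_eq_one {τ c : ℂ} {m n : ℤ} (h : AbelianCondition N ζ τ c m n) {x : ℂ}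
    (hx : Generic ζ τ c x) : yFun N ζ τ c m n x = 1 := by
  have ho := hx.offLattice
  have hos := hx.offLattice_tauStar
  rw [yFun, div_eq_one_iff_eq (mul_ne_zero (fFun_ne_zero hN hζ ho m) (fFun_ne_zero hN hζ ho (-m)))]
  have hper : ∀ {σ : ℂ} {m : ℤ} (l : ℂ) (j : ℤ), negSqrtP σ = qpow ζ (-(N * l)) → l * m = j →
      IsPeriod N ζ (m * (σ + 1)) := by
    intro σ m l j hσ hj
    obtain ⟨k, hk⟩ := exists_of_negSqrtP_eq hσ
    exact ⟨-j, 2 * k * m, by rw [hk]; push_cast; linear_combination -ζ * N * hj⟩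
  rcases h with ⟨hm, hn, l, l', -, -, -, -, hp, hps⟩ | ⟨hn, -, a, u, hu, -, hp, hps⟩ |
    ⟨hm, -, a, u, hu, -, hp, hps⟩ | ⟨hmn, hm, a, ⟨-, hp, hps⟩ | ⟨-, hp, hps⟩⟩ |
    ⟨hmn, hn, ⟨r, hr⟩, -, hp, hps⟩
  -- Here `m(τ + 1)` and `n(τ* + 1)` are both periods, so both products equal `1`.
  · have hm' : (m : ℂ) ≠ 0 := Int.cast_ne_zero.2 fun e => by simp [e] at hm
    have hn' : (n : ℂ) ≠ 0 := Int.cast_ne_zero.2 fun e => by simp [e] at hn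
    rw [mul_div_assoc] at hp hps
    rw [fFun_mul_fFun_neg_of_isPeriod hN hζ ho (hper _ l hp (div_mul_cancel₀ _ hm')),
      fFun_mul_fFun_neg_of_isPeriod hN hζ hos (hper _ l' hps (div_mul_cancel₀ _ hn'))]
  · exact fFun_mul_fFun_neg_eq hN hζ ho hos hn (exists_int_of_eq_two_or_dvd hu) hp hps
  -- The same statement with `p` and `p*`, and `m` and `n`, exchanged.
  · exact (fFun_mul_fFun_neg_eq hN hζ hos ho hm (exists_int_of_eq_two_or_dvd hu) hps hp).symm
  · exact fFun_mul_fFun_neg_eq hN hζ ho hos (hmn ▸ hm) (Or.inl ⟨a, by push_cast; ring⟩) hp hps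
  · exact (fFun_mul_fFun_neg_eq hN hζ hos ho hm (Or.inl ⟨a, by push_cast; ring⟩) hps hp).symm
  -- Oddness `n = 2r + 1` makes `(n ∓ 1)/2` integers, so `m(τ + 1)` and `n(τ* + 1)` are again
  -- periods.
  · have hn' : (n : ℂ) ≠ 0 := Int.cast_ne_zero.2 hn.ne'
    have hr' : (n : ℂ) = 2 * r + 1 := by exact_mod_cast hr
    have hm' : (m : ℂ) = -n := by exact_mod_cast eq_neg_of_add_eq_zero_left hmn
    rw [mul_comm _ (N : ℂ)] at hp hps
    rw [fFun_mul_fFun_neg_of_isPeriod hN hζ ho (hper _ (-r) hp (by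
        rw [hm']; field_simp; push_cast; linear_combination -hr')),
      fFun_mul_fFun_neg_of_isPeriod hN hζ hos (hper _ (r + 1) hps (by
        field_simp; push_cast; linear_combination hr'))]

end

/-! ### The presented algebra -/

theorem exchangeRelations_alg (N : ℕ) (ζ τ c : ℂ) (D : Set ℂ) :
    ExchangeRelations N ζ τ c D (algL N ζ τ c D) (algLinv N ζ τ c D) := by
  have hmul : ∀ (n : Type) [Fintype n] (X Y : Matrix n n (FreeAlgebra ℂ (Gen N D))),
      (X * Y).map (RingQuot.mkAlgHom ℂ (Rel N ζ τ c D)) =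
        X.map (RingQuot.mkAlgHom ℂ (Rel N ζ τ c D)) *
          Y.map (RingQuot.mkAlgHom ℂ (Rel N ζ τ c D)) := fun n _ X Y => Matrix.map_mul
  have hone : ∀ (n : Type) [DecidableEq n], (1 : Matrix n n (FreeAlgebra ℂ (Gen N D))).map
      (RingQuot.mkAlgHom ℂ (Rel N ζ τ c D)) = 1 :=
    fun n _ => Matrix.map_one _ (map_zero _) (map_one _)
  have hnum : ∀ X : Matrix (Fin N × Fin N) (Fin N × Fin N) ℂ,
      (X.map (algebraMap ℂ (FreeAlgebra ℂ (Gen N D)))).map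
        (RingQuot.mkAlgHom ℂ (Rel N ζ τ c D)) = X.map (algebraMap ℂ (Alg N ζ τ c D)) := by
    intro X; ext i j; simp
  have hkl : ∀ X : Matrix (Fin N) (Fin N) (FreeAlgebra ℂ (Gen N D)), (X ⊗ₖ
      (1 : Matrix (Fin N) (Fin N) (FreeAlgebra ℂ (Gen N D)))).map
        (RingQuot.mkAlgHom ℂ (Rel N ζ τ c D)) =
      (X.map (RingQuot.mkAlgHom ℂ (Rel N ζ τ c D))) ⊗ₖ 1 := by
    intro X; ext i j; by_cases h : i.2 = j.2 <;> simp [Matrix.one_apply, h]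
  have hkr : ∀ X : Matrix (Fin N) (Fin N) (FreeAlgebra ℂ (Gen N D)),
      ((1 : Matrix (Fin N) (Fin N) (FreeAlgebra ℂ (Gen N D))) ⊗ₖ X).map
        (RingQuot.mkAlgHom ℂ (Rel N ζ τ c D)) =
      1 ⊗ₖ (X.map (RingQuot.mkAlgHom ℂ (Rel N ζ τ c D))) := by
    intro X; ext i j; by_cases h : i.1 = j.1 <;> simp [Matrix.one_apply, h]
  refine ⟨fun ξ hξ => ?_, fun ξ hξ => ?_, fun ξ hξ η hη hg => ?_⟩
  · rw [algL, algLinv, ← hmul, ← hone]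
    ext i j
    exact RingQuot.mkAlgHom_rel ℂ (Rel.mul_inv ξ hξ i j)
  · rw [algL, algLinv, ← hmul, ← hone]
    ext i j
    exact RingQuot.mkAlgHom_rel ℂ (Rel.inv_mul ξ hξ i j)
  · have h : (rllLeft (rHat N (ξ - η) ζ τ) (freeL N D ξ) (freeL N D η)).map
        (RingQuot.mkAlgHom ℂ (Rel N ζ τ c D)) =
        (rllRight (rHat N (ξ - η) ζ (tauStar ζ τ c)) (freeL N D ξ) (freeL N D η)).map
        (RingQuot.mkAlgHom ℂ (Rel N ζ τ c D)) := by
      ext i j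
      exact RingQuot.mkAlgHom_rel ℂ (Rel.rll ξ η hξ hη hg i j)
    rw [rllLeft, rllRight, hmul, hmul, hmul, hmul, hnum, hnum, hkl, hkr] at h
    exact h

/-! ### Continuous realisations -/

theorem countable_setOf_not_generic (ζ τ c : ℂ) : {x | ¬ Generic ζ τ c x}.Countable := by
  refine (Set.countable_range fun t : ℤ × ℤ × ℤ × ℤ =>
    (t.1 * ζ + t.2.1 * τ + t.2.2.1 * tauStar ζ τ c + t.2.2.2 : ℂ)).mono fun x hx => ?_
  simp only [Generic, not_forall, not_not, Set.mem_ofPred_eq] at hx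
  obtain ⟨a, b, d, k, rfl⟩ := hx
  exact ⟨(a, b, d, k), rfl⟩

theorem dense_setOf_generic_sub (ζ τ c η : ℂ) : Dense {ξ | Generic ζ τ c (ξ - η)} := by
  have h : {ξ | ¬ Generic ζ τ c (ξ - η)}.Countable :=
    (countable_setOf_not_generic ζ τ c).preimage (sub_left_injective (b := η))
  have := h.dense_compl ℝ
  rwa [Set.compl_ofPred, show {ξ | ¬¬ Generic ζ τ c (ξ - η)} = {ξ | Generic ζ τ c (ξ - η)} by
    simp only [not_not]] at this

section

variable {N : ℕ} {ζ τ c : ℂ} {m n : ℤ} {A : Type*} [Ring A] [Algebra ℂ A] [TopologicalSpace A]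
  [IsTopologicalRing A] {D : Set ℂ} {L Linv : ℂ → Matrix (Fin N) (Fin N) A}
  (hL : IsRealization N ζ τ c D L Linv)
include hL

omit [IsTopologicalRing A] in
theorem IsRealization.exchangeRelations : ExchangeRelations N ζ τ c D L Linv :=
  ⟨hL.mul_inv, hL.inv_mul, hL.rll⟩

omit [IsTopologicalRing A] in
theorem IsRealization.isOpen_tDomain : IsOpen (tDomain ζ τ c n D) :=
  hL.isOpen.inter (hL.isOpen.preimage (continuous_add_const (shift ζ τ c n)))

theorem IsRealization.continuousOn_tGen :
    ContinuousOn (tGen N ζ τ c m n L Linv) (tDomain ζ τ c n D) := by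
  have hent : ∀ (F : ℂ → Matrix (Fin N) (Fin N) A) (S : Set ℂ), ContinuousOn F S →
      ∀ i j, ContinuousOn (fun ξ => F ξ i j) S := fun F S hF i j =>
    (continuous_apply_apply i j).comp_continuousOn hF
  have h1 : ContinuousOn (fun ξ => L (ξ + shift ζ τ c n)) (tDomain ζ τ c n D) :=
    hL.continuousOn_L.comp (continuous_add_const _).continuousOn fun ξ hξ => hξ.2
  have h2 : ContinuousOn Linv (tDomain ζ τ c n D) := hL.continuousOn_Linv.mono fun ξ hξ => hξ.1
  unfold tGen
  simp only [Matrix.trace, Matrix.diag, Matrix.mul_apply]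
  refine continuousOn_finsetSum _ fun i _ => continuousOn_finsetSum _ fun j _ =>
    (ContinuousOn.mul (continuousOn_finsetSum _ fun k _ => ContinuousOn.mul
      (continuousOn_finsetSum _ fun l _ => continuousOn_const.mul (hent _ _ h1 _ _))
      continuousOn_const) (hent _ _ h2 _ _))

/-- With `η` fixed, generic differences are dense in the open domain, and both products are
continuous in `ξ`; Hausdorffness makes the limits agree. -/
theorem IsRealization.commute_tGen_of_generic [T2Space A]
    (h : ∀ ξ ∈ tDomain ζ τ c n D, ∀ η ∈ tDomain ζ τ c n D, Generic ζ τ c (ξ - η) →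
      Commute (tGen N ζ τ c m n L Linv ξ) (tGen N ζ τ c m n L Linv η))
    {ξ η : ℂ} (hξ : ξ ∈ tDomain ζ τ c n D) (hη : η ∈ tDomain ζ τ c n D) :
    Commute (tGen N ζ τ c m n L Linv ξ) (tGen N ζ τ c m n L Linv η) := by
  have ho := hL.isOpen_tDomain (n := n)
  have hc := hL.continuousOn_tGen (m := m) (n := n)
  set t := tGen N ζ τ c m n L Linv
  have hd : (𝓝[tDomain ζ τ c n D ∩ {ξ | Generic ζ τ c (ξ - η)}] ξ).NeBot := by
    rw [← mem_closure_iff_nhdsWithin_neBot]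
    exact (dense_setOf_generic_sub ζ τ c η).open_subset_closure_inter ho hξ
  have hl : Filter.Tendsto t (𝓝[tDomain ζ τ c n D ∩ {ξ | Generic ζ τ c (ξ - η)}] ξ) (𝓝 (t ξ)) :=
    (hc ξ hξ).mono Set.inter_subset_left
  refine tendsto_nhds_unique (hl.mul_const (t η)) ((hl.const_mul (t η)).congr' ?_)
  filter_upwards [self_mem_nhdsWithin] with ξ' hξ'
  exact (h ξ' hξ'.1 η hη hξ'.2).eq.symm

end

/-- Two passes through centralizers, one for each argument. -/
theorem commute_of_mem_adjoin {A : Type*} [Ring A] [Algebra ℂ A] {S : Set A}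
    (h : ∀ x ∈ S, ∀ y ∈ S, Commute x y) {x y : A} (hx : x ∈ Algebra.adjoin ℂ S)
    (hy : y ∈ Algebra.adjoin ℂ S) : Commute x y := by
  have h1 : ∀ y ∈ S, x ∈ Subalgebra.centralizer ℂ {y} := by
    intro y hy
    refine Algebra.adjoin_le (fun z hz => ?_) hx
    rw [SetLike.mem_coe, Subalgebra.mem_centralizer_iff]
    rintro _ rfl
    exact (h z hz _ hy).eq.symm
  have h2 : y ∈ Subalgebra.centralizer ℂ {x} := by
    refine Algebra.adjoin_le (fun z hz => ?_) hy
    rw [SetLike.mem_coe, Subalgebra.mem_centralizer_iff]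
    rintro _ rfl
    exact ((Subalgebra.mem_centralizer_iff ℂ).1 (h1 z hz) z rfl).symm
  exact (Subalgebra.mem_centralizer_iff ℂ).1 h2 x rfl

/-- For `N = 2` the ambiguity `2ℤ` of the logarithm already lies in `Nℤ`. -/
theorem onSurfaceCover_of_onSurface {ζ τ c : ℂ} {m n : ℤ} (h : OnSurface 2 ζ τ c m n) :
    OnSurfaceCover 2 ζ τ c m n := by
  have e : ∀ σ : ℂ, negSqrtP σ = ex (σ + 1) := by
    intro σ; rw [negSqrtP, ex_add, ex_one]; ring
  rw [OnSurface, e, e, ← ex_int_mul, ← ex_int_mul, ← ex_add, qpow, ex_eq_ex_iff] at h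
  obtain ⟨k, hk⟩ := h
  exact ⟨k, by simp, by rw [hk]; ring⟩

end EllipticAlgebra

end

/-! ### The main theorem -/

theorem mainTheorem2 (N : ℕ) (hN : 2 ≤ N) (ζ τ c : ℂ) (hq : 0 < ζ.im) (m n : ℤ)
    (hS : EllipticAlgebra.OnSurface N ζ τ c m n)
    (hcond : EllipticAlgebra.AbelianCondition N ζ τ c m n) :
    (∀ x : ℂ, EllipticAlgebra.Generic ζ τ c x → EllipticAlgebra.yFun N ζ τ c m n x = 1) ∧
    (0 < τ.im → 0 < (EllipticAlgebra.tauStar ζ τ c).im →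
      (N = 2 ∨ EllipticAlgebra.OnSurfaceCover N ζ τ c m n) →
      (∀ D : Set ℂ, ∀ ξ ∈ EllipticAlgebra.tDomain ζ τ c n D,
        ∀ η ∈ EllipticAlgebra.tDomain ζ τ c n D, EllipticAlgebra.Generic ζ τ c (ξ - η) →
        Commute
          (EllipticAlgebra.tGen N ζ τ c m n (EllipticAlgebra.algL N ζ τ c D)
            (EllipticAlgebra.algLinv N ζ τ c D) ξ)
          (EllipticAlgebra.tGen N ζ τ c m n (EllipticAlgebra.algL N ζ τ c D)
            (EllipticAlgebra.algLinv N ζ τ c D) η)) ∧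
      (∀ (A : Type*) [Ring A] [Algebra ℂ A] [TopologicalSpace A] [IsTopologicalRing A] [T2Space A]
        (D : Set ℂ) (L Linv : ℂ → Matrix (Fin N) (Fin N) A),
        EllipticAlgebra.IsRealization N ζ τ c D L Linv →
        ∀ x ∈ Algebra.adjoin ℂ
            (EllipticAlgebra.tGen N ζ τ c m n L Linv '' EllipticAlgebra.tDomain ζ τ c n D),
          ∀ y ∈ Algebra.adjoin ℂ
            (EllipticAlgebra.tGen N ζ τ c m n L Linv '' EllipticAlgebra.tDomain ζ τ c n D),
          Commute x y)) := by
  have hN0 : N ≠ 0 := by omega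
  have hY := fun (x : ℂ) (hx : EllipticAlgebra.Generic ζ τ c x) =>
    EllipticAlgebra.yFun_eq_one hN0 hq hcond hx
  refine ⟨hY, fun hτ hτs hcov => ?_⟩
  have hC : EllipticAlgebra.OnSurfaceCover N ζ τ c m n := by
    rcases hcov with rfl | h
    · exact EllipticAlgebra.onSurfaceCover_of_onSurface hS
    · exact h
  refine ⟨fun D ξ hξ η hη hg => EllipticAlgebra.commute_tGen hN0 hq hτ hτs hC
    (EllipticAlgebra.exchangeRelations_alg N ζ τ c D) hξ hη hg (hY _ hg), ?_⟩
  intro A _ _ _ _ _ D L Linv hL x hx y hy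
  refine EllipticAlgebra.commute_of_mem_adjoin ?_ hx hy
  rintro _ ⟨ξ, hξ, rfl⟩ _ ⟨η, hη, rfl⟩
  exact hL.commute_tGen_of_generic (fun ξ hξ η hη hg => EllipticAlgebra.commute_tGen hN0 hq hτ hτs
    hC hL.exchangeRelations hξ hη hg (hY _ hg)) hξ hη
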